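/- Let $G$ be a locally compact (Hausdorff) group with a fixed left Haar measure, written $dx$, and let $(\Phi,\Psi)$ be a complementary pair of $N$-functions: $\Phi:\mathbb R\to[0,\infty)$ is even, convex and continuous, $\Phi(x)=0$ iff $x=0$, $\Phi(x)/x\to0$ as $x\to0$ and $\Phi(x)/x\to\infty$ as $x\to\infty$, and $\Psi(y)=\sup\{x|y|-\Phi(x):x\ge0\}$. Assume that both $\varphi=\Phi$ and $\varphi=\Psi$ satisfy the $\Delta_2$-condition: there are $k>0$ and $x_0\ge0$ with $\varphi(2x)\le k\,\varphi(x)$ for all $x\ge x_0$, where $x_0=0$ if $G$ is not compact. Let $$L^\Phi(G)=\Big\{f:G\to\mathbb C \text{ measurable}:\ \int_G\Phi(\alpha|f|)\,dx<\infty\text{ for some }\alpha>0\Big\}$$ (modulo equality almost everywhere), with either the Luxemburg norm $\inf\{k>0:\int_G\Phi(|f|/k)\,dx\le1\}$ or the Orlicz norm $\sup\{\int_G|fg|\,dx:\int_G\Psi(|g|)\,dx\le1\}$, and let $\mathcal B(L^\Phi(G))$ be the algebra of bounded linear operators on $L^\Phi(G)$ with the operator norm. For $\mu$ in the algebra $M(G)$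 of complex regular Borel measures let $\lambda_\Phi(\mu)g=\mu*g$, $(\mu*g)(x)=\int g(y^{-1}x)\,d\mu(y)$, and for $f\in L^1(G)$ let $\lambda_\Phi(f)=\lambda_\Phi(f\,dx)$. Define * $PF_\Phi(G)$: the norm closure of $\{\lambda_\Phi(f):f\in L^1(G)\}$ in $\mathcal B(L^\Phi(G))$; * $PM_\Phi(G)$: the closure of $\{\lambda_\Phi(\mu):\mu\in M(G)\}$ in $\mathcal B(L^\Phi(G))$ in the ultraweak ($w^*$-) topology, i.e. the topology given by the functionals $T\mapsto\sum_n\varphi_n(Tx_n)$ with $x_n\in L^\Phi(G)$, $\varphi_n\in L^\Phi(G)^*$ and $\sum_n\|x_n\|\|\varphi_n\|<\infty$; * $CV_\Phi(G)$: the set of $T\in\mathcal B(L^\Phi(G))$ with $T(f*g)=T(f)*g$ for all $f,g\in C_c(G)$, where $(f*g)(x)=\int_G f(y)g(y^{-1}x)\,dy$; * $\mathcal M_l(\mathcal A)=\{M\in\mathcal B(\mathcal A):M(ab)=M(a)b\text{ for all }a,b\in\mathcal A\}$ for a Banach algebra $\mathcal A$, with the operator norm. Then there are isometric inclusions $$PF_\Phi(G)\subseteq\mathcal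 M_l(PF_\Phi(G))\subseteq PM_\Phi(G)\subseteq CV_\Phi(G).$$ In detail: $PF_\Phi(G)$ is a subalgebra of $\mathcal B(L^\Phi(G))$; the canonical map $PF_\Phi(G)\to\mathcal M_l(PF_\Phi(G))$, $T\mapsto L_T$, $L_T(S)=TS$, is isometric; there is exactly one unital algebra homomorphism $\iota:\mathcal M_l(PF_\Phi(G))\to\mathcal B(L^\Phi(G))$ with $\iota(L_T)=T$ for all $T\in PF_\Phi(G)$; it is isometric and satisfies $\iota(M)\,T=M(T)$ for all $M\in\mathcal M_l(PF_\Phi(G))$ and $T\in PF_\Phi(G)$; and $$PF_\Phi(G)\subseteq\iota\big(\mathcal M_l(PF_\Phi(G))\big)\subseteq PM_\Phi(G)\subseteq CV_\Phi(G)$$ as subsets of $\mathcal B(L^\Phi(G))$. -/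

import Mathlib

open MeasureTheory Filter Topology Set
open scoped ENNReal

noncomputable section

namespace OrliczConv

/-! ### N-functions -/

/-- An `N`-function: a continuous, even, convex function `Φ : ℝ → [0, ∞)` vanishing exactly at `0`,
with `Φ(x)/x → 0` as `x → 0` and `Φ(x)/x → ∞` as `x → ∞`. -/
structure NFunction where
  toFun : ℝ → ℝ
  nonneg : ∀ x, 0 ≤ toFun x
  even : ∀ x, toFun (-x) = toFun x
  convex : ConvexOn ℝ univ toFun
  continuous : Continuous toFun
  eq_zero_iff : ∀ x, toFun x = 0 ↔ x = 0
  tendsto_div_zero : Tendsto (fun x => toFun x / x) (𝓝[≠] 0) (𝓝 0)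
  tendsto_div_atTop : Tendsto (fun x => toFun x / x) atTop atTop

instance : CoeFun NFunction (fun _ => ℝ → ℝ) := ⟨NFunction.toFun⟩

/-- The complementary function `Ψ(y) = sup {x |y| - Φ(x) : x ≥ 0}`. The supremum is finite,
see `NFunction.bddAbove_complementary`. -/
def NFunction.complementary (Φ : NFunction) (y : ℝ) : ℝ :=
  sSup ((fun x : ℝ => x * |y| - Φ x) '' Ici 0)

/-- The `Δ₂`-condition of a function `φ` relative to a group `G` :
`φ(2x) ≤ k φ(x)` for all `x ≥ x₀`, where `x₀ = 0` if `G` is not compact (that is, if the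
Haar measure of `G` is infinite). -/
def DeltaTwo (G : Type*) [TopologicalSpace G] (φ : ℝ → ℝ) : Prop :=
  ∃ k : ℝ, 0 < k ∧ ∃ x₀ : ℝ, 0 ≤ x₀ ∧ (¬ CompactSpace G → x₀ = 0) ∧
    ∀ x, x₀ ≤ x → φ (2 * x) ≤ k * φ x

theorem NFunction.map_zero (Φ : NFunction) : Φ 0 = 0 := (Φ.eq_zero_iff 0).2 rfl

theorem NFunction.map_mul_le (Φ : NFunction) {t x : ℝ} (h0 : 0 ≤ t) (h1 : t ≤ 1) :
    Φ (t * x) ≤ t * Φ x := by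
  have h := Φ.convex.2 (mem_univ x) (mem_univ 0) h0 (sub_nonneg.2 h1) (by ring)
  simpa [Φ.map_zero] using h

theorem NFunction.mono (Φ : NFunction) {x y : ℝ} (hx : 0 ≤ x) (hxy : x ≤ y) : Φ x ≤ Φ y := by
  rcases hx.eq_or_lt with rfl | hx'
  · simpa [Φ.map_zero] using Φ.nonneg y
  · have hy : 0 < y := hx'.trans_le hxy
    have h := Φ.map_mul_le (t := x / y) (x := y) (by positivity) ((div_le_one hy).2 hxy)
    rw [div_mul_cancel₀ _ hy.ne'] at h
    exact h.trans (mul_le_of_le_one_left (Φ.nonneg y) ((div_le_one hy).2 hxy))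

theorem NFunction.bddAbove_complementary (Φ : NFunction) (y : ℝ) :
    BddAbove ((fun x : ℝ => x * |y| - Φ x) '' Ici 0) := by
  obtain ⟨R, hR⟩ := (Φ.tendsto_div_atTop.eventually_ge_atTop |y|).exists_forall_of_atTop
  refine ⟨max R 0 * |y|, ?_⟩
  rintro _ ⟨x, hx, rfl⟩
  have hx0 : (0 : ℝ) ≤ x := hx
  have hp : 0 ≤ max R 0 * |y| := by positivity
  by_cases hxR : x ≤ max R 0
  · have h1 : x * |y| ≤ max R 0 * |y| := mul_le_mul_of_nonneg_right hxR (abs_nonneg y)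
    have h2 := Φ.nonneg x
    change x * |y| - Φ x ≤ _
    linarith
  · push Not at hxR
    have hxpos : 0 < x := (le_max_right R 0).trans_lt hxR
    have h1 := hR x ((le_max_left R 0).trans hxR.le)
    rw [le_div_iff₀ hxpos] at h1
    change x * |y| - Φ x ≤ _
    linarith [mul_comm x |y|]

/-- Young's inequality. -/
theorem NFunction.young (Φ : NFunction) {x y : ℝ} (hx : 0 ≤ x) (hy : 0 ≤ y) :
    x * y ≤ Φ x + Φ.complementary y := by
  have h : x * |y| - Φ x ≤ Φ.complementary y :=
    le_csSup (Φ.bddAbove_complementary y) ⟨x, hx, rfl⟩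
  rw [abs_of_nonneg hy] at h
  linarith

theorem NFunction.complementary_nonneg (Φ : NFunction) (y : ℝ) : 0 ≤ Φ.complementary y := by
  refine le_csSup (Φ.bddAbove_complementary y) ⟨0, by simp, ?_⟩
  simp [Φ.map_zero]

theorem NFunction.complementary_zero (Φ : NFunction) : Φ.complementary 0 = 0 := by
  refine le_antisymm ?_ (Φ.complementary_nonneg 0)
  refine csSup_le ⟨_, 0, by simp, rfl⟩ ?_
  rintro _ ⟨x, -, rfl⟩
  simpa using Φ.nonneg x

theorem NFunction.complementary_le (Φ : NFunction) {t : ℝ} (h0 : 0 ≤ t) (h1 : t ≤ 1) :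
    Φ.complementary t ≤ t * Φ.complementary 1 := by
  refine csSup_le ⟨_, 0, by simp, rfl⟩ ?_
  rintro _ ⟨x, hx, rfl⟩
  have h := Φ.young (x := x) (y := 1) hx zero_le_one
  have h2 := mul_le_mul_of_nonneg_left h h0
  have h3 := mul_le_of_le_one_left (Φ.nonneg x) h1
  change x * |t| - Φ x ≤ _
  rw [abs_of_nonneg h0]
  nlinarith

/-! ### Orlicz spaces -/

section Orlicz

variable {α : Type*} [MeasurableSpace α]

/-- The modular `∫ φ(h) dμ`. -/
def modular (φ : ℝ → ℝ) (μ : Measure α) (h : α → ℝ) : ℝ≥0∞ :=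
  ∫⁻ x, ENNReal.ofReal (φ (h x)) ∂μ

theorem modular_mono (Φ : NFunction) (μ : Measure α) {h₁ h₂ : α → ℝ}
    (h0 : ∀ᵐ x ∂μ, 0 ≤ h₁ x) (hle : ∀ᵐ x ∂μ, h₁ x ≤ h₂ x) : modular Φ μ h₁ ≤ modular Φ μ h₂ :=
  lintegral_mono_ae (by
    filter_upwards [h0, hle] with x hx hx'
    exact ENNReal.ofReal_le_ofReal (Φ.mono hx hx'))

theorem modular_smul_le (Φ : NFunction) (μ : Measure α) (h : α → ℝ) {t : ℝ}
    (h0 : 0 ≤ t) (h1 : t ≤ 1) :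
    modular Φ μ (fun x => t * h x) ≤ ENNReal.ofReal t * modular Φ μ h := by
  unfold modular
  rw [← lintegral_const_mul' _ _ ENNReal.ofReal_ne_top]
  refine lintegral_mono fun x => ?_
  rw [← ENNReal.ofReal_mul h0]
  exact ENNReal.ofReal_le_ofReal (Φ.map_mul_le h0 h1)

theorem modular_convex (Φ : NFunction) (μ : Measure α) {h₁ h₂ : α → ℝ}
    (hm : AEMeasurable h₁ μ) {s t : ℝ} (hs : 0 ≤ s) (ht : 0 ≤ t) (hst : s + t = 1) :
    modular Φ μ (fun x => s * h₁ x + t * h₂ x) ≤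
      ENNReal.ofReal s * modular Φ μ h₁ + ENNReal.ofReal t * modular Φ μ h₂ := by
  unfold modular
  have hΦ : Measurable (Φ : ℝ → ℝ) := Φ.continuous.measurable
  rw [← lintegral_const_mul' _ _ ENNReal.ofReal_ne_top,
    ← lintegral_const_mul' _ _ ENNReal.ofReal_ne_top, ← lintegral_add_left' (by fun_prop)]
  refine lintegral_mono fun x => ?_
  rw [← ENNReal.ofReal_mul hs, ← ENNReal.ofReal_mul ht,
    ← ENNReal.ofReal_add (mul_nonneg hs (Φ.nonneg _)) (mul_nonneg ht (Φ.nonneg _))]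
  exact ENNReal.ofReal_le_ofReal (Φ.convex.2 (mem_univ _) (mem_univ _) hs ht hst)

/-- The Luxemburg (gauge) norm `inf {k > 0 : ∫ Φ(|f|/k) ≤ 1}`. -/
def luxemburgNorm (Φ : NFunction) (μ : Measure α) (f : α →ₘ[μ] ℂ) : ℝ :=
  sInf {k : ℝ | 0 < k ∧ modular Φ μ (fun x => ‖f x‖ / k) ≤ 1}

/-- The Orlicz norm `sup {∫ |f g| : ∫ Ψ(|g|) ≤ 1}`, with `Ψ` complementary to `Φ`, as an element
of `[0, ∞]`. -/
def orliczENorm (Φ : NFunction) (μ : Measure α) (f : α →ₘ[μ] ℂ) : ℝ≥0∞ :=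
  ⨆ g : {g : α →ₘ[μ] ℂ // modular Φ.complementary μ (fun x => ‖g x‖) ≤ 1},
    ∫⁻ x, ‖f x * (g : α →ₘ[μ] ℂ) x‖ₑ ∂μ

/-- The two standard norms of an Orlicz space. -/
inductive OrliczNormKind
  | luxemburg
  | orlicz

/-- The norm of the given kind. -/
def orliczNorm (κ : OrliczNormKind) (Φ : NFunction) (μ : Measure α) (f : α →ₘ[μ] ℂ) : ℝ :=
  match κ with
  | OrliczNormKind.luxemburg => luxemburgNorm Φ μ f
  | OrliczNormKind.orlicz => (orliczENorm Φ μ f).toReal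

/-- `f` belongs to `L^Φ` : `∫ Φ(a |f|) < ∞` for some `a > 0`. -/
def MemOrlicz (Φ : NFunction) (μ : Measure α) (f : α →ₘ[μ] ℂ) : Prop :=
  ∃ a : ℝ, 0 < a ∧ modular Φ μ (fun x => a * ‖f x‖) < ∞

theorem MemOrlicz.exists_le_one {Φ : NFunction} {μ : Measure α} {f : α →ₘ[μ] ℂ}
    (hf : MemOrlicz Φ μ f) : ∃ k : ℝ, 0 < k ∧ modular Φ μ (fun x => ‖f x‖ / k) ≤ 1 := by
  obtain ⟨a, ha, hfin⟩ := hf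
  set R := (modular Φ μ (fun x => a * ‖f x‖)).toReal with hR
  have hR0 : 0 ≤ R := ENNReal.toReal_nonneg
  have ht1 : (R + 1)⁻¹ ≤ 1 := inv_le_one_of_one_le₀ (by linarith)
  refine ⟨(R + 1) / a, by positivity, ?_⟩
  have h := modular_smul_le Φ μ (fun x => a * ‖f x‖) (t := (R + 1)⁻¹) (by positivity) ht1
  have he : (fun x => ‖f x‖ / ((R + 1) / a)) = fun x => (R + 1)⁻¹ * (a * ‖f x‖) := by
    ext x; field_simp
  rw [he]
  refine h.trans ?_
  rw [← ENNReal.ofReal_toReal hfin.ne, ← hR, ← ENNReal.ofReal_mul (by positivity),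
    ← ENNReal.ofReal_one]
  refine ENNReal.ofReal_le_ofReal ?_
  rw [inv_mul_le_iff₀ (by positivity)]
  linarith

theorem luxemburg_add_mem {Φ : NFunction} {μ : Measure α} {f g : α →ₘ[μ] ℂ} {k l : ℝ}
    (hk : 0 < k) (hl : 0 < l) (hf : modular Φ μ (fun x => ‖f x‖ / k) ≤ 1)
    (hg : modular Φ μ (fun x => ‖g x‖ / l) ≤ 1) :
    modular Φ μ (fun x => ‖(f + g) x‖ / (k + l)) ≤ 1 := by
  have hfm : AEMeasurable (fun x => ‖f x‖ / k) μ :=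
    (f.aestronglyMeasurable.norm.aemeasurable).div_const k
  have hst : k / (k + l) + l / (k + l) = 1 := by field_simp
  refine (modular_mono Φ μ (h₂ := fun x => k / (k + l) * (‖f x‖ / k) + l / (k + l) * (‖g x‖ / l))
    (ae_of_all _ fun x => by positivity) ?_).trans
    ((modular_convex Φ μ hfm (by positivity) (by positivity) hst).trans ?_)
  · filter_upwards [AEEqFun.coeFn_add f g] with x hx
    rw [hx, Pi.add_apply]
    have : k / (k + l) * (‖f x‖ / k) + l / (k + l) * (‖g x‖ / l) = (‖f x‖ + ‖g x‖) / (k + l) := by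
      field_simp
    rw [this]
    gcongr
    exact norm_add_le _ _
  · calc _ ≤ ENNReal.ofReal (k / (k + l)) * 1 + ENNReal.ofReal (l / (k + l)) * 1 := by gcongr
      _ = 1 := by
        rw [mul_one, mul_one, ← ENNReal.ofReal_add (by positivity) (by positivity), hst,
          ENNReal.ofReal_one]

theorem memOrlicz_of_le_one {Φ : NFunction} {μ : Measure α} {f : α →ₘ[μ] ℂ} {k : ℝ} (hk : 0 < k)
    (hf : modular Φ μ (fun x => ‖f x‖ / k) ≤ 1) : MemOrlicz Φ μ f := by
  refine ⟨k⁻¹, by positivity, lt_of_le_of_lt ?_ ENNReal.one_lt_top⟩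
  simpa only [div_eq_inv_mul] using hf

/-- `L^Φ(μ)` as a space of almost everywhere classes of measurable functions. -/
def orliczSubmodule (Φ : NFunction) (μ : Measure α) : Submodule ℂ (α →ₘ[μ] ℂ) where
  carrier := {f | MemOrlicz Φ μ f}
  zero_mem' := by
    refine memOrlicz_of_le_one one_pos (le_of_eq_of_le ?_ zero_le_one)
    refine (lintegral_congr_ae ?_).trans lintegral_zero
    filter_upwards [AEEqFun.coeFn_zero (α := α) (β := ℂ) (μ := μ)] with x hx
    simp [hx, Φ.map_zero]
  add_mem' := by
    intro f g hf hg
    obtain ⟨k, hk, hfk⟩ := MemOrlicz.exists_le_one hf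
    obtain ⟨l, hl, hgl⟩ := MemOrlicz.exists_le_one hg
    exact memOrlicz_of_le_one (add_pos hk hl) (luxemburg_add_mem hk hl hfk hgl)
  smul_mem' := by
    rintro c f ⟨a, ha, hfin⟩
    refine ⟨a / (‖c‖ + 1), by positivity, lt_of_le_of_lt ?_ hfin⟩
    refine modular_mono Φ μ (ae_of_all _ fun x => by positivity) ?_
    filter_upwards [AEEqFun.coeFn_smul c f] with x hx
    rw [hx, Pi.smul_apply, norm_smul, div_mul_eq_mul_div, div_le_iff₀ (by positivity)]
    have := norm_nonneg (f x)
    have h2 : 0 ≤ a * ‖f x‖ := by positivity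
    nlinarith

theorem orliczENorm_lt_top {Φ : NFunction} {μ : Measure α} {f : α →ₘ[μ] ℂ}
    (hf : MemOrlicz Φ μ f) : orliczENorm Φ μ f < ∞ := by
  obtain ⟨a, ha, hfin⟩ := hf
  have key : orliczENorm Φ μ f ≤
      ENNReal.ofReal a⁻¹ * (modular Φ μ (fun x => a * ‖f x‖) + 1) := by
    refine iSup_le fun g => ?_
    have hΦ : Measurable (Φ : ℝ → ℝ) := Φ.continuous.measurable
    have hfm : AEMeasurable (fun x => ‖f x‖) μ := f.aestronglyMeasurable.norm.aemeasurable
    calc ∫⁻ x, ‖f x * (g : α →ₘ[μ] ℂ) x‖ₑ ∂μ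
        ≤ ∫⁻ x, ENNReal.ofReal a⁻¹ * (ENNReal.ofReal (Φ (a * ‖f x‖)) +
            ENNReal.ofReal (Φ.complementary ‖(g : α →ₘ[μ] ℂ) x‖)) ∂μ := by
          refine lintegral_mono fun x => ?_
          rw [← ENNReal.ofReal_add (Φ.nonneg _) (Φ.complementary_nonneg _),
            ← ENNReal.ofReal_mul (by positivity), ← ofReal_norm, norm_mul]
          refine ENNReal.ofReal_le_ofReal ?_
          rw [le_inv_mul_iff₀ ha, ← mul_assoc]
          exact Φ.young (by positivity) (by positivity)
      _ = ENNReal.ofReal a⁻¹ * (modular Φ μ (fun x => a * ‖f x‖) +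
            modular Φ.complementary μ (fun x => ‖(g : α →ₘ[μ] ℂ) x‖)) := by
          rw [lintegral_const_mul' _ _ ENNReal.ofReal_ne_top, lintegral_add_left' (by fun_prop)]
          rfl
      _ ≤ _ := by gcongr; exact g.2
  exact key.trans_lt (ENNReal.mul_lt_top ENNReal.ofReal_lt_top
    (ENNReal.add_lt_top.2 ⟨hfin, ENNReal.one_lt_top⟩))

theorem orliczENorm_add_le {Φ : NFunction} {μ : Measure α} (f g : α →ₘ[μ] ℂ) :
    orliczENorm Φ μ (f + g) ≤ orliczENorm Φ μ f + orliczENorm Φ μ g := by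
  refine iSup_le fun h => ?_
  have hm : AEMeasurable (fun x => ‖f x * (h : α →ₘ[μ] ℂ) x‖ₑ) μ :=
    (f.aestronglyMeasurable.mul (h : α →ₘ[μ] ℂ).aestronglyMeasurable).enorm
  calc ∫⁻ x, ‖(f + g) x * (h : α →ₘ[μ] ℂ) x‖ₑ ∂μ
      ≤ ∫⁻ x, (‖f x * (h : α →ₘ[μ] ℂ) x‖ₑ + ‖g x * (h : α →ₘ[μ] ℂ) x‖ₑ) ∂μ := by
        refine lintegral_mono_ae ?_
        filter_upwards [AEEqFun.coeFn_add f g] with x hx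
        rw [hx, Pi.add_apply, add_mul]
        exact enorm_add_le _ _
    _ = _ := lintegral_add_left' hm _
    _ ≤ _ := add_le_add
        (le_iSup (fun h : {g : α →ₘ[μ] ℂ // modular Φ.complementary μ (fun x => ‖g x‖) ≤ 1} =>
          ∫⁻ x, ‖f x * (h : α →ₘ[μ] ℂ) x‖ₑ ∂μ) h)
        (le_iSup (fun h : {g : α →ₘ[μ] ℂ // modular Φ.complementary μ (fun x => ‖g x‖) ≤ 1} =>
          ∫⁻ x, ‖g x * (h : α →ₘ[μ] ℂ) x‖ₑ ∂μ) h)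

theorem orliczENorm_smul {Φ : NFunction} {μ : Measure α} (c : ℂ) (f : α →ₘ[μ] ℂ) :
    orliczENorm Φ μ (c • f) = ‖c‖ₑ * orliczENorm Φ μ f := by
  unfold orliczENorm
  rw [ENNReal.mul_iSup]
  congr 1
  ext h
  rw [← lintegral_const_mul' _ _ (by simp)]
  refine lintegral_congr_ae ?_
  filter_upwards [AEEqFun.coeFn_smul c f] with x hx
  rw [hx, Pi.smul_apply, smul_eq_mul, mul_assoc, enorm_mul]

theorem eq_zero_of_orliczENorm {Φ : NFunction} {μ : Measure α} {f : α →ₘ[μ] ℂ}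
    (hf : MemOrlicz Φ μ f) (h0 : orliczENorm Φ μ f = 0) : f = 0 := by
  obtain ⟨a, ha, hfin⟩ := hf
  have hΦ : Measurable (Φ : ℝ → ℝ) := Φ.continuous.measurable
  have hfm : Measurable f := f.measurable
  have hlevel : ∀ n : ℕ, μ {x | ((n : ℝ) + 1)⁻¹ < ‖f x‖} = 0 := by
    intro n
    set ε : ℝ := ((n : ℝ) + 1)⁻¹ with hε
    have hεpos : 0 < ε := by positivity
    set S := {x | ε < ‖f x‖} with hS
    have hSm : MeasurableSet S := measurableSet_lt measurable_const hfm.norm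
    have hpos : 0 < Φ (a * ε) := lt_of_le_of_ne (Φ.nonneg _) (fun h => by
      have := (Φ.eq_zero_iff _).1 h.symm
      exact (mul_pos ha hεpos).ne' this)
    have hSfin : μ S < ∞ := by
      have hmark := mul_meas_ge_le_lintegral₀ (μ := μ)
        (f := fun x => ENNReal.ofReal (Φ (a * ‖f x‖))) (by fun_prop)
        (ENNReal.ofReal (Φ (a * ε)))
      have hsub : S ⊆ {x | ENNReal.ofReal (Φ (a * ε)) ≤ ENNReal.ofReal (Φ (a * ‖f x‖))} := by
        intro x hx
        have hx' : ε < ‖f x‖ := hx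
        exact ENNReal.ofReal_le_ofReal (Φ.mono (by positivity) (by gcongr))
      have h1 : ENNReal.ofReal (Φ (a * ε)) * μ S < ∞ :=
        (mul_le_mul_right (measure_mono hsub) _).trans_lt (hmark.trans_lt hfin)
      rcases ENNReal.mul_lt_top_iff.1 h1 with h | h | h
      · exact h.2
      · simp [ENNReal.ofReal_eq_zero] at h; linarith
      · rw [h]; exact ENNReal.zero_lt_top
    set m := (μ S).toReal with hm
    have hm0 : 0 ≤ m := ENNReal.toReal_nonneg
    have hΨ1 := Φ.complementary_nonneg 1
    set c : ℝ := (Φ.complementary 1 * m + 1)⁻¹ with hc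
    have hc0 : 0 < c := by positivity
    have hc1 : c ≤ 1 := inv_le_one_of_one_le₀ (by nlinarith)
    let g₀ : α → ℂ := S.indicator fun _ => (c : ℂ)
    have hg₀ : AEStronglyMeasurable g₀ μ :=
      (stronglyMeasurable_const.indicator hSm).aestronglyMeasurable
    have hg : modular Φ.complementary μ (fun x => ‖(AEEqFun.mk g₀ hg₀) x‖) ≤ 1 := by
      have : modular Φ.complementary μ (fun x => ‖(AEEqFun.mk g₀ hg₀) x‖) =
          ∫⁻ x, S.indicator (fun _ => ENNReal.ofReal (Φ.complementary c)) x ∂μ := by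
        refine lintegral_congr_ae ?_
        filter_upwards [AEEqFun.coeFn_mk g₀ hg₀] with x hx
        rw [hx]
        by_cases hxS : x ∈ S
        · simp [g₀, hxS, abs_of_pos hc0]
        · simp [g₀, hxS, Φ.complementary_zero]
      rw [this, lintegral_indicator_const hSm, ← ENNReal.ofReal_toReal hSfin.ne, ← hm,
        ← ENNReal.ofReal_mul (Φ.complementary_nonneg _), ← ENNReal.ofReal_one]
      refine ENNReal.ofReal_le_ofReal ?_
      calc Φ.complementary c * m ≤ c * Φ.complementary 1 * m := by
            gcongr; exact Φ.complementary_le hc0.le hc1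
        _ ≤ 1 := by
            rw [mul_assoc, hc, inv_mul_le_iff₀ (by positivity)]; linarith
    have hz : ∫⁻ x, ‖f x * (AEEqFun.mk g₀ hg₀) x‖ₑ ∂μ = 0 := by
      refine le_antisymm ?_ zero_le
      rw [← h0]
      exact le_iSup (fun h : {g : α →ₘ[μ] ℂ //
        modular Φ.complementary μ (fun x => ‖g x‖) ≤ 1} =>
          ∫⁻ x, ‖f x * (h : α →ₘ[μ] ℂ) x‖ₑ ∂μ) ⟨AEEqFun.mk g₀ hg₀, hg⟩
    have hm' : AEMeasurable (fun x => ‖f x * (AEEqFun.mk g₀ hg₀) x‖ₑ) μ :=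
      (f.aestronglyMeasurable.mul (AEEqFun.mk g₀ hg₀).aestronglyMeasurable).enorm
    rw [lintegral_eq_zero_iff' hm'] at hz
    have hae : ∀ᵐ x ∂μ, x ∉ S := by
      filter_upwards [hz, AEEqFun.coeFn_mk g₀ hg₀] with x hx hx' hxS
      have hxS' : ε < ‖f x‖ := hxS
      rw [Pi.zero_apply, enorm_eq_zero, hx'] at hx
      simp only [g₀, indicator_of_mem hxS, mul_eq_zero, Complex.ofReal_eq_zero] at hx
      rcases hx with hx | hx
      · rw [hx, norm_zero] at hxS'; linarith
      · exact hc0.ne' hx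
    simpa using measure_eq_zero_iff_ae_notMem.2 hae
  refine AEEqFun.ext ?_
  have hall : ∀ᵐ x ∂μ, ∀ n : ℕ, ¬ ((n : ℝ) + 1)⁻¹ < ‖f x‖ :=
    ae_all_iff.2 fun n => measure_eq_zero_iff_ae_notMem.1 (hlevel n)
  filter_upwards [hall, AEEqFun.coeFn_zero (α := α) (β := ℂ) (μ := μ)] with x hx hx0
  rw [hx0, Pi.zero_apply, ← norm_eq_zero]
  by_contra hne
  obtain ⟨n, hn⟩ := exists_nat_one_div_lt (lt_of_le_of_ne (norm_nonneg (f x)) (Ne.symm hne))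
  exact hx n (by simpa [one_div] using hn)

theorem luxemburgNorm_nonneg (Φ : NFunction) (μ : Measure α) (f : α →ₘ[μ] ℂ) :
    0 ≤ luxemburgNorm Φ μ f :=
  Real.sInf_nonneg fun _ hk => hk.1.le

theorem luxemburgNorm_le {Φ : NFunction} {μ : Measure α} {f : α →ₘ[μ] ℂ} {k : ℝ} (hk : 0 < k)
    (h : modular Φ μ (fun x => ‖f x‖ / k) ≤ 1) : luxemburgNorm Φ μ f ≤ k :=
  csInf_le ⟨0, fun _ hk => hk.1.le⟩ ⟨hk, h⟩

theorem exists_lt_of_luxemburgNorm_lt {Φ : NFunction} {μ : Measure α} {f : α →ₘ[μ] ℂ}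
    (hf : MemOrlicz Φ μ f) {r : ℝ} (hr : luxemburgNorm Φ μ f < r) :
    ∃ k, 0 < k ∧ k < r ∧ modular Φ μ (fun x => ‖f x‖ / k) ≤ 1 := by
  obtain ⟨k, hk, hkr⟩ := exists_lt_of_csInf_lt (MemOrlicz.exists_le_one hf) hr
  exact ⟨k, hk.1, hkr, hk.2⟩

theorem luxemburgNorm_add_le {Φ : NFunction} {μ : Measure α} {f g : α →ₘ[μ] ℂ}
    (hf : MemOrlicz Φ μ f) (hg : MemOrlicz Φ μ g) :
    luxemburgNorm Φ μ (f + g) ≤ luxemburgNorm Φ μ f + luxemburgNorm Φ μ g := by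
  refine le_of_forall_pos_le_add fun ε hε => ?_
  obtain ⟨k, hk, hkr, hfk⟩ :=
    exists_lt_of_luxemburgNorm_lt hf (lt_add_of_pos_right _ (half_pos hε))
  obtain ⟨l, hl, hlr, hgl⟩ :=
    exists_lt_of_luxemburgNorm_lt hg (lt_add_of_pos_right _ (half_pos hε))
  have := luxemburgNorm_le (add_pos hk hl) (luxemburg_add_mem hk hl hfk hgl)
  linarith

theorem luxemburgNorm_smul_le {Φ : NFunction} {μ : Measure α} {f : α →ₘ[μ] ℂ}
    (hf : MemOrlicz Φ μ f) (c : ℂ) :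
    luxemburgNorm Φ μ (c • f) ≤ ‖c‖ * luxemburgNorm Φ μ f := by
  have key : ∀ k : ℝ, 0 < k → modular Φ μ (fun x => ‖f x‖ / k) ≤ 1 → ∀ d : ℝ, ‖c‖ ≤ d → 0 < d →
      luxemburgNorm Φ μ (c • f) ≤ d * k := by
    intro k hk hfk d hcd hd
    refine luxemburgNorm_le (mul_pos hd hk) ((modular_mono Φ μ
      (ae_of_all _ fun x => by positivity) ?_).trans hfk)
    filter_upwards [AEEqFun.coeFn_smul c f] with x hx
    rw [hx, Pi.smul_apply, norm_smul, div_le_div_iff₀ (by positivity) hk]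
    have h2 : 0 ≤ ‖f x‖ * k := by positivity
    nlinarith
  have key2 : ∀ d : ℝ, ‖c‖ ≤ d → 0 < d →
      luxemburgNorm Φ μ (c • f) ≤ d * luxemburgNorm Φ μ f := by
    intro d hcd hd
    rw [← div_le_iff₀' hd]
    refine le_csInf (MemOrlicz.exists_le_one hf) fun k hk => ?_
    rw [div_le_iff₀' hd]
    exact key k hk.1 hk.2 d hcd hd
  refine le_of_forall_pos_le_add fun ε hε => ?_
  set N := luxemburgNorm Φ μ f with hN
  have hN0 : 0 ≤ N := luxemburgNorm_nonneg Φ μ f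
  have h := key2 (‖c‖ + ε / (N + 1)) (le_add_of_nonneg_right (by positivity)) (by positivity)
  refine h.trans ?_
  have : ε / (N + 1) * N ≤ ε := by
    rw [div_mul_eq_mul_div, div_le_iff₀ (by positivity)]
    nlinarith
  linarith [add_mul ‖c‖ (ε / (N + 1)) N]

theorem eq_zero_of_luxemburgNorm {Φ : NFunction} {μ : Measure α} {f : α →ₘ[μ] ℂ}
    (hf : MemOrlicz Φ μ f) (h0 : luxemburgNorm Φ μ f = 0) : f = 0 := by
  have hΦ : Measurable (Φ : ℝ → ℝ) := Φ.continuous.measurable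
  have hfm : AEMeasurable (fun x => ‖f x‖) μ := f.aestronglyMeasurable.norm.aemeasurable
  have hle : ∀ ε : ℝ, 0 < ε → ε ≤ 1 → modular Φ μ (fun x => ‖f x‖) ≤ ENNReal.ofReal ε := by
    intro ε hε hε1
    obtain ⟨k, hk, hkε, hfk⟩ := exists_lt_of_luxemburgNorm_lt hf (h0.trans_lt hε)
    have h := modular_smul_le Φ μ (fun x => ‖f x‖ / k) (t := k) hk.le (hkε.le.trans hε1)
    have he : (fun x => k * (‖f x‖ / k)) = fun x => ‖f x‖ := by ext x; field_simp
    rw [he] at h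
    refine h.trans ?_
    calc ENNReal.ofReal k * modular Φ μ (fun x => ‖f x‖ / k) ≤ ENNReal.ofReal ε * 1 := by
          gcongr
      _ = _ := mul_one _
  have hz : modular Φ μ (fun x => ‖f x‖) = 0 := by
    by_contra hne
    have hlt : modular Φ μ (fun x => ‖f x‖) ≠ ∞ :=
      ((hle 1 one_pos le_rfl).trans_lt ENNReal.ofReal_lt_top).ne
    set r := (modular Φ μ (fun x => ‖f x‖)).toReal with hr
    have hr0 : 0 < r := ENNReal.toReal_pos hne hlt
    have h := hle (min 1 (r / 2)) (by positivity) (min_le_left _ _)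
    rw [← ENNReal.ofReal_toReal hlt, ← hr, ENNReal.ofReal_le_ofReal_iff (by positivity)] at h
    have := min_le_right 1 (r / 2)
    linarith
  unfold modular at hz
  rw [lintegral_eq_zero_iff' (by fun_prop)] at hz
  refine AEEqFun.ext ?_
  filter_upwards [hz, AEEqFun.coeFn_zero (α := α) (β := ℂ) (μ := μ)] with x hx hx0
  rw [hx0, Pi.zero_apply, ← norm_eq_zero, ← Φ.eq_zero_iff]
  exact le_antisymm (ENNReal.ofReal_eq_zero.1 hx) (Φ.nonneg _)

/-- The Orlicz space `L^Φ(μ)` with the norm of kind `κ`. -/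
def OrliczSpace (_κ : OrliczNormKind) (Φ : NFunction) (μ : Measure α) : Type _ :=
  orliczSubmodule Φ μ

variable {κ : OrliczNormKind} {Φ : NFunction} {μ : Measure α}

@[reducible]
def OrliczSpace.addCommGroup : AddCommGroup (OrliczSpace κ Φ μ) :=
  inferInstanceAs (AddCommGroup (orliczSubmodule Φ μ))

attribute [local instance] OrliczSpace.addCommGroup

@[reducible]
def OrliczSpace.module : Module ℂ (OrliczSpace κ Φ μ) :=
  inferInstanceAs (Module ℂ (orliczSubmodule Φ μ))

attribute [local instance] OrliczSpace.module

/-- The almost everywhere class underlying an element of `L^Φ`. -/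
def OrliczSpace.toAEEqFun (u : OrliczSpace κ Φ μ) : α →ₘ[μ] ℂ :=
  ((show orliczSubmodule Φ μ from u) : α →ₘ[μ] ℂ)

/-- A (measurable) representative of an element of `L^Φ`. -/
instance : CoeFun (OrliczSpace κ Φ μ) (fun _ => α → ℂ) := ⟨fun u => u.toAEEqFun⟩

@[reducible]
def OrliczSpace.norm : Norm (OrliczSpace κ Φ μ) := ⟨fun u => orliczNorm κ Φ μ u.toAEEqFun⟩

attribute [local instance] OrliczSpace.norm

theorem OrliczSpace.mem (u : OrliczSpace κ Φ μ) : MemOrlicz Φ μ u.toAEEqFun :=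
  (show orliczSubmodule Φ μ from u).2

theorem OrliczSpace.normedSpaceCore : NormedSpace.Core ℂ (OrliczSpace κ Φ μ) where
  norm_nonneg u := by
    cases κ
    · exact luxemburgNorm_nonneg Φ μ _
    · exact ENNReal.toReal_nonneg
  norm_smul c u := by
    cases κ
    · change luxemburgNorm Φ μ (c • u.toAEEqFun) = ‖c‖ * luxemburgNorm Φ μ u.toAEEqFun
      refine le_antisymm (luxemburgNorm_smul_le u.mem c) ?_
      rcases eq_or_ne c 0 with rfl | hc
      · simpa using luxemburgNorm_nonneg Φ μ _
      · have hcm : MemOrlicz Φ μ (c • u.toAEEqFun) := (orliczSubmodule Φ μ).smul_mem c u.mem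
        have h := luxemburgNorm_smul_le hcm c⁻¹
        rw [inv_smul_smul₀ hc, norm_inv, le_inv_mul_iff₀ (norm_pos_iff.2 hc)] at h
        exact h
    · change (orliczENorm Φ μ (c • u.toAEEqFun)).toReal = ‖c‖ * (orliczENorm Φ μ u.toAEEqFun).toReal
      rw [orliczENorm_smul, ENNReal.toReal_mul, toReal_enorm]
  norm_triangle u v := by
    cases κ
    · exact luxemburgNorm_add_le u.mem v.mem
    · change (orliczENorm Φ μ (u.toAEEqFun + v.toAEEqFun)).toReal ≤ _
      refine (ENNReal.toReal_mono ?_ (orliczENorm_add_le _ _)).trans ENNReal.toReal_add_le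
      exact (ENNReal.add_lt_top.2 ⟨orliczENorm_lt_top u.mem, orliczENorm_lt_top v.mem⟩).ne
  norm_eq_zero_iff u := by
    cases κ
    · constructor
      · intro h
        exact Subtype.ext (eq_zero_of_luxemburgNorm u.mem h)
      · rintro rfl
        have h := luxemburgNorm_smul_le
          (show MemOrlicz Φ μ (0 : α →ₘ[μ] ℂ) from (orliczSubmodule Φ μ).zero_mem) 0
        rw [zero_smul ℂ (0 : α →ₘ[μ] ℂ), norm_zero, zero_mul] at h
        exact le_antisymm h (luxemburgNorm_nonneg Φ μ _)
    · constructor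
      · intro h
        have h' : (orliczENorm Φ μ u.toAEEqFun).toReal = 0 := h
        rw [ENNReal.toReal_eq_zero_iff] at h'
        exact Subtype.ext (eq_zero_of_orliczENorm u.mem
          (h'.resolve_right (orliczENorm_lt_top u.mem).ne))
      · rintro rfl
        change (orliczENorm Φ μ (0 : α →ₘ[μ] ℂ)).toReal = 0
        rw [← zero_smul ℂ (0 : α →ₘ[μ] ℂ), orliczENorm_smul]
        simp

@[reducible]
def OrliczSpace.preNormedAddCommGroup (κ : OrliczNormKind) (Φ : NFunction) (μ : Measure α) :
    NormedAddCommGroup (OrliczSpace κ Φ μ) :=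
  NormedAddCommGroup.ofCore OrliczSpace.normedSpaceCore

@[reducible]
def OrliczSpace.preNormedSpace (κ : OrliczNormKind) (Φ : NFunction) (μ : Measure α) :
    @NormedSpace ℂ (OrliczSpace κ Φ μ) _
      (OrliczSpace.preNormedAddCommGroup κ Φ μ).toSeminormedAddCommGroup :=
  letI := OrliczSpace.preNormedAddCommGroup κ Φ μ
  NormedSpace.ofCore OrliczSpace.normedSpaceCore

/-- The normed group structure of `L^Φ`; it is sealed after the basic facts below. -/
instance OrliczSpace.normedAddCommGroup (κ : OrliczNormKind) (Φ : NFunction) (μ : Measure α) :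
    NormedAddCommGroup (OrliczSpace κ Φ μ) :=
  OrliczSpace.preNormedAddCommGroup κ Φ μ

/-- The normed space structure of `L^Φ`; it is sealed after the basic facts below. -/
instance OrliczSpace.normedSpace (κ : OrliczNormKind) (Φ : NFunction) (μ : Measure α) :
    @NormedSpace ℂ (OrliczSpace κ Φ μ) _
      (OrliczSpace.normedAddCommGroup κ Φ μ).toSeminormedAddCommGroup :=
  OrliczSpace.preNormedSpace κ Φ μ

end Orlicz

section OrliczInstances

variable {α : Type*} [MeasurableSpace α] {κ : OrliczNormKind} {Φ : NFunction} {μ : Measure α}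

/-- The element of `L^Φ` given by a class with finite modular. -/
def OrliczSpace.mk (f : α →ₘ[μ] ℂ) (hf : MemOrlicz Φ μ f) : OrliczSpace κ Φ μ :=
  (⟨f, hf⟩ : orliczSubmodule Φ μ)

theorem OrliczSpace.toAEEqFun_mk (f : α →ₘ[μ] ℂ) (hf : MemOrlicz Φ μ f) :
    (OrliczSpace.mk f hf : OrliczSpace κ Φ μ).toAEEqFun = f := rfl

theorem OrliczSpace.toAEEqFun_injective :
    Function.Injective (OrliczSpace.toAEEqFun (κ := κ) (Φ := Φ) (μ := μ)) :=
  fun _ _ h => Subtype.ext h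

theorem OrliczSpace.norm_eq (u : OrliczSpace κ Φ μ) : ‖u‖ = orliczNorm κ Φ μ u.toAEEqFun := rfl

theorem OrliczSpace.toAEEqFun_zero : (0 : OrliczSpace κ Φ μ).toAEEqFun = 0 := rfl

theorem OrliczSpace.toAEEqFun_add (u v : OrliczSpace κ Φ μ) :
    (u + v).toAEEqFun = u.toAEEqFun + v.toAEEqFun := rfl

theorem OrliczSpace.toAEEqFun_neg (u : OrliczSpace κ Φ μ) :
    (-u).toAEEqFun = -u.toAEEqFun := rfl

theorem OrliczSpace.toAEEqFun_sub (u v : OrliczSpace κ Φ μ) :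
    (u - v).toAEEqFun = u.toAEEqFun - v.toAEEqFun := rfl

theorem OrliczSpace.toAEEqFun_smul (c : ℂ) (u : OrliczSpace κ Φ μ) :
    (c • u).toAEEqFun = c • u.toAEEqFun := rfl

attribute [irreducible] OrliczSpace.normedAddCommGroup OrliczSpace.normedSpace

end OrliczInstances

/-! ### Left multiplier algebras and the ultraweak topology -/

/-- A subalgebra of a normed algebra, with the inherited norm. -/
instance {B : Type*} [NonUnitalNormedRing B] [NormedSpace ℂ B] (A : NonUnitalSubalgebra ℂ B) :
    NormedSpace ℂ A where
  norm_smul_le c a := norm_smul_le c (a : B)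

/-- The left multiplier algebra `M_l(A) = {M ∈ B(A) : M(ab) = M(a) b}`, as a subalgebra
of `B(A)`. -/
def leftMultiplier (A : Type*) [NonUnitalNormedRing A] [NormedSpace ℂ A] [IsScalarTower ℂ A A]
    [SMulCommClass ℂ A A] : Subalgebra ℂ (A →L[ℂ] A) where
  carrier := {M | ∀ a b : A, M (a * b) = M a * b}
  mul_mem' := by
    intro M N hM hN a b
    change M (N (a * b)) = M (N a) * b
    rw [hN a b, hM (N a) b]
  add_mem' := by
    intro M N hM hN a b
    change M (a * b) + N (a * b) = (M a + N a) * b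
    rw [hM a b, hN a b, add_mul]
  algebraMap_mem' := by
    intro c a b
    simp [Algebra.algebraMap_eq_smul_one, smul_mul_assoc]

/-- Left multiplication `b ↦ a b` as an element of `M_l(A)`; this is the canonical map
`A → M_l(A)`. -/
def leftMul {A : Type*} [NonUnitalNormedRing A] [NormedSpace ℂ A] [IsScalarTower ℂ A A]
    [SMulCommClass ℂ A A] (a : A) : leftMultiplier A :=
  ⟨ContinuousLinearMap.mul ℂ A a, fun b c => by simp [mul_assoc]⟩

/-- The isometric inclusions `S ⊆ M_l(S) ⊆ P` inside a unital normed algebra `B` :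
* `S` is (the underlying set of) a subalgebra `A` of `B`;
* the canonical map `A → M_l(A)`, `T ↦ (left multiplication by T)`, is isometric;
* there is a unital algebra homomorphism `ι : M_l(A) → B` which extends the inclusion of `A`
  in `B`, for which every `M` acts on `A` as the product in `B` with `ι M`, which is the only
  unital algebra homomorphism extending the inclusion of `A`, and which is isometric;
* under the identification of `M_l(A)` with its image under `ι`, `S ⊆ M_l(A) ⊆ P`. -/
def MultiplierInclusions {B : Type*} [NormedRing B] [NormedAlgebra ℂ B] (S P : Set B) : Prop :=
  ∃ A : NonUnitalSubalgebra ℂ B, (A : Set B) = S ∧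
    (∀ T : A, ‖(leftMul T : A →L[ℂ] A)‖ = ‖T‖) ∧
    ∃ ι : leftMultiplier A →ₐ[ℂ] B,
      (∀ T : A, ι (leftMul T) = T) ∧
      (∀ (M : leftMultiplier A) (T : A), ι M * (T : B) = ((M : A →L[ℂ] A) T : A)) ∧
      (∀ ι' : leftMultiplier A →ₐ[ℂ] B, (∀ T : A, ι' (leftMul T) = T) → ι' = ι) ∧
      (∀ M : leftMultiplier A, ‖ι M‖ = ‖(M : A →L[ℂ] A)‖) ∧
      S ⊆ Set.range ι ∧ Set.range ι ⊆ P

/-- The ultraweak topology on `B(E)`: the coarsest topology making all the functionals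
`T ↦ ∑ₙ φₙ(T xₙ)` with `xₙ ∈ E`, `φₙ ∈ E*`, `∑ₙ ‖xₙ‖ ‖φₙ‖ < ∞`, continuous. For reflexive `E`
these are exactly the elements of the predual (the projective tensor product of `E` and `E*`)
of `B(E)`, and this is the weak-* topology. -/
@[reducible]
def ultraweakTopology (E : Type*) [NormedAddCommGroup E] [NormedSpace ℂ E] :
    TopologicalSpace (E →L[ℂ] E) :=
  TopologicalSpace.induced
    (fun (T : E →L[ℂ] E)
        (p : {p : (ℕ → E) × (ℕ → (E →L[ℂ] ℂ)) // Summable fun n => ‖p.1 n‖ * ‖p.2 n‖}) =>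
      ∑' n, p.1.2 n (T (p.1.1 n)))
    Pi.topologicalSpace

/-! ### Convolution operators on `L^Φ(G)` -/

section Group

variable {G : Type*} [Group G] [TopologicalSpace G] [MeasurableSpace G]

/-- `w = f * g` almost everywhere, where `(f * g)(x) = ∫ f(y) g(y⁻¹ x) dy`, and the integral
converges for almost every `x`. -/
def IsConvolution (μ : Measure G) (f g w : G → ℂ) : Prop :=
  ∀ᵐ x ∂μ, Integrable (fun y => f y * g (y⁻¹ * x)) μ ∧ w x = ∫ y, f y * g (y⁻¹ * x) ∂μ

/-- `w = ν * g` almost everywhere, where `(ν * g)(x) = ∫ g(y⁻¹ x) dν(y)`, and the integral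
converges for almost every `x`. -/
def IsMeasureConvolution (μ : Measure G) (ν : ComplexMeasure G) (g w : G → ℂ) : Prop :=
  ∀ᵐ x ∂μ, ν.Integrable (fun y => g (y⁻¹ * x)) ∧
    w x = ∫ᵛ y, g (y⁻¹ * x) ∂[ContinuousLinearMap.mul ℝ ℂ; ν]

/-- The measure algebra `M(G)`: complex Borel measures whose total variation is regular. -/
def measureAlgebra (G : Type*) [TopologicalSpace G] [MeasurableSpace G] : Set (ComplexMeasure G) :=
  {ν | ν.variation.Regular}

/-- `T = λ_Φ(ν)`: the bounded operator `T` on `L^Φ(G)` is `g ↦ ν * g`. -/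
def IsLeftConvolutionOperator {κ : OrliczNormKind} {Φ : NFunction} {μ : Measure G}
    (ν : ComplexMeasure G) (T : OrliczSpace κ Φ μ →L[ℂ] OrliczSpace κ Φ μ) : Prop :=
  ∀ g : OrliczSpace κ Φ μ, IsMeasureConvolution μ ν g (T g)

/-- The `Φ`-pseudofunctions `PF_Φ(G)`: the norm closure of `{λ_Φ(f) : f ∈ L¹(G)}`, where
`λ_Φ(f)` is the convolution operator of the measure `f dμ`. -/
def pseudofunctions (κ : OrliczNormKind) (Φ : NFunction) (μ : Measure G) :
    Set (OrliczSpace κ Φ μ →L[ℂ] OrliczSpace κ Φ μ) :=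
  closure {T | ∃ f : G → ℂ, Integrable f μ ∧ IsLeftConvolutionOperator (μ.withDensityᵥ f) T}

/-- The `Φ`-pseudomeasures `PM_Φ(G)`: the ultraweak closure of `{λ_Φ(ν) : ν ∈ M(G)}`. -/
def pseudomeasures (κ : OrliczNormKind) (Φ : NFunction) (μ : Measure G) :
    Set (OrliczSpace κ Φ μ →L[ℂ] OrliczSpace κ Φ μ) :=
  @closure _ (ultraweakTopology (OrliczSpace κ Φ μ))
    {T | ∃ ν ∈ measureAlgebra G, IsLeftConvolutionOperator ν T}

/-- The `Φ`-convolution operators `CV_Φ(G)`: bounded operators `T` on `L^Φ(G)` with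
`T(f * g) = T(f) * g` for all `f, g ∈ C_c(G)`. Here `u` and `v` are the classes of `f` and
of `f * g` in `L^Φ(G)`. -/
def convolutionOperators (κ : OrliczNormKind) (Φ : NFunction) (μ : Measure G) :
    Set (OrliczSpace κ Φ μ →L[ℂ] OrliczSpace κ Φ μ) :=
  {T | ∀ f g : G → ℂ, Continuous f → HasCompactSupport f → Continuous g → HasCompactSupport g →
    ∃ u v : OrliczSpace κ Φ μ, u =ᵐ[μ] f ∧ IsConvolution μ f g v ∧ IsConvolution μ (T u) g (T v)}

end Group

end OrliczConv

end

open OrliczConv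

noncomputable section

namespace OrliczConv

open scoped CompactlySupported Pointwise

/-! ### Complementary functions and the `Δ₂`-condition -/

/-! Write `E` for the Orlicz space and `L_y` for left translation. The `Δ₂`-condition of `Φ`
supplies what the argument needs from `E`: it makes both norms control the modular, so that norm
limits are limits almost everywhere along subsequences and `E` is complete
(`OrliczSpace.completeSpace`), and it makes `C_c(G)` dense (`OrliczSpace.denseRange_ofCc`).
Translations are isometric for both norms and strongly continuous, so for `f` in `C_c(G)` the
Bochner integral of `f(y) L_y u` defines an operator `convOp κ h f` of norm at most the `L¹` norm of
`f`. These operators form an algebra whose norm closure is the set of pseudofunctions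
(`pseudofunctions_eq_closure_range`).

Normalized bumps at the identity of `G` give contractions `e_i` in this closure `A` with `e_i T → T`
in norm for `T` in `A` and `e_i u → u` for `u` in `E`. If `M` is a left multiplier, then `M(e_i) T =
M(e_i T) → M(T)`. Hence the bounded net `M(e_i)` converges on the vectors `e_j u`, so on all of `E`.
Its limit `S` satisfies `S T = M(T)` and `‖S‖ = ‖M‖` (`exists_multiplier_extension`). An operator is
determined by its products with the `e_i`, which yields multiplicativity, unitality and uniqueness.
A bounded strong limit is an ultraweak limit, so `S` is a pseudomeasure.

For the last inclusion fix `f` and `g` in `C_c(G)`. The pairs `(u, u * g)` form a closed subspace of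
`E × E` (`exists_convRight_submodule`). If the images of `f` and `f * g` under a pseudomeasure left
it, Hahn–Banach would provide two functionals on `E` separating them from it. Together these give an
ultraweakly continuous functional of the operator which vanishes on every convolution operator of a
regular measure, hence on the ultraweak closure, a contradiction.

The group need not be σ-compact, so Fubini's theorem for product measures is not at hand. Integrals
are interchanged only for continuous integrands with compact support. Exceptional null sets are
handled by local domination of inverted Haar measure (`exists_inv_restrict_le`) and by a Markov
inequality proved through compact sets (`mul_measure_le_of_isCompact`). -/

theorem NFunction.complementary_mul_le (Φ : NFunction) {s y : ℝ} (h0 : 0 ≤ s) (h1 : s ≤ 1) :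
    Φ.complementary (s * y) ≤ s * Φ.complementary y := by
  refine csSup_le ⟨_, 0, by simp, rfl⟩ ?_
  rintro _ ⟨x, hx, rfl⟩
  have hx0 : (0 : ℝ) ≤ x := hx
  have h := Φ.young hx0 (abs_nonneg y)
  have hy : Φ.complementary |y| = Φ.complementary y := by simp [NFunction.complementary]
  rw [hy] at h
  have h2 := mul_le_mul_of_nonneg_left h h0
  have h3 := mul_le_of_le_one_left (Φ.nonneg x) h1
  change x * |s * y| - Φ x ≤ _
  rw [abs_mul, abs_of_nonneg h0]
  nlinarith

/-- By convexity `Φ(x)/x` is increasing. For `x ≤ t` the product `x Φ(t)/t` is at most `Φ(t)`, and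
for `x ≥ t` it is at most `Φ(x)`. This makes `Φ(t)/t` an efficient test value when Young's
inequality has to be reversed. -/
theorem NFunction.complementary_div_le (Φ : NFunction) {t : ℝ} (ht : 0 ≤ t) :
    Φ.complementary (Φ t / t) ≤ Φ t := by
  refine csSup_le ⟨_, 0, by simp, rfl⟩ ?_
  rintro _ ⟨x, hx, rfl⟩
  have hx0 : (0 : ℝ) ≤ x := hx
  change x * |Φ t / t| - Φ x ≤ _
  rcases ht.eq_or_lt with rfl | ht
  · simpa [Φ.map_zero] using Φ.nonneg x
  rw [abs_of_nonneg (div_nonneg (Φ.nonneg t) ht.le)]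
  rcases le_total x t with hxt | hxt
  · have h1 : x * (Φ t / t) ≤ Φ t := by
      rw [mul_div_assoc', div_le_iff₀ ht, mul_comm]
      exact mul_le_mul_of_nonneg_left hxt (Φ.nonneg t)
    linarith [Φ.nonneg x]
  · have hx' : 0 < x := ht.trans_le hxt
    have h := Φ.map_mul_le (t := t / x) (x := x) (by positivity) ((div_le_one hx').2 hxt)
    rw [div_mul_cancel₀ _ hx'.ne'] at h
    have h1 : x * (Φ t / t) ≤ Φ x := by
      rw [mul_div_assoc', div_le_iff₀ ht]
      calc x * Φ t ≤ x * (t / x * Φ x) := mul_le_mul_of_nonneg_left h hx0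
        _ = Φ x * t := by field_simp
    linarith [Φ.nonneg t]

theorem NFunction.le_map_mul (Φ : NFunction) {t x : ℝ} (ht : 1 ≤ t) : t * Φ x ≤ Φ (t * x) := by
  have ht0 : 0 < t := one_pos.trans_le ht
  have h := Φ.map_mul_le (t := t⁻¹) (x := t * x) (by positivity) (inv_le_one_of_one_le₀ ht)
  rw [inv_mul_cancel_left₀ ht0.ne'] at h
  rwa [← le_inv_mul_iff₀ ht0]

theorem NFunction.pos (Φ : NFunction) {x : ℝ} (hx : x ≠ 0) : 0 < Φ x :=
  lt_of_le_of_ne (Φ.nonneg x) fun h => hx ((Φ.eq_zero_iff x).1 h.symm)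

section Orlicz

variable {α : Type*} [MeasurableSpace α]

/-- The `Δ₂`-condition of `Φ` relative to a measure: `Φ(2x) ≤ K Φ(x) + c` for `x ≥ 0`, where the
constant `c` is integrable. -/
def DeltaTwoOn (Φ : NFunction) (μ : Measure α) : Prop :=
  ∃ K c : ℝ, 0 ≤ K ∧ 0 ≤ c ∧ (c = 0 ∨ μ univ < ∞) ∧ ∀ x, 0 ≤ x → Φ (2 * x) ≤ K * Φ x + c

variable {κ : OrliczNormKind} {Φ : NFunction} {μ : Measure α}

theorem DeltaTwoOn.modular_two_mul_lt_top (h : DeltaTwoOn Φ μ) {f : α → ℝ} (hf : ∀ x, 0 ≤ f x)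
    (hfin : modular Φ μ f < ∞) : modular Φ μ (fun x => 2 * f x) < ∞ := by
  obtain ⟨K, c, hK, hc, hcμ, hle⟩ := h
  have h1 : modular Φ μ (fun x => 2 * f x) ≤
      ∫⁻ x, (ENNReal.ofReal K * ENNReal.ofReal (Φ (f x)) + ENNReal.ofReal c) ∂μ := by
    refine lintegral_mono fun x => ?_
    rw [← ENNReal.ofReal_mul hK, ← ENNReal.ofReal_add (mul_nonneg hK (Φ.nonneg _)) hc]
    exact ENNReal.ofReal_le_ofReal (hle _ (hf x))
  refine h1.trans_lt ?_
  rw [lintegral_add_right _ measurable_const, lintegral_const_mul' _ _ ENNReal.ofReal_ne_top,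
    lintegral_const]
  refine ENNReal.add_lt_top.2 ⟨ENNReal.mul_lt_top ENNReal.ofReal_lt_top hfin, ?_⟩
  rcases hcμ with rfl | hμ
  · simp
  · exact ENNReal.mul_lt_top ENNReal.ofReal_lt_top hμ

/-- Repeated doubling carries finiteness from one scale to every scale. -/
theorem DeltaTwoOn.modular_lt_top (h : DeltaTwoOn Φ μ) {f : α →ₘ[μ] ℂ} (hf : MemOrlicz Φ μ f)
    {a : ℝ} (ha : 0 ≤ a) : modular Φ μ (fun x => a * ‖f x‖) < ∞ := by
  obtain ⟨b, hb, hfin⟩ := hf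
  have hpow : ∀ n : ℕ, modular Φ μ (fun x => 2 ^ n * (b * ‖f x‖)) < ∞ := by
    intro n
    induction n with
    | zero => simpa using hfin
    | succ n ih =>
      have := h.modular_two_mul_lt_top (fun x => by positivity) ih
      simpa only [pow_succ', mul_assoc] using this
  obtain ⟨n, hn⟩ := pow_unbounded_of_one_lt (a / b) (one_lt_two)
  refine lt_of_le_of_lt (modular_mono Φ μ (ae_of_all _ fun x => by positivity)
    (ae_of_all _ fun x => ?_)) (hpow n)
  rw [div_lt_iff₀ hb] at hn
  rw [← mul_assoc]
  exact mul_le_mul_of_nonneg_right hn.le (norm_nonneg _)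

/-! ### The norms of an Orlicz space and its modular -/

theorem NFunction.measurable (Φ : NFunction) : Measurable (Φ : ℝ → ℝ) := Φ.continuous.measurable

theorem OrliczSpace.measurable (u : OrliczSpace κ Φ μ) : Measurable (u : α → ℂ) :=
  u.toAEEqFun.measurable

theorem OrliczSpace.ext_ae {u v : OrliczSpace κ Φ μ} (h : (u : α → ℂ) =ᵐ[μ] v) : u = v :=
  OrliczSpace.toAEEqFun_injective (AEEqFun.ext h)

theorem OrliczSpace.coeFn_add (u v : OrliczSpace κ Φ μ) :
    ((u + v : OrliczSpace κ Φ μ) : α → ℂ) =ᵐ[μ] fun x => u x + v x := by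
  rw [OrliczSpace.toAEEqFun_add]; exact AEEqFun.coeFn_add _ _

theorem OrliczSpace.coeFn_sub (u v : OrliczSpace κ Φ μ) :
    ((u - v : OrliczSpace κ Φ μ) : α → ℂ) =ᵐ[μ] fun x => u x - v x := by
  rw [OrliczSpace.toAEEqFun_sub]; exact AEEqFun.coeFn_sub _ _

theorem OrliczSpace.coeFn_smul (c : ℂ) (u : OrliczSpace κ Φ μ) :
    ((c • u : OrliczSpace κ Φ μ) : α → ℂ) =ᵐ[μ] fun x => c * u x := by
  rw [OrliczSpace.toAEEqFun_smul]; exact AEEqFun.coeFn_smul _ _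

theorem OrliczSpace.coeFn_zero :
    ((0 : OrliczSpace κ Φ μ) : α → ℂ) =ᵐ[μ] fun _ => 0 := by
  rw [OrliczSpace.toAEEqFun_zero]; exact AEEqFun.coeFn_zero

/-- Young's inequality applied to `‖f x‖ / k` and `‖g x‖`, then integrated. -/
theorem lintegral_mul_le_of_modular_le_one {f : α →ₘ[μ] ℂ} {k : ℝ} (hk : 0 < k)
    (hf : modular Φ μ (fun x => ‖f x‖ / k) ≤ 1) {g : α → ℂ} :
    ∫⁻ x, ‖f x * g x‖ₑ ∂μ ≤
      ENNReal.ofReal k * (1 + modular Φ.complementary μ (fun x => ‖g x‖)) := by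
  have hΦ := Φ.measurable
  have hfm : AEMeasurable (fun x => ‖f x‖) μ := f.aestronglyMeasurable.norm.aemeasurable
  calc ∫⁻ x, ‖f x * g x‖ₑ ∂μ
      ≤ ∫⁻ x, ENNReal.ofReal k * (ENNReal.ofReal (Φ (‖f x‖ / k)) +
          ENNReal.ofReal (Φ.complementary ‖g x‖)) ∂μ := by
        refine lintegral_mono fun x => ?_
        rw [← ENNReal.ofReal_add (Φ.nonneg _) (Φ.complementary_nonneg _),
          ← ENNReal.ofReal_mul hk.le, ← ofReal_norm, norm_mul]
        refine ENNReal.ofReal_le_ofReal ?_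
        rw [← div_le_iff₀' hk, mul_div_right_comm]
        exact Φ.young (by positivity) (by positivity)
    _ = ENNReal.ofReal k * (modular Φ μ (fun x => ‖f x‖ / k) +
          modular Φ.complementary μ (fun x => ‖g x‖)) := by
        rw [lintegral_const_mul' _ _ ENNReal.ofReal_ne_top, lintegral_add_left' (by fun_prop)]
        rfl
    _ ≤ _ := by gcongr

/-- Both norms are at most twice the Luxemburg norm. -/
theorem OrliczSpace.norm_le_two_mul (u : OrliczSpace κ Φ μ) {k : ℝ} (hk : 0 < k)
    (h : modular Φ μ (fun x => ‖u x‖ / k) ≤ 1) : ‖u‖ ≤ 2 * k := by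
  rw [OrliczSpace.norm_eq]
  cases κ
  · change luxemburgNorm Φ μ u.toAEEqFun ≤ _
    linarith [luxemburgNorm_le hk h]
  · change (orliczENorm Φ μ u.toAEEqFun).toReal ≤ _
    refine ENNReal.toReal_le_of_le_ofReal (by positivity) (iSup_le fun g => ?_)
    refine (lintegral_mul_le_of_modular_le_one hk h).trans ?_
    rw [mul_comm 2 k, ENNReal.ofReal_mul hk.le]
    gcongr
    calc (1 : ℝ≥0∞) + _ ≤ 1 + 1 := by gcongr; exact g.2
      _ = ENNReal.ofReal 2 := by norm_num

/-- If the modular `m` exceeded `1`, a suitable admissible test function would give the pairing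
exactly `r`, against the strict bound on the Orlicz norm. The `Δ₂`-condition enters to make `m`
finite. -/
theorem modular_le_one_of_orliczENorm_lt (h : DeltaTwoOn Φ μ) {f : α →ₘ[μ] ℂ}
    (hf : MemOrlicz Φ μ f) {r : ℝ} (hr : 0 < r) (hfr : orliczENorm Φ μ f < ENNReal.ofReal r) :
    modular Φ μ (fun x => ‖f x‖ / r) ≤ 1 := by
  by_contra hlt
  rw [not_le] at hlt
  have hfin : modular Φ μ (fun x => ‖f x‖ / r) < ∞ := by
    simpa only [div_eq_inv_mul] using h.modular_lt_top hf (a := r⁻¹) (by positivity)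
  set M := modular Φ μ (fun x => ‖f x‖ / r) with hM
  set m := M.toReal with hm
  have hMm : M = ENNReal.ofReal m := (ENNReal.ofReal_toReal hfin.ne).symm
  have hm1 : 1 < m := by
    rw [hMm, ← ENNReal.ofReal_one, ENNReal.ofReal_lt_ofReal_iff'] at hlt
    exact hlt.1
  have hm0 : 0 < m := one_pos.trans hm1
  have hΦ := Φ.measurable
  have hfm : Measurable f := f.measurable
  -- With `s = ‖f x‖ / r` the test function is `Φ(s)/s` divided by `m`. By
  -- `NFunction.complementary_div_le` its complementary modular is at most `m⁻¹` times the modular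
  -- of `s`, that is `1`. The quotient `Φ(s)/s` is `0` at `s = 0` by the convention for division.
  let g₀ : α → ℂ := fun x => ((m⁻¹ * (Φ (‖f x‖ / r) / (‖f x‖ / r)) : ℝ) : ℂ)
  have hg₀m : Measurable g₀ := by fun_prop
  have hg₀ : AEStronglyMeasurable g₀ μ := hg₀m.aestronglyMeasurable
  have hnn : ∀ x, 0 ≤ Φ (‖f x‖ / r) / (‖f x‖ / r) := fun x =>
    div_nonneg (Φ.nonneg _) (by positivity)
  have hnorm : ∀ x, ‖g₀ x‖ = m⁻¹ * (Φ (‖f x‖ / r) / (‖f x‖ / r)) := fun x => by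
    rw [Complex.norm_real, Real.norm_eq_abs, abs_of_nonneg (mul_nonneg (by positivity) (hnn x))]
  have hg : modular Φ.complementary μ (fun x => ‖(AEEqFun.mk g₀ hg₀) x‖) ≤ 1 := by
    calc modular Φ.complementary μ (fun x => ‖(AEEqFun.mk g₀ hg₀) x‖)
        ≤ ∫⁻ x, ENNReal.ofReal m⁻¹ * ENNReal.ofReal (Φ (‖f x‖ / r)) ∂μ := by
          refine lintegral_mono_ae ?_
          filter_upwards [AEEqFun.coeFn_mk g₀ hg₀] with x hx
          rw [hx, hnorm, ← ENNReal.ofReal_mul (by positivity)]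
          refine ENNReal.ofReal_le_ofReal ((Φ.complementary_mul_le (by positivity)
            (inv_le_one_of_one_le₀ hm1.le)).trans ?_)
          gcongr
          exact Φ.complementary_div_le (by positivity)
      _ = ENNReal.ofReal m⁻¹ * M := by
          rw [lintegral_const_mul' _ _ ENNReal.ofReal_ne_top]; rfl
      _ = 1 := by
          rw [hMm, ← ENNReal.ofReal_mul (by positivity), inv_mul_cancel₀ hm0.ne',
            ENNReal.ofReal_one]
  have hint : ∫⁻ x, ‖f x * (AEEqFun.mk g₀ hg₀) x‖ₑ ∂μ = ENNReal.ofReal r := by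
    calc ∫⁻ x, ‖f x * (AEEqFun.mk g₀ hg₀) x‖ₑ ∂μ
        = ∫⁻ x, ENNReal.ofReal (r * m⁻¹) * ENNReal.ofReal (Φ (‖f x‖ / r)) ∂μ := by
          refine lintegral_congr_ae ?_
          filter_upwards [AEEqFun.coeFn_mk g₀ hg₀] with x hx
          rw [hx, ← ENNReal.ofReal_mul (by positivity), ← ofReal_norm, norm_mul, hnorm]
          congr 1
          rcases eq_or_ne (‖f x‖) 0 with h0 | h0
          · simp [h0, Φ.map_zero]
          · field_simp
      _ = ENNReal.ofReal (r * m⁻¹) * M := by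
          rw [lintegral_const_mul' _ _ ENNReal.ofReal_ne_top]; rfl
      _ = ENNReal.ofReal r := by
          rw [hMm, ← ENNReal.ofReal_mul (by positivity), mul_assoc, inv_mul_cancel₀ hm0.ne',
            mul_one]
  have := le_iSup (fun h : {g : α →ₘ[μ] ℂ // modular Φ.complementary μ (fun x => ‖g x‖) ≤ 1} =>
    ∫⁻ x, ‖f x * (h : α →ₘ[μ] ℂ) x‖ₑ ∂μ) ⟨AEEqFun.mk g₀ hg₀, hg⟩
  rw [hint] at this
  exact absurd hfr (not_lt.2 this)

/-- Both norms dominate the Luxemburg norm. -/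
theorem OrliczSpace.modular_le_one (h : DeltaTwoOn Φ μ) (u : OrliczSpace κ Φ μ) {k : ℝ}
    (hk : ‖u‖ < k) : modular Φ μ (fun x => ‖u x‖ / k) ≤ 1 := by
  have hk0 : 0 < k := (norm_nonneg u).trans_lt hk
  rw [OrliczSpace.norm_eq] at hk
  cases κ
  · obtain ⟨l, hl, hlk, hle⟩ := exists_lt_of_luxemburgNorm_lt u.mem hk
    refine (modular_mono Φ μ (ae_of_all _ fun x => by positivity)
      (ae_of_all _ fun x => ?_)).trans hle
    gcongr
  · refine modular_le_one_of_orliczENorm_lt h u.mem hk0 ?_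
    rwa [← ENNReal.ofReal_toReal (orliczENorm_lt_top u.mem).ne, ENNReal.ofReal_lt_ofReal_iff hk0]

theorem OrliczSpace.measure_norm_ge_le (h : DeltaTwoOn Φ μ) (u : OrliczSpace κ Φ μ) {k ε : ℝ}
    (hk : ‖u‖ < k) (hε : 0 < ε) :
    μ {x | ε ≤ ‖u x‖} ≤ (ENNReal.ofReal (Φ (ε / k)))⁻¹ := by
  have hk0 : 0 < k := (norm_nonneg u).trans_lt hk
  have hΦ := Φ.measurable
  have hum := u.measurable
  have hpos : 0 < Φ (ε / k) := Φ.pos (by positivity)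
  have h1 := meas_ge_le_lintegral_div (μ := μ)
    (f := fun x => ENNReal.ofReal (Φ (‖u x‖ / k))) (by fun_prop)
    (ε := ENNReal.ofReal (Φ (ε / k))) (by simpa using hpos) ENNReal.ofReal_ne_top
  refine (measure_mono fun x hx => ?_).trans (h1.trans ?_)
  · have hx' : ε ≤ ‖u x‖ := hx
    exact ENNReal.ofReal_le_ofReal (Φ.mono (by positivity) (by gcongr))
  · rw [ENNReal.div_eq_inv_mul]
    exact mul_le_of_le_one_right zero_le (u.modular_le_one h hk)

theorem OrliczSpace.measure_norm_ge_lt_top (h : DeltaTwoOn Φ μ) (u : OrliczSpace κ Φ μ) {ε : ℝ}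
    (hε : 0 < ε) : μ {x | ε ≤ ‖u x‖} < ∞ := by
  refine (u.measure_norm_ge_le h (lt_add_one ‖u‖) hε).trans_lt ?_
  have hpos : 0 < Φ (ε / (‖u‖ + 1)) := Φ.pos (by positivity)
  simpa using hpos

theorem NFunction.tendsto_inv_map_div (Φ : NFunction) {ε : ℝ} (hε : 0 < ε) :
    Tendsto (fun k => (ENNReal.ofReal (Φ (ε / k)))⁻¹) (𝓝[>] 0) (𝓝 0) := by
  have h1 : Tendsto (fun x => Φ x) atTop atTop := by
    refine tendsto_atTop_mono' _ ?_ Φ.tendsto_div_atTop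
    filter_upwards [eventually_ge_atTop 1] with x hx
    exact div_le_self (Φ.nonneg x) hx
  have h2 : Tendsto (fun k : ℝ => ε / k) (𝓝[>] 0) atTop := by
    simpa only [div_eq_mul_inv] using tendsto_inv_nhdsGT_zero.const_mul_atTop hε
  have h3 := ENNReal.tendsto_ofReal_atTop.comp (h1.comp h2)
  simpa using tendsto_inv_iff.2 h3

/-- Norm convergence implies convergence almost everywhere along a subsequence. -/
theorem OrliczSpace.exists_seq_tendsto_ae (h : DeltaTwoOn Φ μ) {u : ℕ → OrliczSpace κ Φ μ}
    {v : OrliczSpace κ Φ μ} (hu : Tendsto u atTop (𝓝 v)) :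
    ∃ ns : ℕ → ℕ, StrictMono ns ∧ ∀ᵐ x ∂μ, Tendsto (fun i => u (ns i) x) atTop (𝓝 (v x)) := by
  suffices hm : TendstoInMeasure μ (fun n => (u n : α → ℂ)) atTop (v : α → ℂ) from
    hm.exists_seq_tendsto_ae
  rw [tendstoInMeasure_iff_norm]
  intro ε hε
  rw [ENNReal.tendsto_nhds_zero]
  intro δ hδ
  -- Here `k` is a norm bound so small that the Chebyshev estimate `1/Φ(ε/k)` drops below `δ`.
  obtain ⟨k, hk1, hk0⟩ := (((ENNReal.tendsto_nhds_zero.1 (Φ.tendsto_inv_map_div hε)) δ hδ).and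
    self_mem_nhdsWithin).exists
  filter_upwards [(tendsto_iff_norm_sub_tendsto_zero.1 hu).eventually_lt_const hk0] with n hn
  refine le_trans (le_of_eq ?_) (((u n - v).measure_norm_ge_le h hn hε).trans hk1)
  refine measure_congr ?_
  filter_upwards [OrliczSpace.coeFn_sub (u n) v] with x hx
  change (ε ≤ ‖u n x - v x‖) = (ε ≤ ‖(u n - v) x‖)
  rw [hx]

/-! ### Completeness and local integrability -/

theorem OrliczSpace.exists_limit_ae (h : DeltaTwoOn Φ μ) {u : ℕ → OrliczSpace κ Φ μ}
    (hu : ∀ n, ‖u (n + 1) - u n‖ < (1 / 4) ^ n) :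
    ∃ f : α → ℂ, StronglyMeasurable f ∧ ∀ᵐ x ∂μ, Tendsto (fun n => u n x) atTop (𝓝 (f x)) := by
  refine exists_stronglyMeasurable_limit_of_tendsto_ae
    (fun n => (u n).toAEEqFun.aestronglyMeasurable) ?_
  have hΦ1 : 0 < Φ 1 := Φ.pos one_ne_zero
  -- Borel–Cantelli: Chebyshev at height `2⁻ⁿ` and norm `4⁻ⁿ` gives `1/Φ(2ⁿ)`, which is at most
  -- `2⁻ⁿ/Φ(1)` by convexity. The gap between the two geometric rates makes both these measures and
  -- the increments summable.
  have hs : ∀ n, μ {x | (1 / 2 : ℝ) ^ n ≤ ‖(u (n + 1) - u n) x‖} ≤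
      (ENNReal.ofReal (Φ 1))⁻¹ * (2⁻¹) ^ n := by
    intro n
    refine ((u (n + 1) - u n).measure_norm_ge_le h (hu n) (by positivity)).trans ?_
    have he : (1 / 2 : ℝ) ^ n / (1 / 4) ^ n = 2 ^ n * 1 := by
      rw [← div_pow]; norm_num
    have h2 := Φ.le_map_mul (t := 2 ^ n) (x := 1) (one_le_pow₀ one_le_two)
    rw [he, ← ENNReal.inv_pow, ← ENNReal.mul_inv (Or.inr (by simp)) (Or.inl ENNReal.ofReal_ne_top)]
    gcongr
    rw [show (2 : ℝ≥0∞) ^ n = ENNReal.ofReal (2 ^ n) by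
      rw [ENNReal.ofReal_pow (by norm_num)]; norm_num, ← ENNReal.ofReal_mul hΦ1.le, mul_comm]
    exact ENNReal.ofReal_le_ofReal h2
  have hsum : ∑' n, μ {x | (1 / 2 : ℝ) ^ n ≤ ‖(u (n + 1) - u n) x‖} ≠ ∞ := by
    refine ne_top_of_le_ne_top ?_ (ENNReal.tsum_le_tsum hs)
    rw [ENNReal.tsum_mul_left, ENNReal.tsum_geometric]
    refine ENNReal.mul_ne_top ?_ (by norm_num)
    simpa using hΦ1
  have hsub := ae_all_iff.2 fun n => OrliczSpace.coeFn_sub (u (n + 1)) (u n)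
  filter_upwards [ae_eventually_notMem hsum, hsub] with x hx hx'
  refine cauchySeq_tendsto_of_complete (cauchySeq_of_summable_dist ?_)
  refine Summable.of_norm_bounded_eventually_nat (g := fun n => (1 / 2 : ℝ) ^ n)
    (summable_geometric_of_lt_one (by norm_num) (by norm_num)) ?_
  filter_upwards [hx] with n hn
  simp only [not_le, hx' n] at hn
  rw [Real.norm_eq_abs, abs_of_nonneg dist_nonneg, dist_comm, dist_eq_norm]
  exact hn.le

theorem OrliczSpace.completeSpace (h : DeltaTwoOn Φ μ) : CompleteSpace (OrliczSpace κ Φ μ) := by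
  refine Metric.complete_of_convergent_controlled_sequences (fun n => (1 / 4 : ℝ) ^ n)
    (fun n => by positivity) fun u hu => ?_
  obtain ⟨f, hfm, hf⟩ := OrliczSpace.exists_limit_ae h fun n => by
    rw [← dist_eq_norm]; exact hu n (n + 1) n n.le_succ le_rfl
  have hΦ := Φ.measurable
  have key : ∀ N, ∃ v : OrliczSpace κ Φ μ, (v : α → ℂ) =ᵐ[μ] (fun x => f x - u N x) ∧
      ‖v‖ ≤ 2 * (1 / 4 : ℝ) ^ N := by
    intro N
    have hNpos : (0 : ℝ) < (1 / 4) ^ N := by positivity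
    have hm : AEStronglyMeasurable (fun x => f x - u N x) μ :=
      hfm.aestronglyMeasurable.sub (u N).toAEEqFun.aestronglyMeasurable
    have hmod : modular Φ μ (fun x => ‖(AEEqFun.mk _ hm) x‖ / (1 / 4) ^ N) ≤ 1 := by
      have hall := ae_all_iff.2 fun n => OrliczSpace.coeFn_sub (u n) (u N)
      calc modular Φ μ (fun x => ‖(AEEqFun.mk _ hm) x‖ / (1 / 4) ^ N)
          = ∫⁻ x, liminf (fun n => ENNReal.ofReal (Φ (‖(u n - u N) x‖ / (1 / 4) ^ N))) atTop ∂μ := by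
            refine lintegral_congr_ae ?_
            filter_upwards [AEEqFun.coeFn_mk _ hm, hall, hf] with x hx hx1 hx2
            rw [hx]
            refine (Tendsto.liminf_eq ?_).symm
            simp only [hx1]
            exact (ENNReal.continuous_ofReal.tendsto _).comp ((Φ.continuous.tendsto _).comp
              ((hx2.sub_const _).norm.div_const _))
        -- Fatou's lemma: the limit lies within `4⁻ᴺ` of `u N` in the Luxemburg sense because all
        -- later terms do.
        _ ≤ liminf (fun n => modular Φ μ (fun x => ‖(u n - u N) x‖ / (1 / 4) ^ N)) atTop := by
            refine lintegral_liminf_le' fun n => ?_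
            have := (u n - u N).measurable
            fun_prop
        _ ≤ 1 := by
            refine liminf_le_of_frequently_le' (Eventually.frequently ?_)
            filter_upwards [eventually_ge_atTop N] with n hn
            refine OrliczSpace.modular_le_one h _ ?_
            rw [← dist_eq_norm]
            exact hu N n N hn le_rfl
    refine ⟨OrliczSpace.mk _ (memOrlicz_of_le_one hNpos hmod), AEEqFun.coeFn_mk _ hm, ?_⟩
    exact OrliczSpace.norm_le_two_mul _ hNpos hmod
  choose v hv hvle using key
  -- Since `f` is not yet known to lie in the space, `u N + v N` serves as its class, the same one
  -- for every `N`.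
  have hconst : ∀ N, u N + v N = u 0 + v 0 := by
    intro N
    refine OrliczSpace.ext_ae ?_
    filter_upwards [OrliczSpace.coeFn_add (u N) (v N), OrliczSpace.coeFn_add (u 0) (v 0), hv N,
      hv 0] with x h1 h2 h3 h4
    rw [h1, h2, h3, h4]; ring
  refine ⟨u 0 + v 0, ?_⟩
  rw [tendsto_iff_norm_sub_tendsto_zero]
  refine squeeze_zero (fun _ => norm_nonneg _) (g := fun N => 2 * (1 / 4 : ℝ) ^ N) (fun N => ?_) ?_
  · rw [← hconst N, sub_add_cancel_left, norm_neg]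
    exact hvle N
  · simpa using (tendsto_pow_atTop_nhds_zero_of_lt_one (by norm_num : (0 : ℝ) ≤ 1 / 4)
      (by norm_num)).const_mul 2

/-- Local integrability, with a bound. -/
theorem OrliczSpace.setLIntegral_enorm_le (h : DeltaTwoOn Φ μ) (u : OrliczSpace κ Φ μ)
    {s : Set α} (hs : MeasurableSet s) (hμs : μ s ≠ ∞) :
    ∫⁻ x in s, ‖u x‖ₑ ∂μ ≤
      ENNReal.ofReal ‖u‖ * (1 + ENNReal.ofReal (Φ.complementary 1) * μ s) := by
  have key : ∀ k : ℝ, ‖u‖ < k → ∫⁻ x in s, ‖u x‖ₑ ∂μ ≤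
      ENNReal.ofReal k * (1 + ENNReal.ofReal (Φ.complementary 1) * μ s) := by
    intro k hk
    have hk0 : 0 < k := (norm_nonneg u).trans_lt hk
    have h1 := lintegral_mul_le_of_modular_le_one hk0 (u.modular_le_one h hk)
      (g := s.indicator fun _ => 1)
    have h2 : modular Φ.complementary μ (fun x => ‖s.indicator (fun _ => (1 : ℂ)) x‖) =
        ENNReal.ofReal (Φ.complementary 1) * μ s := by
      rw [← lintegral_indicator_const hs]
      refine lintegral_congr fun x => ?_
      by_cases hx : x ∈ s <;> simp [hx, Φ.complementary_zero]
    rw [h2] at h1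
    refine le_trans (le_of_eq ?_) h1
    rw [← lintegral_indicator hs]
    refine lintegral_congr fun x => ?_
    by_cases hx : x ∈ s <;> simp [hx]
  have ht : Tendsto (fun k => ENNReal.ofReal k * (1 + ENNReal.ofReal (Φ.complementary 1) * μ s))
      (𝓝[>] ‖u‖) (𝓝 (ENNReal.ofReal ‖u‖ * (1 + ENNReal.ofReal (Φ.complementary 1) * μ s))) := by
    refine ENNReal.Tendsto.mul_const
      ((ENNReal.continuous_ofReal.tendsto _).mono_left nhdsWithin_le_nhds) ?_
    exact Or.inr (ENNReal.add_ne_top.2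
      ⟨ENNReal.one_ne_top, ENNReal.mul_ne_top ENNReal.ofReal_ne_top hμs⟩)
  refine ge_of_tendsto ht ?_
  filter_upwards [self_mem_nhdsWithin] with k hk using key k hk

theorem OrliczSpace.integrableOn (h : DeltaTwoOn Φ μ) (u : OrliczSpace κ Φ μ)
    {s : Set α} (hs : MeasurableSet s) (hμs : μ s ≠ ∞) : IntegrableOn u s μ := by
  refine ⟨u.measurable.aestronglyMeasurable, (u.setLIntegral_enorm_le h hs hμs).trans_lt ?_⟩
  exact ENNReal.mul_lt_top ENNReal.ofReal_lt_top (ENNReal.add_lt_top.2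
    ⟨ENNReal.one_lt_top, ENNReal.mul_lt_top ENNReal.ofReal_lt_top hμs.lt_top⟩)

theorem OrliczSpace.setIntegral_norm_le (h : DeltaTwoOn Φ μ) (u : OrliczSpace κ Φ μ)
    {s : Set α} (hs : MeasurableSet s) (hμs : μ s ≠ ∞) :
    ∫ x in s, ‖u x‖ ∂μ ≤ (1 + Φ.complementary 1 * μ.real s) * ‖u‖ := by
  have hΨ := Φ.complementary_nonneg 1
  rw [integral_norm_eq_lintegral_enorm u.measurable.aestronglyMeasurable]
  refine ENNReal.toReal_le_of_le_ofReal (by positivity) ((u.setLIntegral_enorm_le h hs hμs).trans ?_)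
  rw [mul_comm, ENNReal.ofReal_mul (by positivity), ENNReal.ofReal_add zero_le_one (by positivity),
    ENNReal.ofReal_one, ENNReal.ofReal_mul hΨ, measureReal_def, ENNReal.ofReal_toReal hμs]

/-- Integration over a set of finite measure, as a continuous functional on `L^Φ`. -/
def OrliczSpace.setIntegralCLM (h : DeltaTwoOn Φ μ) {s : Set α} (hs : MeasurableSet s)
    (hμs : μ s ≠ ∞) : OrliczSpace κ Φ μ →L[ℂ] ℂ :=
  LinearMap.mkContinuous
    { toFun := fun u => ∫ x in s, u x ∂μ
      map_add' := fun u v => by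
        rw [← integral_add (u.integrableOn h hs hμs) (v.integrableOn h hs hμs)]
        exact integral_congr_ae (ae_restrict_of_ae (OrliczSpace.coeFn_add u v))
      map_smul' := fun c u => by
        rw [RingHom.id_apply, smul_eq_mul, ← integral_const_mul]
        exact integral_congr_ae (ae_restrict_of_ae (OrliczSpace.coeFn_smul c u)) }
    (1 + Φ.complementary 1 * μ.real s)
    fun u => (norm_integral_le_integral_norm _).trans (u.setIntegral_norm_le h hs hμs)

theorem OrliczSpace.setIntegralCLM_apply (h : DeltaTwoOn Φ μ) {s : Set α} (hs : MeasurableSet s)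
    (hμs : μ s ≠ ∞) (u : OrliczSpace κ Φ μ) :
    OrliczSpace.setIntegralCLM h hs hμs u = ∫ x in s, u x ∂μ := rfl

/-- The measure need not be σ-finite, but each set `{‖u‖ ≥ 1/(n+1)}` has finite measure, and these
sets exhaust the support of `u`. The lemma is used to identify Bochner integrals with pointwise
ones, as point evaluations make no sense on classes. -/
theorem OrliczSpace.eq_zero_of_forall_setIntegral_eq_zero (h : DeltaTwoOn Φ μ)
    {u : OrliczSpace κ Φ μ}
    (hu : ∀ s, MeasurableSet s → μ s ≠ ∞ → ∫ x in s, u x ∂μ = 0) : u = 0 := by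
  have hlevel : ∀ n : ℕ, ∀ᵐ x ∂μ, ((n : ℝ) + 1)⁻¹ ≤ ‖u x‖ → u x = 0 := by
    intro n
    set A := {x | ((n : ℝ) + 1)⁻¹ ≤ ‖u x‖} with hA
    have hAm : MeasurableSet A := measurableSet_le measurable_const u.measurable.norm
    have hAμ : μ A ≠ ∞ := (u.measure_norm_ge_lt_top h (by positivity)).ne
    have h0 := (u.integrableOn h hAm hAμ).ae_eq_zero_of_forall_setIntegral_eq_zero fun s hs _ => by
      rw [Measure.restrict_restrict hs]
      exact hu _ (hs.inter hAm) (measure_ne_top_of_subset inter_subset_right hAμ)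
    exact (ae_restrict_iff' hAm).1 h0
  refine OrliczSpace.ext_ae ?_
  filter_upwards [ae_all_iff.2 hlevel, OrliczSpace.coeFn_zero (κ := κ) (Φ := Φ) (μ := μ)]
    with x hx hx0
  rw [hx0]
  by_contra hne
  obtain ⟨n, hn⟩ := exists_nat_one_div_lt (norm_pos_iff.2 hne)
  exact hne (hx n (by simpa [one_div] using hn.le))

/-! ### Bounded functions supported on sets of finite measure -/

theorem modular_le_of_bounded {f : α → ℂ} {C k : ℝ} {s : Set α} (hs : MeasurableSet s)
    (hfC : ∀ x, ‖f x‖ ≤ C) (hfs : ∀ x, x ∉ s → f x = 0) (hk : 0 < k) :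
    modular Φ μ (fun x => ‖f x‖ / k) ≤ ENNReal.ofReal (Φ (C / k)) * μ s := by
  rw [← lintegral_indicator_const hs]
  refine lintegral_mono fun x => ?_
  by_cases hx : x ∈ s
  · rw [indicator_of_mem hx]
    refine ENNReal.ofReal_le_ofReal (Φ.mono (by positivity) ?_)
    exact div_le_div_of_nonneg_right (hfC x) hk.le
  · simp [hx, hfs x hx, Φ.map_zero]

theorem memOrlicz_of_bounded {f : α → ℂ} (hf : AEStronglyMeasurable f μ) {C : ℝ} {s : Set α}
    (hs : MeasurableSet s) (hμs : μ s < ∞) (hfC : ∀ x, ‖f x‖ ≤ C)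
    (hfs : ∀ x, x ∉ s → f x = 0) : MemOrlicz Φ μ (AEEqFun.mk f hf) := by
  refine ⟨1, one_pos, lt_of_le_of_lt (le_of_eq ?_) (lt_of_le_of_lt
    (modular_le_of_bounded (Φ := Φ) (μ := μ) hs hfC hfs one_pos)
      (ENNReal.mul_lt_top ENNReal.ofReal_lt_top hμs))⟩
  refine lintegral_congr_ae ?_
  filter_upwards [AEEqFun.coeFn_mk f hf] with x hx
  simp [hx]

theorem OrliczSpace.norm_le_of_ae_eq (u : OrliczSpace κ Φ μ) {f : α → ℂ} (hu : u =ᵐ[μ] f) {k : ℝ}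
    (hk : 0 < k) (hf : modular Φ μ (fun x => ‖f x‖ / k) ≤ 1) : ‖u‖ ≤ 2 * k := by
  refine u.norm_le_two_mul hk (le_trans (le_of_eq ?_) hf)
  refine lintegral_congr_ae ?_
  filter_upwards [hu] with x hx
  rw [hx]

theorem tendsto_ofReal_map_div_mul (Φ : NFunction) {k : ℝ} (m : ℝ≥0∞) (hm : m ≠ ∞) :
    Tendsto (fun ε => ENNReal.ofReal (Φ (ε / k)) * m) (𝓝 0) (𝓝 0) := by
  have h1 : Tendsto (fun ε => ENNReal.ofReal (Φ (ε / k))) (𝓝 0) (𝓝 (ENNReal.ofReal (Φ (0 / k)))) :=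
    ((ENNReal.continuous_ofReal.comp Φ.continuous).comp (continuous_id.div_const k)).tendsto 0
  rw [zero_div, Φ.map_zero, ENNReal.ofReal_zero] at h1
  simpa using ENNReal.Tendsto.mul_const h1 (Or.inr hm)

/-- A uniformly small function supported on a fixed set of finite measure is small in `L^Φ`. -/
theorem OrliczSpace.exists_norm_le_of_bounded {s : Set α} (hs : MeasurableSet s) (hμs : μ s < ∞)
    {δ : ℝ} (hδ : 0 < δ) : ∃ ε > 0, ∀ (u : OrliczSpace κ Φ μ) (f : α → ℂ), u =ᵐ[μ] f →
      (∀ x, ‖f x‖ ≤ ε) → (∀ x, x ∉ s → f x = 0) → ‖u‖ ≤ δ := by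
  have h1 := (tendsto_ofReal_map_div_mul Φ (k := δ / 2) (μ s) hμs.ne).mono_left
    (nhdsWithin_le_nhds (s := Ioi 0))
  obtain ⟨ε, hε1, hε0⟩ := ((ENNReal.tendsto_nhds_zero.1 h1 1 one_pos).and
    self_mem_nhdsWithin).exists
  refine ⟨ε, hε0, fun u f huf hfε hfs => ?_⟩
  have h2 := u.norm_le_of_ae_eq huf (half_pos hδ)
    ((modular_le_of_bounded hs hfε hfs (half_pos hδ)).trans hε1)
  linarith

/-- A function which is bounded and small in `L¹` is small in `L^Φ`. -/
theorem OrliczSpace.norm_le_of_bounded_of_lintegral_le (u : OrliczSpace κ Φ μ) {C k : ℝ}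
    (hC : 0 < C) (hk : 0 < k) (huC : ∀ᵐ x ∂μ, ‖u x‖ ≤ C)
    (hu : ∫⁻ x, ‖u x‖ₑ ∂μ ≤ ENNReal.ofReal (C / Φ (C / k))) : ‖u‖ ≤ 2 * k := by
  have hpos : 0 < Φ (C / k) := Φ.pos (by positivity)
  refine u.norm_le_two_mul hk ?_
  calc modular Φ μ (fun x => ‖u x‖ / k)
      ≤ ∫⁻ x, ENNReal.ofReal (Φ (C / k) / C) * ‖u x‖ₑ ∂μ := by
        refine lintegral_mono_ae ?_
        filter_upwards [huC] with x hx
        rw [← ofReal_norm, ← ENNReal.ofReal_mul (by positivity)]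
        refine ENNReal.ofReal_le_ofReal ?_
        -- On `[0, C/k]` the convex function `Φ` lies below its chord, so the modular is controlled
        -- linearly by the `L¹` norm.
        have := Φ.map_mul_le (t := ‖u x‖ / C) (x := C / k) (by positivity) ((div_le_one hC).2 hx)
        calc Φ (‖u x‖ / k) = Φ (‖u x‖ / C * (C / k)) := by congr 1; field_simp
          _ ≤ ‖u x‖ / C * Φ (C / k) := this
          _ = Φ (C / k) / C * ‖u x‖ := by ring
    _ = ENNReal.ofReal (Φ (C / k) / C) * ∫⁻ x, ‖u x‖ₑ ∂μ :=
        lintegral_const_mul' _ _ ENNReal.ofReal_ne_top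
    _ ≤ ENNReal.ofReal (Φ (C / k) / C) * ENNReal.ofReal (C / Φ (C / k)) := by gcongr
    _ = 1 := by
        rw [← ENNReal.ofReal_mul (by positivity), ← ENNReal.ofReal_one]
        congr 1
        field_simp

/-- The bounded functions supported on sets of finite measure are dense in `L^Φ`. -/
theorem OrliczSpace.exists_bounded_norm_sub_le (h : DeltaTwoOn Φ μ) (u : OrliczSpace κ Φ μ) {δ : ℝ}
    (hδ : 0 < δ) : ∃ (f : α → ℂ) (C : ℝ) (s : Set α) (v : OrliczSpace κ Φ μ), Measurable f ∧
      (∀ x, ‖f x‖ ≤ C) ∧ MeasurableSet s ∧ μ s < ∞ ∧ (∀ x, x ∉ s → f x = 0) ∧ v =ᵐ[μ] f ∧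
      ‖u - v‖ ≤ δ := by
  -- Truncation from both sides: the lower cut gives finite measure, the upper cut gives
  -- boundedness.
  set S : ℕ → Set α := fun n => {x | ((n : ℝ) + 1)⁻¹ ≤ ‖u x‖} ∩ {x | ‖u x‖ ≤ n} with hS
  have hum := u.measurable
  have hSm : ∀ n, MeasurableSet (S n) := fun n =>
    (measurableSet_le measurable_const hum.norm).inter (measurableSet_le hum.norm measurable_const)
  have hSμ : ∀ n, μ (S n) < ∞ := fun n =>
    (measure_mono inter_subset_left).trans_lt (u.measure_norm_ge_lt_top h (by positivity))
  set f : ℕ → α → ℂ := fun n => (S n).indicator u with hf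
  have hfm : ∀ n, Measurable (f n) := fun n => hum.indicator (hSm n)
  have hfC : ∀ n x, ‖f n x‖ ≤ n := fun n x => by
    by_cases hx : x ∈ S n
    · simpa [hf, hx] using hx.2
    · simp [hf, hx]
  have hfs : ∀ n x, x ∉ S n → f n x = 0 := fun n x hx => by simp [hf, hx]
  have hΦ := Φ.measurable
  have hk : 0 < δ / 2 := half_pos hδ
  have hlim : Tendsto (fun n => modular Φ μ (fun x => ‖u x - f n x‖ / (δ / 2))) atTop (𝓝 0) := by
    have h0 : (0 : ℝ≥0∞) = ∫⁻ _, 0 ∂μ := by simp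
    rw [h0]
    refine tendsto_lintegral_of_dominated_convergence'
      (fun x => ENNReal.ofReal (Φ (‖u x‖ / (δ / 2)))) (fun n => ?_) (fun n => ae_of_all _ fun x => ?_)
      ?_ (ae_of_all _ fun x => ?_)
    · have := hfm n
      fun_prop
    · refine ENNReal.ofReal_le_ofReal (Φ.mono (by positivity) (div_le_div_of_nonneg_right ?_ hk.le))
      by_cases hx : x ∈ S n <;> simp [hf, hx]
    -- The dominating function is integrable at scale `δ/2` because `Δ₂` makes the modular finite at
    -- every scale.
    · have := h.modular_lt_top u.mem (a := (δ / 2)⁻¹) (by positivity)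
      simp only [div_eq_inv_mul _ (δ / 2)]
      exact this.ne
    · refine tendsto_const_nhds.congr' ?_
      rcases eq_or_ne (u x) 0 with hx | hx
      · refine Eventually.of_forall fun n => ?_
        have : f n x = 0 := by simp [hf, indicator_apply, hx]
        simp [this, hx, Φ.map_zero]
      · obtain ⟨N, hN⟩ := exists_nat_one_div_lt (norm_pos_iff.2 hx)
        obtain ⟨M, hM⟩ := exists_nat_ge ‖u x‖
        filter_upwards [eventually_ge_atTop (max N M)] with n hn
        have hn1 : (N : ℝ) ≤ n := by exact_mod_cast (le_max_left N M).trans hn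
        have hn2 : (M : ℝ) ≤ n := by exact_mod_cast (le_max_right N M).trans hn
        have hxS : x ∈ S n := by
          refine ⟨?_, hM.trans hn2⟩
          change ((n : ℝ) + 1)⁻¹ ≤ ‖u x‖
          rw [one_div] at hN
          refine le_trans ?_ hN.le
          gcongr
        simp [hf, hxS, Φ.map_zero]
  obtain ⟨n, hn⟩ := (ENNReal.tendsto_nhds_zero.1 hlim 1 one_pos).exists
  refine ⟨f n, n, S n, OrliczSpace.mk _ (memOrlicz_of_bounded (hfm n).aestronglyMeasurable (hSm n)
    (hSμ n) (hfC n) (hfs n)), hfm n, hfC n, hSm n, hSμ n, hfs n, AEEqFun.coeFn_mk _ _, ?_⟩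
  set v : OrliczSpace κ Φ μ := OrliczSpace.mk _ (memOrlicz_of_bounded (hfm n).aestronglyMeasurable
    (hSm n) (hSμ n) (hfC n) (hfs n))
  have hv : v =ᵐ[μ] f n := AEEqFun.coeFn_mk _ _
  have := (u - v).norm_le_of_ae_eq (f := fun x => u x - f n x) (k := δ / 2) (by
    filter_upwards [OrliczSpace.coeFn_sub u v, hv] with x h1 h2
    rw [h1, h2]) hk hn
  linarith

end Orlicz


/-! ### Continuous functions with compact support -/

section LocallyCompact

variable {X : Type*} [TopologicalSpace X] [LocallyCompactSpace X] [T2Space X] [MeasurableSpace X]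
  [BorelSpace X] {μ : Measure X} [μ.Regular]

theorem exists_compactlySupported_eLpNorm_indicator_sub_le (c : ℂ) {t : Set X}
    (ht : MeasurableSet t) (hμt : μ t < ∞) {ε : ℝ≥0∞} (hε : ε ≠ 0) :
    ∃ g : C_c(X, ℂ), eLpNorm (⇑g - t.indicator fun _ => c) 1 μ ≤ ε := by
  -- The approximating function differs from the indicator only on `t \ K` and `U \ K`, each of
  -- measure at most `δ`; adding `1` to the norm of `c` avoids division by zero.
  set δ : ℝ≥0∞ := ε / (2 * (‖c‖ₑ + 1)) with hδ
  have hδ0 : δ ≠ 0 := ENNReal.div_ne_zero.2 ⟨hε, by finiteness⟩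
  obtain ⟨K, hKt, hK, hKδ⟩ := ht.exists_isCompact_sdiff_lt hμt.ne hδ0
  obtain ⟨U, hKU, hU, hUδ⟩ := hK.exists_isOpen_lt_add (μ := μ) hδ0
  obtain ⟨k, hk1, hk0, hkc, hk01⟩ := exists_continuous_one_zero_of_isCompact hK hU.isClosed_compl
    (disjoint_compl_right_iff_subset.2 hKU)
  have hKμ : μ K < ∞ := hK.measure_lt_top
  have hUK : μ (U \ K) ≤ δ := by
    rw [measure_sdiff hKU hK.measurableSet.nullMeasurableSet hKμ.ne]
    exact tsub_le_iff_left.2 hUδ.le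
  let g : C_c(X, ℂ) := ⟨⟨fun x => c * (k x : ℂ), by fun_prop⟩,
    (hkc.comp_left (g := fun r : ℝ => c * (r : ℂ)) (by simp))⟩
  refine ⟨g, ?_⟩
  have hgx : ∀ x, g x = c * (k x : ℂ) := fun _ => rfl
  rw [eLpNorm_one_eq_lintegral_enorm]
  calc ∫⁻ x, ‖(⇑g - t.indicator fun _ => c) x‖ₑ ∂μ
      ≤ ∫⁻ x, (((t \ K).indicator (fun _ => ‖c‖ₑ) x) + ((U \ K).indicator (fun _ => ‖c‖ₑ) x)) ∂μ := by
        refine lintegral_mono fun x => ?_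
        rw [Pi.sub_apply, hgx]
        have hkx : ‖(k x : ℂ)‖ ≤ 1 := by
          rw [Complex.norm_real, Real.norm_eq_abs, abs_of_nonneg (hk01 x).1]; exact (hk01 x).2
        have hkx' : ‖1 - (k x : ℂ)‖ ≤ 1 := by
          rw [← Complex.ofReal_one, ← Complex.ofReal_sub, Complex.norm_real, Real.norm_eq_abs,
            abs_of_nonneg (sub_nonneg.2 (hk01 x).2)]
          linarith [(hk01 x).1]
        by_cases hxK : x ∈ K
        · simp [hk1 hxK, hKt hxK]
        by_cases hxt : x ∈ t
        · have h1 : ‖c * (k x : ℂ) - c‖ₑ ≤ ‖c‖ₑ := by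
            rw [← ofReal_norm, ← ofReal_norm, ← neg_sub, norm_neg,
              show c - c * (k x : ℂ) = c * (1 - (k x : ℂ)) by ring, norm_mul]
            exact ENNReal.ofReal_le_ofReal (mul_le_of_le_one_right (norm_nonneg c) hkx')
          simpa [hxt, hxK] using h1.trans le_self_add
        · by_cases hxU : x ∈ U
          · have h1 : ‖c * (k x : ℂ)‖ₑ ≤ ‖c‖ₑ := by
              rw [← ofReal_norm, ← ofReal_norm, norm_mul]
              exact ENNReal.ofReal_le_ofReal (mul_le_of_le_one_right (norm_nonneg c) hkx)
            simpa [hxt, hxK, hxU] using h1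
          · have : k x = 0 := hk0 hxU
            simp [hxt, hxU, this]
    _ = ‖c‖ₑ * μ (t \ K) + ‖c‖ₑ * μ (U \ K) := by
        rw [lintegral_add_left (measurable_const.indicator (ht.diff hK.measurableSet)),
          lintegral_indicator_const (ht.diff hK.measurableSet),
          lintegral_indicator_const (hU.measurableSet.diff hK.measurableSet)]
    _ ≤ (‖c‖ₑ + 1) * δ + (‖c‖ₑ + 1) * δ := by
        gcongr
        · exact le_self_add
        · exact le_self_add
    _ = ε := by
        rw [← two_mul, ← mul_assoc, hδ, ENNReal.mul_div_cancel (by simp) (by finiteness)]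

theorem exists_compactlySupported_lintegral_sub_le {f : X → ℂ} (hf : Integrable f μ) {ε : ℝ≥0∞}
    (hε : ε ≠ 0) : ∃ g : C_c(X, ℂ), ∫⁻ x, ‖f x - g x‖ₑ ∂μ ≤ ε := by
  have := (memLp_one_iff_integrable.2 hf).induction_dense ENNReal.one_ne_top
    (fun g => ∃ k : C_c(X, ℂ), ⇑k = g) (fun c t ht hμt ε hε => ?_) ?_ ?_ hε
  · obtain ⟨_, hg, k, rfl⟩ := this
    rw [eLpNorm_one_eq_lintegral_enorm] at hg
    exact ⟨k, hg⟩
  · obtain ⟨g, hg⟩ := exists_compactlySupported_eLpNorm_indicator_sub_le c ht hμt hε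
    exact ⟨g, hg, g, rfl⟩
  · rintro _ _ ⟨k, rfl⟩ ⟨l, rfl⟩
    exact ⟨k + l, rfl⟩
  · rintro _ ⟨k, rfl⟩
    exact k.continuous.aestronglyMeasurable

theorem exists_norm_compactlySupported_le (f : C_c(X, ℂ)) : ∃ C, ∀ x, ‖f x‖ ≤ C :=
  f.hasCompactSupport.exists_bound_of_continuous f.continuous

theorem integrable_compactlySupported (f : C_c(X, ℂ)) : Integrable f μ :=
  f.continuous.integrable_of_hasCompactSupport f.hasCompactSupport

variable {κ : OrliczNormKind} {Φ : NFunction}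

theorem memOrlicz_compactlySupported (f : C_c(X, ℂ)) :
    MemOrlicz Φ μ (AEEqFun.mk f f.continuous.aestronglyMeasurable) := by
  obtain ⟨C, hC⟩ := exists_norm_compactlySupported_le f
  exact memOrlicz_of_bounded _ (isClosed_tsupport f).measurableSet
    f.hasCompactSupport.isCompact.measure_lt_top hC fun x hx => image_eq_zero_of_notMem_tsupport hx

/-- The class in `L^Φ` of a continuous function with compact support. -/
def OrliczSpace.ofCc (f : C_c(X, ℂ)) : OrliczSpace κ Φ μ :=
  OrliczSpace.mk _ (memOrlicz_compactlySupported f)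

theorem OrliczSpace.coeFn_ofCc (f : C_c(X, ℂ)) :
    ((OrliczSpace.ofCc f : OrliczSpace κ Φ μ) : X → ℂ) =ᵐ[μ] f := AEEqFun.coeFn_mk _ _

/-- The radial retraction of `ℂ` onto the closed ball of radius `C`. -/
def radialRetraction (C : ℝ) (z : ℂ) : ℂ := ((C / max C ‖z‖ : ℝ) : ℂ) * z

theorem continuous_radialRetraction {C : ℝ} (hC : 0 < C) : Continuous (radialRetraction C) := by
  refine Continuous.mul (Complex.continuous_ofReal.comp ?_) continuous_id
  exact continuous_const.div (by fun_prop) fun z => (hC.trans_le (le_max_left _ _)).ne'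

theorem norm_radialRetraction_le {C : ℝ} (hC : 0 < C) (z : ℂ) : ‖radialRetraction C z‖ ≤ C := by
  have hm : 0 < max C ‖z‖ := hC.trans_le (le_max_left _ _)
  rw [radialRetraction, norm_mul, Complex.norm_real, Real.norm_eq_abs, abs_of_nonneg (by positivity),
    div_mul_eq_mul_div, div_le_iff₀ hm]
  exact mul_le_mul_of_nonneg_left (le_max_right _ _) hC.le

/-- The retraction moves `z` by the excess of `‖z‖` over `C`, which is at most `‖w - z‖` because `w`
is in the ball; the triangle inequality then gives the factor `2`. Thus an `L¹` approximation can be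
truncated without losing its quality. -/
theorem norm_sub_radialRetraction_le {C : ℝ} (hC : 0 < C) {w : ℂ} (hw : ‖w‖ ≤ C) (z : ℂ) :
    ‖w - radialRetraction C z‖ ≤ 2 * ‖w - z‖ := by
  have h1 : ‖z - radialRetraction C z‖ ≤ ‖w - z‖ := by
    rcases le_total ‖z‖ C with hz | hz
    · rw [radialRetraction, max_eq_left hz, div_self hC.ne']
      simp
    · have hz0 : 0 < ‖z‖ := hC.trans_le hz
      have he : z - radialRetraction C z = ((1 - C / ‖z‖ : ℝ) : ℂ) * z := by
        rw [radialRetraction, max_eq_right hz]; push_cast; ring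
      have h0 : 0 ≤ 1 - C / ‖z‖ := sub_nonneg.2 ((div_le_one hz0).2 hz)
      rw [he, norm_mul, Complex.norm_real, Real.norm_eq_abs, abs_of_nonneg h0, sub_mul,
        div_mul_cancel₀ _ hz0.ne', one_mul]
      have := norm_sub_norm_le z w
      rw [norm_sub_rev] at this
      linarith
  calc ‖w - radialRetraction C z‖ = ‖(w - z) + (z - radialRetraction C z)‖ := by congr 1; ring
    _ ≤ ‖w - z‖ + ‖z - radialRetraction C z‖ := norm_add_le _ _
    _ ≤ 2 * ‖w - z‖ := by linarith

theorem exists_compactlySupported_norm_le_lintegral_sub_le {f : X → ℂ} (hf : Integrable f μ)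
    {C : ℝ} (hC : 0 < C) (hfC : ∀ x, ‖f x‖ ≤ C) {ε : ℝ} (hε : 0 < ε) :
    ∃ g : C_c(X, ℂ), (∀ x, ‖g x‖ ≤ C) ∧ ∫⁻ x, ‖f x - g x‖ₑ ∂μ ≤ ENNReal.ofReal ε := by
  obtain ⟨g₀, hg₀⟩ := exists_compactlySupported_lintegral_sub_le hf
    (ε := ENNReal.ofReal (ε / 2)) (by simpa using hε)
  refine ⟨⟨⟨fun x => radialRetraction C (g₀ x),
    (continuous_radialRetraction hC).comp g₀.continuous⟩,
    g₀.hasCompactSupport.comp_left (g := radialRetraction C) (mul_zero _)⟩,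
    fun x => norm_radialRetraction_le hC (g₀ x), ?_⟩
  calc ∫⁻ x, ‖f x - radialRetraction C (g₀ x)‖ₑ ∂μ
      ≤ ∫⁻ x, 2 * ‖f x - g₀ x‖ₑ ∂μ := by
        refine lintegral_mono fun x => ?_
        rw [← ofReal_norm, ← ofReal_norm, show (2 : ℝ≥0∞) = ENNReal.ofReal 2 by norm_num,
          ← ENNReal.ofReal_mul zero_le_two]
        exact ENNReal.ofReal_le_ofReal (norm_sub_radialRetraction_le hC (hfC x) _)
    _ = 2 * ∫⁻ x, ‖f x - g₀ x‖ₑ ∂μ := lintegral_const_mul' _ _ (by simp)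
    _ ≤ 2 * ENNReal.ofReal (ε / 2) := by gcongr
    _ = ENNReal.ofReal ε := by
        rw [show (2 : ℝ≥0∞) = ENNReal.ofReal 2 by norm_num, ← ENNReal.ofReal_mul zero_le_two]
        congr 1
        ring

theorem OrliczSpace.exists_ofCc_norm_sub_le_of_bounded (v : OrliczSpace κ Φ μ) {f : X → ℂ}
    (hfi : Integrable f μ) {C : ℝ} (hC : 0 < C) (hfC : ∀ x, ‖f x‖ ≤ C) (hv : v =ᵐ[μ] f) {k : ℝ}
    (hk : 0 < k) : ∃ g : C_c(X, ℂ), ‖v - OrliczSpace.ofCc g‖ ≤ 2 * k := by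
  have hpos : 0 < Φ (2 * C / k) := Φ.pos (by positivity)
  -- The difference of two functions bounded by `C` is bounded by `2C`, and the required `L¹`
  -- accuracy is the threshold of `OrliczSpace.norm_le_of_bounded_of_lintegral_le` for that bound.
  obtain ⟨g, hgC, hg⟩ := exists_compactlySupported_norm_le_lintegral_sub_le hfi hC hfC
    (ε := 2 * C / Φ (2 * C / k)) (by positivity)
  refine ⟨g, ?_⟩
  have hvg : ((v - OrliczSpace.ofCc g : OrliczSpace κ Φ μ) : X → ℂ) =ᵐ[μ] fun x => f x - g x := by
    filter_upwards [OrliczSpace.coeFn_sub v (OrliczSpace.ofCc g), hv,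
      OrliczSpace.coeFn_ofCc (κ := κ) (Φ := Φ) (μ := μ) g] with x h1 h2 h3
    rw [h1, h2, h3]
  refine OrliczSpace.norm_le_of_bounded_of_lintegral_le _ (C := 2 * C) (by positivity) hk ?_ ?_
  · filter_upwards [hvg] with x hx
    rw [hx]
    linarith [norm_sub_le (f x) (g x), hfC x, hgC x]
  · refine le_trans (le_of_eq (lintegral_congr_ae ?_)) hg
    filter_upwards [hvg] with x hx
    rw [hx]

/-- The continuous functions with compact support are dense in `L^Φ`. -/
theorem OrliczSpace.exists_ofCc_norm_sub_le (h : DeltaTwoOn Φ μ) (u : OrliczSpace κ Φ μ) {δ : ℝ}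
    (hδ : 0 < δ) : ∃ g : C_c(X, ℂ), ‖u - OrliczSpace.ofCc g‖ ≤ δ := by
  obtain ⟨f, C₀, s, v, hfm, hfC₀, hs, hμs, hfs, hv, huv⟩ := u.exists_bounded_norm_sub_le h
    (half_pos hδ)
  have hfC : ∀ x, ‖f x‖ ≤ max C₀ 1 := fun x => (hfC₀ x).trans (le_max_left _ _)
  have hfi : Integrable f μ := by
    rw [← integrableOn_iff_integrable_of_support_subset (s := s)
      (fun x hx => by by_contra hxs; exact hx (hfs x hxs))]
    exact Measure.integrableOn_of_bounded hμs.ne hfm.aestronglyMeasurable (ae_of_all _ hfC)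
  obtain ⟨g, hg⟩ := v.exists_ofCc_norm_sub_le_of_bounded hfi
    (one_pos.trans_le (le_max_right C₀ 1)) hfC hv (k := δ / 4) (by positivity)
  refine ⟨g, ?_⟩
  calc ‖u - OrliczSpace.ofCc g‖ = ‖(u - v) + (v - OrliczSpace.ofCc g)‖ := by congr 1; abel
    _ ≤ ‖u - v‖ + ‖v - OrliczSpace.ofCc g‖ := norm_add_le _ _
    _ ≤ δ := by linarith

theorem OrliczSpace.denseRange_ofCc (h : DeltaTwoOn Φ μ) :
    DenseRange (OrliczSpace.ofCc : C_c(X, ℂ) → OrliczSpace κ Φ μ) := by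
  refine Metric.denseRange_iff.2 fun u r hr => ?_
  obtain ⟨g, hg⟩ := u.exists_ofCc_norm_sub_le h (half_pos hr)
  exact ⟨g, by rw [dist_eq_norm]; linarith⟩

theorem OrliczSpace.exists_seq_ofCc_tendsto (h : DeltaTwoOn Φ μ) (u : OrliczSpace κ Φ μ) :
    ∃ g : ℕ → C_c(X, ℂ), Tendsto (fun n => (OrliczSpace.ofCc (g n) : OrliczSpace κ Φ μ)) atTop
      (𝓝 u) := by
  choose g hg using fun n : ℕ => u.exists_ofCc_norm_sub_le h (δ := 1 / ((n : ℝ) + 1)) (by positivity)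
  refine ⟨g, ?_⟩
  rw [tendsto_iff_norm_sub_tendsto_zero]
  refine squeeze_zero (fun _ => norm_nonneg _) (fun n => ?_) tendsto_one_div_add_atTop_nhds_zero_nat
  rw [norm_sub_rev]
  exact hg n

theorem exists_seq_compactlySupported_tendsto {f : X → ℂ} (hf : Integrable f μ) :
    ∃ g : ℕ → C_c(X, ℂ), Tendsto (fun n => ∫ x, ‖f x - g n x‖ ∂μ) atTop (𝓝 0) := by
  choose g hg using fun n : ℕ => exists_compactlySupported_lintegral_sub_le hf
    (ε := ENNReal.ofReal (1 / ((n : ℝ) + 1))) (by simp; positivity)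
  refine ⟨g, squeeze_zero (fun n => integral_nonneg fun _ => norm_nonneg _) (fun n => ?_)
    tendsto_one_div_add_atTop_nhds_zero_nat⟩
  have hm : AEStronglyMeasurable (fun x => f x - g n x) μ :=
    hf.aestronglyMeasurable.sub (g n).continuous.aestronglyMeasurable
  rw [integral_norm_eq_lintegral_enorm hm]
  exact ENNReal.toReal_le_of_le_ofReal (by positivity) (hg n)

end LocallyCompact


section Group

variable {G : Type*} [Group G] [TopologicalSpace G] [IsTopologicalGroup G] [LocallyCompactSpace G]
  [T2Space G] [MeasurableSpace G] [BorelSpace G] {μ : Measure G} [μ.IsHaarMeasure] [μ.Regular]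
  {κ : OrliczNormKind} {Φ : NFunction}

/-- The additive constant `Φ(2x₀)` covers the range below `x₀` by monotonicity. It vanishes when `G`
is not compact, and otherwise the Haar measure is finite. -/
theorem DeltaTwo.deltaTwoOn (h : DeltaTwo G Φ) : DeltaTwoOn Φ μ := by
  obtain ⟨k, hk, x₀, hx₀, hG, hle⟩ := h
  refine ⟨k, Φ (2 * x₀), hk.le, Φ.nonneg _, ?_, fun x hx => ?_⟩
  · by_cases hc : CompactSpace G
    · exact Or.inr isCompact_univ.measure_lt_top
    · left
      rw [hG hc, mul_zero, Φ.map_zero]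
  · rcases le_total x₀ x with hxx | hxx
    · exact (hle x hxx).trans (le_add_of_nonneg_right (Φ.nonneg _))
    · exact (Φ.mono (by positivity) (by linarith)).trans
        (le_add_of_nonneg_left (mul_nonneg hk.le (Φ.nonneg _)))

/-! ### Translations -/

theorem ae_inv_mul {p : G → Prop} (y : G) (h : ∀ᵐ x ∂μ, p x) : ∀ᵐ x ∂μ, p (y⁻¹ * x) :=
  (measurePreserving_mul_left μ y⁻¹).quasiMeasurePreserving.ae h

/-- Left translation of almost everywhere classes. -/
def translateAE (y : G) (f : G →ₘ[μ] ℂ) : G →ₘ[μ] ℂ :=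
  f.compMeasurePreserving (fun x => y⁻¹ * x) (measurePreserving_mul_left μ y⁻¹)

theorem coeFn_translateAE (y : G) (f : G →ₘ[μ] ℂ) :
    translateAE y f =ᵐ[μ] fun x => f (y⁻¹ * x) :=
  AEEqFun.coeFn_compMeasurePreserving f (measurePreserving_mul_left μ y⁻¹)

theorem translateAE_mul (y z : G) (f : G →ₘ[μ] ℂ) :
    translateAE (y * z) f = translateAE y (translateAE z f) := by
  refine AEEqFun.ext ?_
  filter_upwards [coeFn_translateAE (y * z) f, coeFn_translateAE y (translateAE z f),
    ae_inv_mul y (coeFn_translateAE z f)] with x h1 h2 h3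
  rw [h1, h2, h3, mul_inv_rev, mul_assoc]

theorem translateAE_one (f : G →ₘ[μ] ℂ) : translateAE 1 f = f := by
  refine AEEqFun.ext ?_
  filter_upwards [coeFn_translateAE 1 f] with x h1
  rw [h1, inv_one, one_mul]

theorem modular_translateAE (φ : ℝ → ℝ) (F : ℝ → ℝ) (y : G) (f : G →ₘ[μ] ℂ) :
    modular φ μ (fun x => F ‖translateAE y f x‖) = modular φ μ (fun x => F ‖f x‖) := by
  unfold modular
  rw [← lintegral_mul_left_eq_self (fun x => ENNReal.ofReal (φ (F ‖f x‖))) y⁻¹]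
  refine lintegral_congr_ae ?_
  filter_upwards [coeFn_translateAE y f] with x hx
  rw [hx]

/-- Left invariance moves the translation to the test function, which stays admissible. -/
theorem orliczENorm_translateAE_le (y : G) (f : G →ₘ[μ] ℂ) :
    orliczENorm Φ μ (translateAE y f) ≤ orliczENorm Φ μ f := by
  refine iSup_le fun g => ?_
  have hg := g.2
  rw [← modular_translateAE Φ.complementary (fun t => t) y⁻¹] at hg
  refine le_trans (le_of_eq ?_) (le_iSup (fun h : {g : G →ₘ[μ] ℂ //
    modular Φ.complementary μ (fun x => ‖g x‖) ≤ 1} => ∫⁻ x, ‖f x * (h : G →ₘ[μ] ℂ) x‖ₑ ∂μ)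
      ⟨translateAE y⁻¹ g, hg⟩)
  rw [← lintegral_mul_left_eq_self (fun x => ‖f x * (translateAE y⁻¹ (g : G →ₘ[μ] ℂ)) x‖ₑ) y⁻¹]
  refine lintegral_congr_ae ?_
  filter_upwards [coeFn_translateAE y f,
    ae_inv_mul y (coeFn_translateAE y⁻¹ (g : G →ₘ[μ] ℂ))] with x h1 h2
  rw [h1, h2, inv_inv, mul_inv_cancel_left]

theorem orliczNorm_translateAE (y : G) (f : G →ₘ[μ] ℂ) :
    orliczNorm κ Φ μ (translateAE y f) = orliczNorm κ Φ μ f := by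
  cases κ
  · change sInf _ = sInf _
    congr 1
    ext k
    exact and_congr_right fun _ => by rw [modular_translateAE Φ (fun t => t / k)]
  · change (orliczENorm Φ μ _).toReal = (orliczENorm Φ μ _).toReal
    congr 1
    refine le_antisymm (orliczENorm_translateAE_le y f) ?_
    have := orliczENorm_translateAE_le (Φ := Φ) y⁻¹ (translateAE y f)
    rwa [← translateAE_mul, inv_mul_cancel, translateAE_one] at this

theorem MemOrlicz.translateAE {f : G →ₘ[μ] ℂ} (hf : MemOrlicz Φ μ f) (y : G) :
    MemOrlicz Φ μ (translateAE y f) := by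
  obtain ⟨a, ha, hfin⟩ := hf
  exact ⟨a, ha, by rwa [modular_translateAE Φ (fun t => a * t)]⟩

/-- Left translation `(L_y u)(x) = u(y⁻¹ x)` on `L^Φ(G)`. -/
def translate (y : G) : OrliczSpace κ Φ μ →ₗᵢ[ℂ] OrliczSpace κ Φ μ where
  toFun u := OrliczSpace.mk (translateAE y u.toAEEqFun) (u.mem.translateAE y)
  map_add' u v := by
    refine OrliczSpace.toAEEqFun_injective (AEEqFun.ext ?_)
    simp only [OrliczSpace.toAEEqFun_add, OrliczSpace.toAEEqFun_mk]
    filter_upwards [coeFn_translateAE y (u.toAEEqFun + v.toAEEqFun),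
      coeFn_translateAE y u.toAEEqFun, coeFn_translateAE y v.toAEEqFun,
      ae_inv_mul y (AEEqFun.coeFn_add u.toAEEqFun v.toAEEqFun),
      AEEqFun.coeFn_add (translateAE y u.toAEEqFun) (translateAE y v.toAEEqFun)]
      with x h1 h2 h3 h4 h5
    rw [h1, h4, h5, Pi.add_apply, Pi.add_apply, h2, h3]
  map_smul' c u := by
    refine OrliczSpace.toAEEqFun_injective (AEEqFun.ext ?_)
    simp only [OrliczSpace.toAEEqFun_smul, OrliczSpace.toAEEqFun_mk, RingHom.id_apply]
    filter_upwards [coeFn_translateAE y (c • u.toAEEqFun), coeFn_translateAE y u.toAEEqFun,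
      ae_inv_mul y (AEEqFun.coeFn_smul c u.toAEEqFun),
      AEEqFun.coeFn_smul c (translateAE y u.toAEEqFun)] with x h1 h2 h4 h5
    rw [h1, h4, h5, Pi.smul_apply, Pi.smul_apply, h2]
  norm_map' u := by
    rw [OrliczSpace.norm_eq, OrliczSpace.norm_eq u]
    exact orliczNorm_translateAE y _

theorem coeFn_translate (y : G) (u : OrliczSpace κ Φ μ) :
    (translate y u : OrliczSpace κ Φ μ) =ᵐ[μ] fun x => u (y⁻¹ * x) :=
  coeFn_translateAE y u.toAEEqFun

theorem translate_mul (y z : G) (u : OrliczSpace κ Φ μ) :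
    translate (y * z) u = translate y (translate z u) :=
  OrliczSpace.toAEEqFun_injective (translateAE_mul y z u.toAEEqFun)

/-- Left translation of continuous functions with compact support. -/
def translateCc (y : G) (f : C_c(G, ℂ)) : C_c(G, ℂ) :=
  ⟨⟨fun x => f (y⁻¹ * x), by fun_prop⟩,
    f.hasCompactSupport.comp_homeomorph (Homeomorph.mulLeft y⁻¹)⟩

theorem translateCc_apply (y : G) (f : C_c(G, ℂ)) (x : G) : translateCc y f x = f (y⁻¹ * x) := rfl

theorem translate_ofCc (y : G) (f : C_c(G, ℂ)) :
    (translate y (OrliczSpace.ofCc f) : OrliczSpace κ Φ μ) =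
      OrliczSpace.ofCc (translateCc y f) := by
  refine OrliczSpace.ext_ae ?_
  filter_upwards [coeFn_translate (κ := κ) (Φ := Φ) (μ := μ) y (OrliczSpace.ofCc f),
    ae_inv_mul y (OrliczSpace.coeFn_ofCc (κ := κ) (Φ := Φ) (μ := μ) f),
    OrliczSpace.coeFn_ofCc (κ := κ) (Φ := Φ) (μ := μ) (translateCc y f)] with x h1 h2 h3
  rw [h1, h2, h3, translateCc_apply]

/-- Uniform continuity of a continuous function with compact support, with control of the
supports of the translates. -/
theorem exists_isCompact_eventually_translate_sub (f : C_c(G, ℂ)) : ∃ K : Set G, IsCompact K ∧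
    ∀ ε > 0, ∀ᶠ y in 𝓝 (1 : G), (∀ x, ‖f (y⁻¹ * x) - f x‖ ≤ ε) ∧
      ∀ x, x ∉ K → f (y⁻¹ * x) - f x = 0 := by
  obtain ⟨N, hN, hN1⟩ := exists_compact_mem_nhds (1 : G)
  have hKc : IsCompact (N * tsupport f) := hN.mul f.hasCompactSupport.isCompact
  have hout : ∀ y ∈ N, ∀ x, x ∉ N * tsupport f → f (y⁻¹ * x) - f x = 0 := by
    intro y hy x hx
    have h1 : f (y⁻¹ * x) = 0 := by
      refine image_eq_zero_of_notMem_tsupport fun hmem => hx ?_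
      exact ⟨y, hy, y⁻¹ * x, hmem, by simp⟩
    have h2 : f x = 0 := by
      refine image_eq_zero_of_notMem_tsupport fun hmem => hx ?_
      exact ⟨1, mem_of_mem_nhds hN1, x, hmem, by simp⟩
    rw [h1, h2, sub_zero]
  refine ⟨_, hKc, fun ε hε => ?_⟩
  have h1 : ∀ᶠ y in 𝓝 (1 : G), ∀ x ∈ N * tsupport f, ‖f (y⁻¹ * x) - f x‖ < ε := by
    refine hKc.eventually_forall_of_forall_eventually fun x _ => ?_
    have hcont : Continuous fun p : G × G => ‖f (p.1⁻¹ * p.2) - f p.2‖ := by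
      have := f.continuous
      fun_prop
    have := hcont.tendsto (1, x)
    simp only [inv_one, one_mul, sub_self, norm_zero] at this
    exact this.eventually_lt_const hε
  filter_upwards [h1, hN1] with y hy hyN
  refine ⟨fun x => ?_, hout y hyN⟩
  by_cases hx : x ∈ N * tsupport f
  · exact (hy x hx).le
  · rw [hout y hyN x hx, norm_zero]
    exact hε.le

theorem eventually_integral_norm_translate_sub_le (f : C_c(G, ℂ)) {ε : ℝ} (hε : 0 < ε) :
    ∀ᶠ y in 𝓝 (1 : G), ∫ x, ‖f (y⁻¹ * x) - f x‖ ∂μ ≤ ε := by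
  obtain ⟨K, hK, h⟩ := exists_isCompact_eventually_translate_sub f
  have hμ : 0 ≤ μ.real K := measureReal_nonneg
  filter_upwards [h (ε / (μ.real K + 1)) (by positivity)] with y hy
  rw [← setIntegral_eq_integral_of_forall_compl_eq_zero (s := K)
    (fun x hx => by rw [hy.2 x hx, norm_zero])]
  calc ∫ x in K, ‖f (y⁻¹ * x) - f x‖ ∂μ ≤ ‖∫ x in K, ‖f (y⁻¹ * x) - f x‖ ∂μ‖ := le_abs_self _
    _ ≤ ε / (μ.real K + 1) * μ.real K := by
        refine norm_setIntegral_le_of_norm_le_const hK.measure_lt_top fun x _ => ?_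
        rw [norm_norm]; exact hy.1 x
    _ ≤ ε := by
        rw [div_mul_eq_mul_div, div_le_iff₀ (by positivity)]
        nlinarith

theorem eventually_norm_translate_sub_le (h : DeltaTwoOn Φ μ) (u : OrliczSpace κ Φ μ) {ε : ℝ}
    (hε : 0 < ε) : ∀ᶠ y in 𝓝 (1 : G), ‖translate y u - u‖ ≤ ε := by
  obtain ⟨g, hg⟩ := u.exists_ofCc_norm_sub_le h (δ := ε / 3) (by positivity)
  obtain ⟨K, hK, hgK⟩ := exists_isCompact_eventually_translate_sub g
  obtain ⟨δ, hδ, hδε⟩ := OrliczSpace.exists_norm_le_of_bounded (κ := κ) (Φ := Φ)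
    hK.measurableSet (hK.measure_lt_top (μ := μ)) (δ := ε / 3) (by positivity)
  filter_upwards [hgK δ hδ] with y hy
  have h1 : ‖translate y (OrliczSpace.ofCc g : OrliczSpace κ Φ μ) - OrliczSpace.ofCc g‖ ≤ ε / 3 := by
    refine hδε _ (fun x => g (y⁻¹ * x) - g x) ?_ hy.1 hy.2
    rw [translate_ofCc]
    filter_upwards [OrliczSpace.coeFn_sub (κ := κ) (Φ := Φ) (μ := μ)
      (OrliczSpace.ofCc (translateCc y g)) (OrliczSpace.ofCc g),
      OrliczSpace.coeFn_ofCc (κ := κ) (Φ := Φ) (μ := μ) g,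
      OrliczSpace.coeFn_ofCc (κ := κ) (Φ := Φ) (μ := μ) (translateCc y g)] with x h1 h2 h3
    rw [h1, h2, h3, translateCc_apply]
  have h2 : ‖translate y (u - OrliczSpace.ofCc g)‖ ≤ ε / 3 := by
    rw [(translate y).norm_map]; exact hg
  -- The three-term estimate: translation is isometric, so only the middle term, for a function in
  -- `C_c(G)`, uses uniform continuity.
  have he : translate y u - u = translate y (u - OrliczSpace.ofCc g) +
      (translate y (OrliczSpace.ofCc g) - OrliczSpace.ofCc g) - (u - OrliczSpace.ofCc g) := by
    rw [map_sub]; abel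
  rw [he]
  refine (norm_sub_le _ _).trans ?_
  linarith [norm_add_le (translate y (u - OrliczSpace.ofCc g))
    (translate y (OrliczSpace.ofCc g) - OrliczSpace.ofCc g : OrliczSpace κ Φ μ)]

theorem continuous_translate (h : DeltaTwoOn Φ μ) (u : OrliczSpace κ Φ μ) :
    Continuous fun y : G => translate y u := by
  refine continuous_iff_continuousAt.2 fun z => ?_
  rw [ContinuousAt, tendsto_iff_norm_sub_tendsto_zero, Metric.tendsto_nhds]
  intro ε hε
  have ht : Tendsto (fun y => z⁻¹ * y) (𝓝 z) (𝓝 1) := by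
    have : Continuous fun y : G => z⁻¹ * y := by fun_prop
    simpa using this.tendsto z
  filter_upwards [ht.eventually (eventually_norm_translate_sub_le h u (half_pos hε))] with y hy
  have : translate y u - translate z u = translate z (translate (z⁻¹ * y) u - u) := by
    rw [map_sub, ← translate_mul, mul_inv_cancel_left]
  rw [this, (translate z).norm_map, Real.dist_eq, sub_zero, abs_of_nonneg (norm_nonneg _)]
  linarith

/-! ### Convolution operators given by continuous functions with compact support -/

theorem integrable_smul_translate (h : DeltaTwoOn Φ μ) (f : C_c(G, ℂ)) (u : OrliczSpace κ Φ μ) :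
    Integrable (fun y => f y • translate y u) μ :=
  (f.continuous.smul (continuous_translate h u)).integrable_of_hasCompactSupport
    f.hasCompactSupport.smul_right

/-- The operator `u ↦ ∫ f(y) L_y u dy`. -/
def convOp (κ : OrliczNormKind) (h : DeltaTwoOn Φ μ) (f : C_c(G, ℂ)) :
    OrliczSpace κ Φ μ →L[ℂ] OrliczSpace κ Φ μ :=
  LinearMap.mkContinuous
    { toFun := fun u => ∫ y, f y • translate y u ∂μ
      map_add' := fun u v => by
        rw [← integral_add (integrable_smul_translate h f u) (integrable_smul_translate h f v)]
        simp only [map_add, smul_add]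
      map_smul' := fun c u => by
        rw [RingHom.id_apply, ← integral_smul]
        simp only [map_smul, smul_comm c] }
    (∫ y, ‖f y‖ ∂μ)
    fun u => by
      refine (norm_integral_le_integral_norm _).trans (le_of_eq ?_)
      rw [← integral_mul_const]
      simp only [norm_smul, LinearIsometry.norm_map]

theorem convOp_apply (h : DeltaTwoOn Φ μ) (f : C_c(G, ℂ)) (u : OrliczSpace κ Φ μ) :
    convOp κ h f u = ∫ y, f y • translate y u ∂μ := rfl

theorem norm_convOp_le (h : DeltaTwoOn Φ μ) (f : C_c(G, ℂ)) :
    ‖convOp κ h f‖ ≤ ∫ y, ‖f y‖ ∂μ :=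
  LinearMap.mkContinuous_norm_le _ (integral_nonneg fun _ => norm_nonneg _) _

theorem convOp_sub (h : DeltaTwoOn Φ μ) (f g : C_c(G, ℂ)) :
    convOp κ h (f - g) = convOp κ h f - convOp κ h g := by
  ext1 u
  rw [sub_apply, convOp_apply, convOp_apply, convOp_apply,
    ← integral_sub (integrable_smul_translate h f u) (integrable_smul_translate h g u)]
  simp only [CompactlySupportedContinuousMap.coe_sub, Pi.sub_apply, sub_smul]

theorem convOp_add (h : DeltaTwoOn Φ μ) (f g : C_c(G, ℂ)) :
    convOp κ h (f + g) = convOp κ h f + convOp κ h g := by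
  ext1 u
  rw [add_apply, convOp_apply, convOp_apply, convOp_apply,
    ← integral_add (integrable_smul_translate h f u) (integrable_smul_translate h g u)]
  simp only [CompactlySupportedContinuousMap.coe_add, Pi.add_apply, add_smul]

theorem convOp_smul (h : DeltaTwoOn Φ μ) (c : ℂ) (f : C_c(G, ℂ)) :
    convOp κ h (c • f) = c • convOp κ h f := by
  ext1 u
  rw [smul_apply, convOp_apply, convOp_apply, ← integral_smul]
  simp only [CompactlySupportedContinuousMap.coe_smul, Pi.smul_apply, smul_eq_mul, mul_smul]

/-- Translation passes through the Bochner integral, and left invariance shifts the variable. This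
turns a translate of the operator's value into a translate of its kernel, where `L¹` estimates
apply. -/
theorem translate_convOp (h : DeltaTwoOn Φ μ) (z : G) (f : C_c(G, ℂ)) (u : OrliczSpace κ Φ μ) :
    translate z (convOp κ h f u) = convOp κ h (translateCc z f) u := by
  have : CompleteSpace (OrliczSpace κ Φ μ) := OrliczSpace.completeSpace h
  rw [convOp_apply, convOp_apply]
  have h1 := (translate z : OrliczSpace κ Φ μ →ₗᵢ[ℂ] OrliczSpace κ Φ μ).toContinuousLinearMap.integral_comp_comm
    (integrable_smul_translate h f u)
  simp only [LinearIsometry.coe_toContinuousLinearMap, map_smul] at h1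
  rw [← h1, ← integral_mul_left_eq_self (fun y => translateCc z f y • translate y u) z]
  simp only [translateCc_apply, inv_mul_cancel_left, translate_mul]

theorem hasCompactSupport_uncurry_conv {R : Type*} [NormedRing R] (f g : C_c(G, R)) :
    HasCompactSupport (Function.uncurry fun y x => f y * g (y⁻¹ * x)) := by
  refine HasCompactSupport.intro (f.hasCompactSupport.isCompact.prod
    (f.hasCompactSupport.isCompact.mul g.hasCompactSupport.isCompact)) ?_
  rintro ⟨y, x⟩ hyx
  by_contra hne
  have hy : y ∈ tsupport f := by
    by_contra hy
    exact hne (by simp [Function.uncurry, image_eq_zero_of_notMem_tsupport hy])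
  have hx : y⁻¹ * x ∈ tsupport g := by
    by_contra hx
    exact hne (by simp [Function.uncurry, image_eq_zero_of_notMem_tsupport hx])
  exact hyx ⟨hy, y, hy, y⁻¹ * x, hx, by simp⟩

theorem continuous_uncurry_conv {R : Type*} [NormedRing R] (f g : C_c(G, R)) :
    Continuous (Function.uncurry fun y x => f y * g (y⁻¹ * x)) := by
  have hf := f.continuous
  have hg := g.continuous
  change Continuous fun p : G × G => f p.1 * g (p.1⁻¹ * p.2)
  fun_prop

/-- The convolution of continuous functions with compact support. -/
def convCc {R : Type*} [NormedRing R] [NormedSpace ℝ R] (μ : Measure G)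
    [IsFiniteMeasureOnCompacts μ] (f g : C_c(G, R)) : C_c(G, R) :=
  ⟨⟨fun x => ∫ y, f y * g (y⁻¹ * x) ∂μ, by
      rw [← continuousOn_univ]
      refine continuousOn_integral_of_compact_support f.hasCompactSupport.isCompact
        (f := fun x y => f y * g (y⁻¹ * x)) ?_ fun x y _ hy => ?_
      · exact ((continuous_uncurry_conv f g).comp continuous_swap).continuousOn
      · rw [image_eq_zero_of_notMem_tsupport hy, zero_mul]⟩,
    HasCompactSupport.intro
      (f.hasCompactSupport.isCompact.mul g.hasCompactSupport.isCompact) fun x hx => by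
        refine integral_eq_zero_of_ae (ae_of_all _ fun y => ?_)
        by_contra hne
        have hy : y ∈ tsupport f := by
          by_contra hy
          exact hne (by simp [image_eq_zero_of_notMem_tsupport hy])
        have hy' : y⁻¹ * x ∈ tsupport g := by
          by_contra hx
          exact hne (by simp [image_eq_zero_of_notMem_tsupport hx])
        exact hx ⟨y, hy, y⁻¹ * x, hy', by simp⟩⟩

theorem convCc_apply (f g : C_c(G, ℂ)) (x : G) :
    convCc μ f g x = ∫ y, f y * g (y⁻¹ * x) ∂μ := rfl

/-- Integration over a set of finite measure is a continuous functional, so it commutes with the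
Bochner integral. What remains is an interchange of integrals for a continuous integrand with
compact support. -/
theorem convOp_ofCc (h : DeltaTwoOn Φ μ) (f g : C_c(G, ℂ)) :
    convOp κ h f (OrliczSpace.ofCc g) = OrliczSpace.ofCc (convCc μ f g) := by
  have : CompleteSpace (OrliczSpace κ Φ μ) := OrliczSpace.completeSpace h
  rw [← sub_eq_zero]
  refine OrliczSpace.eq_zero_of_forall_setIntegral_eq_zero h fun s hs hμs => ?_
  rw [← OrliczSpace.setIntegralCLM_apply h hs hμs, map_sub, sub_eq_zero, convOp_apply,
    ← ContinuousLinearMap.integral_comp_comm _ (integrable_smul_translate h f _),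
    OrliczSpace.setIntegralCLM_apply]
  have h1 : ∀ y, OrliczSpace.setIntegralCLM h hs hμs
      (f y • translate y (OrliczSpace.ofCc g : OrliczSpace κ Φ μ)) =
      ∫ x in s, f y * g (y⁻¹ * x) ∂μ := by
    intro y
    rw [map_smul, OrliczSpace.setIntegralCLM_apply, translate_ofCc, smul_eq_mul,
      ← integral_const_mul]
    refine integral_congr_ae (ae_restrict_of_ae ?_)
    filter_upwards [OrliczSpace.coeFn_ofCc (κ := κ) (Φ := Φ) (μ := μ) (translateCc y g)] with x hx
    rw [hx, translateCc_apply]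
  have h2 : ∫ x in s, (OrliczSpace.ofCc (convCc μ f g) : OrliczSpace κ Φ μ) x ∂μ =
      ∫ x in s, ∫ y, f y * g (y⁻¹ * x) ∂μ ∂μ :=
    integral_congr_ae (ae_restrict_of_ae (OrliczSpace.coeFn_ofCc _))
  simp only [h1]
  rw [h2]
  exact integral_integral_swap_of_hasCompactSupport (continuous_uncurry_conv f g)
    (hasCompactSupport_uncurry_conv f g)

theorem integral_integral_conv_smul (h : DeltaTwoOn Φ μ) (f g : C_c(G, ℂ))
    (u : OrliczSpace κ Φ μ) :
    ∫ y, ∫ x, (f y * g (y⁻¹ * x)) • translate x u ∂μ ∂μ =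
      ∫ x, ∫ y, (f y * g (y⁻¹ * x)) • translate x u ∂μ ∂μ := by
  have hc : Continuous fun p : G × G => translate p.2 u :=
    (continuous_translate h u).comp continuous_snd
  refine integral_integral_swap_of_hasCompactSupport
    (f := fun y x => (f y * g (y⁻¹ * x)) • translate x u) ?_ ?_
  · exact (continuous_uncurry_conv f g).smul hc
  · refine (hasCompactSupport_uncurry_conv f g).mono fun p hp hp0 => hp ?_
    change (Function.uncurry fun y x => f y * g (y⁻¹ * x)) p • translate p.2 u = 0
    rw [hp0, zero_smul]

/-- Associativity of convolution, as a vector-valued interchange of integrals after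
`translate_convOp` has absorbed the outer translation into the kernel. -/
theorem convOp_mul (h : DeltaTwoOn Φ μ) (f g : C_c(G, ℂ)) :
    convOp κ h f * convOp κ h g = convOp κ h (convCc μ f g) := by
  have : CompleteSpace (OrliczSpace κ Φ μ) := OrliczSpace.completeSpace h
  ext1 u
  have h1 : ∀ y, f y • translate y (convOp κ h g u) =
      ∫ x, (f y * g (y⁻¹ * x)) • translate x u ∂μ := by
    intro y
    rw [translate_convOp, convOp_apply, ← integral_smul]
    simp only [mul_smul, translateCc_apply]
  have h2 : ∀ x, (convCc μ f g) x • translate x u =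
      ∫ y, (f y * g (y⁻¹ * x)) • translate x u ∂μ := by
    intro x
    rw [convCc_apply, integral_smul_const]
  change convOp κ h f (convOp κ h g u) = _
  rw [convOp_apply, convOp_apply h (convCc μ f g)]
  simp only [h1, h2]
  exact integral_integral_conv_smul h f g u

end Group


section Group

variable {G : Type*} [Group G] [TopologicalSpace G] [IsTopologicalGroup G] [LocallyCompactSpace G]
  [T2Space G] [MeasurableSpace G] [BorelSpace G] {μ : Measure G} [μ.IsHaarMeasure] [μ.Regular]
  {κ : OrliczNormKind} {Φ : NFunction}

/-! ### Inversion and Haar measure -/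

/-- A continuous function with compact support between the indicators of a compact set and of an
open set. -/
theorem exists_compactlySupported_between {X : Type*} [TopologicalSpace X] [LocallyCompactSpace X]
    [RegularSpace X] {K U : Set X} (hK : IsCompact K) (hU : IsOpen U) (hKU : K ⊆ U) :
    ∃ k : C_c(X, ℝ), (∀ x ∈ K, k x = 1) ∧ (∀ x, x ∉ U → k x = 0) ∧ ∀ x, k x ∈ Icc (0 : ℝ) 1 := by
  obtain ⟨k, hk1, hk0, hkc, hk01⟩ := exists_continuous_one_zero_of_isCompact hK hU.isClosed_compl
    (disjoint_compl_right_iff_subset.2 hKU)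
  exact ⟨⟨k, hkc⟩, fun x hx => hk1 hx, fun x hx => hk0 hx, hk01⟩

/-- The image of Haar measure under inversion is right invariant. Comparing it with the left
invariant `μ` through a fixed bump `g` gives `μ`, up to a constant, the continuous positive density
`1/D` relative to `μ.inv`. On the compact set `V` the function `D` is bounded. -/
theorem exists_integral_inv_le {V : Set G} (hV : IsCompact V) : ∃ C : ℝ, 0 ≤ C ∧
    ∀ f : C_c(G, ℝ), (∀ x, 0 ≤ f x) → (∀ x, x ∉ V → f x = 0) →
      ∫ x, f x ∂μ.inv ≤ C * ∫ x, f x ∂μ := by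
  obtain ⟨g, hg1, -, hg01⟩ := exists_compactlySupported_between (isCompact_singleton (x := (1 : G)))
    isOpen_univ (subset_univ _)
  have hg0 : ∀ x, 0 ≤ g x := fun x => (hg01 x).1
  have hgne : g 1 ≠ 0 := by rw [hg1 1 rfl]; exact one_ne_zero
  set D : G → ℝ := fun y => ∫ z, g (z⁻¹ * y) ∂μ.inv with hD
  have hDc : Continuous D := continuous_integral_apply_inv_mul g.continuous g.hasCompactSupport
  have hDpos : ∀ x, 0 < D x := by
    intro x
    have hc : Continuous fun y => g (y⁻¹ * x) := by
      have := g.continuous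
      fun_prop
    refine (integral_pos_iff_support_of_nonneg (fun y => hg0 _) ?_).2 ?_
    · exact hc.integrable_of_hasCompactSupport
        (g.hasCompactSupport.comp_homeomorph ((Homeomorph.inv G).trans (Homeomorph.mulRight x)))
    · exact hc.isOpen_support.measure_pos μ.inv ⟨x, by simpa using hgne⟩
  obtain ⟨M, hM⟩ := (hV.image hDc).bddAbove
  set M' := max M 1
  have hM' : 0 < M' := one_pos.trans_le (le_max_right _ _)
  have hDM : ∀ x ∈ V, D x ≤ M' := fun x hx => (hM ⟨x, hx, rfl⟩).trans (le_max_left _ _)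
  have hgint : 0 < ∫ x, g x ∂μ :=
    g.continuous.integral_pos_of_hasCompactSupport_nonneg_nonzero g.hasCompactSupport hg0 hgne
  refine ⟨M' / ∫ x, g x ∂μ, by positivity, fun f hf hfV => ?_⟩
  have hcombo : ∫ x, f x ∂μ = (∫ y, f y * (D y)⁻¹ ∂μ.inv) * ∫ x, g x ∂μ :=
    Measure.integral_isMulLeftInvariant_isMulRightInvariant_combo (μ := μ) (ν := μ.inv)
    f.continuous f.hasCompactSupport g.continuous g.hasCompactSupport hg0 hgne
  have hle : M'⁻¹ * ∫ x, f x ∂μ.inv ≤ ∫ x, f x * (D x)⁻¹ ∂μ.inv := by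
    rw [← integral_const_mul]
    refine integral_mono ?_ ?_ fun x => ?_
    · exact (f.continuous.integrable_of_hasCompactSupport f.hasCompactSupport).const_mul _
    · exact (f.continuous.mul (hDc.inv₀ fun x => (hDpos x).ne')).integrable_of_hasCompactSupport
        f.hasCompactSupport.mul_right
    · by_cases hx : x ∈ V
      · change M'⁻¹ * f x ≤ f x * (D x)⁻¹
        rw [mul_comm]
        exact mul_le_mul_of_nonneg_left (inv_anti₀ (hDpos x) (hDM x hx)) (hf x)
      · simp [hfV x hx]
  rw [hcombo, div_mul_eq_mul_div, le_div_iff₀ hgint, ← mul_assoc]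
  refine mul_le_mul_of_nonneg_right ?_ hgint.le
  rwa [inv_mul_le_iff₀ hM'] at hle

/-- On compact sets, the inverse of Haar measure is dominated by Haar measure. -/
theorem exists_inv_restrict_le {K : Set G} (hK : IsCompact K) :
    ∃ C : ℝ≥0∞, C ≠ ∞ ∧ μ.inv.restrict K ≤ C • μ.restrict K := by
  obtain ⟨V, hV, hKV⟩ := exists_compact_superset hK
  obtain ⟨C, hC0, hC⟩ := exists_integral_inv_le (μ := μ) hV
  -- The estimate passes from functions to open subsets of `V` by inner regularity, and afterwards
  -- to Borel subsets of `K` by outer regularity of `μ`; `V` provides the room needed around `K`.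
  have hopen : ∀ U : Set G, IsOpen U → U ⊆ V → μ.inv U ≤ ENNReal.ofReal C * μ U := by
    intro U hU hUV
    rw [hU.measure_eq_iSup_isCompact μ.inv]
    refine iSup₂_le fun L hLU => iSup_le fun hL => ?_
    obtain ⟨k, hk1, hk0, hk01⟩ := exists_compactlySupported_between hL hU hLU
    have hUfin : μ U ≠ ∞ := measure_ne_top_of_subset hUV hV.measure_lt_top.ne
    have h1 : μ.inv.real L ≤ ∫ x, k x ∂μ.inv := by
      rw [← integral_indicator_one hL.measurableSet]
      refine integral_mono ((integrable_indicator_iff hL.measurableSet).2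
        (integrableOn_const (hL.measure_lt_top (μ := μ.inv)).ne)) ?_ fun x => ?_
      · exact k.continuous.integrable_of_hasCompactSupport k.hasCompactSupport
      · by_cases hx : x ∈ L
        · simp [hx, hk1 x hx]
        · simpa [hx] using (hk01 x).1
    have h2 : ∫ x, k x ∂μ ≤ μ.real U := by
      rw [← integral_indicator_one hU.measurableSet]
      refine integral_mono (k.continuous.integrable_of_hasCompactSupport k.hasCompactSupport) ?_
        fun x => ?_
      · exact (integrable_indicator_iff hU.measurableSet).2 (integrableOn_const hUfin)
      · by_cases hx : x ∈ U
        · simpa [hx] using (hk01 x).2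
        · simp [hx, hk0 x hx]
    have h3 := hC k (fun x => (hk01 x).1) fun x hx => hk0 x fun h => hx (hUV h)
    have h4 : μ.inv.real L ≤ C * μ.real U :=
      h1.trans (h3.trans (mul_le_mul_of_nonneg_left h2 hC0))
    rw [← ENNReal.ofReal_toReal (hL.measure_lt_top (μ := μ.inv)).ne, ← ENNReal.ofReal_toReal hUfin,
      ← ENNReal.ofReal_mul hC0]
    exact ENNReal.ofReal_le_ofReal h4
  refine ⟨ENNReal.ofReal C, ENNReal.ofReal_ne_top, Measure.le_iff.2 fun A hA => ?_⟩
  rw [Measure.smul_apply, Measure.restrict_apply hA, Measure.restrict_apply hA, smul_eq_mul]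
  refine ENNReal.le_of_forall_pos_le_add fun ε hε _ => ?_
  have hfin : μ (A ∩ K) ≠ ∞ := measure_ne_top_of_subset inter_subset_right hK.measure_lt_top.ne
  obtain ⟨U, hAU, hU, hUε⟩ := (A ∩ K).exists_isOpen_lt_add (μ := μ) hfin
    (ε := ε / (ENNReal.ofReal C + 1)) (ENNReal.div_ne_zero.2 ⟨by simpa using hε.ne', by finiteness⟩)
  calc μ.inv (A ∩ K) ≤ μ.inv (U ∩ interior V) :=
        measure_mono (subset_inter hAU (inter_subset_right.trans hKV))
    _ ≤ ENNReal.ofReal C * μ (U ∩ interior V) :=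
        hopen _ (hU.inter isOpen_interior) (inter_subset_right.trans interior_subset)
    _ ≤ ENNReal.ofReal C * (μ (A ∩ K) + ε / (ENNReal.ofReal C + 1)) := by
        gcongr
        exact (measure_mono inter_subset_left).trans hUε.le
    _ ≤ ENNReal.ofReal C * μ (A ∩ K) + (ENNReal.ofReal C + 1) * (ε / (ENNReal.ofReal C + 1)) := by
        rw [mul_add]
        gcongr
        exact le_self_add
    _ = ENNReal.ofReal C * μ (A ∩ K) + ε := by
        rw [ENNReal.mul_div_cancel (by simp) (by finiteness)]

/-- For `f` continuous with compact support, `(f * g)(x)` is bounded by the integral of `|g|` over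
a compact set. -/
theorem exists_lintegral_conv_le (f : C_c(G, ℂ)) (x : G) : ∃ K : Set G, IsCompact K ∧
    ∃ C : ℝ≥0∞, C ≠ ∞ ∧ ∀ g : G → ℂ,
      ∫⁻ y, ‖f y * g (y⁻¹ * x)‖ₑ ∂μ ≤ C * ∫⁻ y in K, ‖g y‖ₑ ∂μ := by
  have hK : IsCompact ((tsupport f)⁻¹ * {x}) :=
    f.hasCompactSupport.isCompact.inv.mul isCompact_singleton
  obtain ⟨C, hC, hle⟩ := exists_inv_restrict_le (μ := μ) hK
  obtain ⟨B, hB⟩ := exists_norm_compactlySupported_le f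
  refine ⟨_, hK, ENNReal.ofReal B * C, by finiteness, fun g => ?_⟩
  -- Translating by `x` and then inverting moves the argument of `g` to the integration variable, at
  -- the cost of replacing `μ` by `μ.inv` on a compact set.
  calc ∫⁻ y, ‖f y * g (y⁻¹ * x)‖ₑ ∂μ = ∫⁻ y, ‖f (x * y) * g y⁻¹‖ₑ ∂μ := by
        rw [← lintegral_mul_left_eq_self _ x]
        simp
    _ = ∫⁻ y, ‖f (x * y⁻¹) * g y‖ₑ ∂μ.inv := by
        have he := lintegral_map_equiv (μ := μ) (fun y => ‖f (x * y⁻¹) * g y‖ₑ)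
          (MeasurableEquiv.inv G)
        simp only [MeasurableEquiv.inv_apply, inv_inv] at he
        exact he.symm
    _ ≤ ∫⁻ y in (tsupport f)⁻¹ * {x}, ENNReal.ofReal B * ‖g y‖ₑ ∂μ.inv := by
        rw [← lintegral_indicator hK.measurableSet]
        refine lintegral_mono fun y => ?_
        by_cases hy : y ∈ (tsupport f)⁻¹ * {x}
        · rw [indicator_of_mem hy, enorm_mul]
          gcongr
          rw [← ofReal_norm]
          exact ENNReal.ofReal_le_ofReal (hB _)
        · have : f (x * y⁻¹) = 0 := by
            refine image_eq_zero_of_notMem_tsupport fun h => hy ?_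
            exact ⟨(x * y⁻¹)⁻¹, Set.inv_mem_inv.2 h, x, rfl, by simp⟩
          simp [this]
    _ = ENNReal.ofReal B * ∫⁻ y in (tsupport f)⁻¹ * {x}, ‖g y‖ₑ ∂μ.inv :=
        lintegral_const_mul' _ _ ENNReal.ofReal_ne_top
    _ ≤ ENNReal.ofReal B * ∫⁻ y, ‖g y‖ₑ ∂(C • μ.restrict ((tsupport f)⁻¹ * {x})) := by
        gcongr
    _ = ENNReal.ofReal B * C * ∫⁻ y in (tsupport f)⁻¹ * {x}, ‖g y‖ₑ ∂μ := by
        rw [lintegral_smul_measure, smul_eq_mul, mul_assoc]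

/-! ### Pointwise values of the convolution operators -/

theorem integrable_conv_left (h : DeltaTwoOn Φ μ) (f : C_c(G, ℂ)) (g : OrliczSpace κ Φ μ) (x : G) :
    Integrable (fun y => f y * g (y⁻¹ * x)) μ := by
  obtain ⟨K, hK, C, hC, hle⟩ := exists_lintegral_conv_le (μ := μ) f x
  refine ⟨?_, (hle g).trans_lt ?_⟩
  · have h1 := g.measurable
    have h2 := f.continuous.measurable
    have h3 : Measurable fun y : G => y⁻¹ * x := by fun_prop
    exact (h2.mul (h1.comp h3)).aestronglyMeasurable
  · exact ENNReal.mul_lt_top hC.lt_top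
      (g.integrableOn h hK.measurableSet hK.measure_lt_top.ne).2

/-- At every single `x` the value is bounded by an integral of the second factor over a compact set,
hence by its norm in the Orlicz space. -/
theorem tendsto_conv_left (h : DeltaTwoOn Φ μ) (f : C_c(G, ℂ)) {g : ℕ → C_c(G, ℂ)}
    {u : OrliczSpace κ Φ μ}
    (hg : Tendsto (fun n => (OrliczSpace.ofCc (g n) : OrliczSpace κ Φ μ)) atTop (𝓝 u)) (x : G) :
    Tendsto (fun n => convCc μ f (g n) x) atTop (𝓝 (∫ y, f y * u (y⁻¹ * x) ∂μ)) := by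
  obtain ⟨K, hK, C, hC, hle⟩ := exists_lintegral_conv_le (μ := μ) f x
  have hKμ := hK.measure_lt_top (μ := μ)
  set A : ℝ≥0∞ := 1 + ENNReal.ofReal (Φ.complementary 1) * μ K with hA
  have hAfin : A ≠ ∞ := by finiteness
  rw [tendsto_iff_edist_tendsto_0]
  have hlim : Tendsto (fun n => C * (ENNReal.ofReal ‖OrliczSpace.ofCc (g n) - u‖ * A)) atTop
      (𝓝 0) := by
    have h0 : Tendsto (fun n => ENNReal.ofReal ‖OrliczSpace.ofCc (g n) - u‖) atTop (𝓝 0) := by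
      simpa using ENNReal.tendsto_ofReal (tendsto_iff_norm_sub_tendsto_zero.1 hg)
    simpa using ENNReal.Tendsto.const_mul (ENNReal.Tendsto.mul_const h0 (Or.inr hAfin))
      (Or.inr hC)
  refine tendsto_of_tendsto_of_tendsto_of_le_of_le tendsto_const_nhds hlim (fun _ => zero_le)
    fun n => ?_
  have hi : Integrable (fun y => f y * g n (y⁻¹ * x)) μ := by
    refine Continuous.integrable_of_hasCompactSupport ?_ f.hasCompactSupport.mul_right
    have h1 := f.continuous
    have h2 := (g n).continuous
    fun_prop
  change edist (∫ y, f y * g n (y⁻¹ * x) ∂μ) _ ≤ _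
  rw [edist_eq_enorm_sub, ← integral_sub hi (integrable_conv_left h f u x)]
  calc ‖∫ y, (f y * g n (y⁻¹ * x) - f y * u (y⁻¹ * x)) ∂μ‖ₑ
      ≤ ∫⁻ y, ‖f y * g n (y⁻¹ * x) - f y * u (y⁻¹ * x)‖ₑ ∂μ := enorm_integral_le_lintegral_enorm _
    _ = ∫⁻ y, ‖f y * (fun z => g n z - u z) (y⁻¹ * x)‖ₑ ∂μ := by simp only [mul_sub]
    _ ≤ C * ∫⁻ y in K, ‖g n y - u y‖ₑ ∂μ := hle _
    _ = C * ∫⁻ y in K, ‖(OrliczSpace.ofCc (g n) - u : OrliczSpace κ Φ μ) y‖ₑ ∂μ := by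
        congr 1
        refine lintegral_congr_ae (ae_restrict_of_ae ?_)
        filter_upwards [OrliczSpace.coeFn_sub (OrliczSpace.ofCc (g n)) u,
          OrliczSpace.coeFn_ofCc (κ := κ) (Φ := Φ) (μ := μ) (g n)] with y h1 h2
        rw [h1, h2]
    _ ≤ _ := by
        gcongr
        exact OrliczSpace.setLIntegral_enorm_le h _ hK.measurableSet hKμ.ne

/-- The formula holds on the dense set `C_c(G)`. Along an approximating sequence one side converges
almost everywhere after passing to a subsequence, the other side at every point. -/
theorem convOp_apply_ae (h : DeltaTwoOn Φ μ) (f : C_c(G, ℂ)) (u : OrliczSpace κ Φ μ) :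
    (convOp κ h f u : OrliczSpace κ Φ μ) =ᵐ[μ] fun x => ∫ y, f y * u (y⁻¹ * x) ∂μ := by
  obtain ⟨g, hg⟩ := u.exists_seq_ofCc_tendsto h
  have h1 := ((convOp κ h f).continuous.tendsto u).comp hg
  obtain ⟨ns, hns, hae⟩ := OrliczSpace.exists_seq_tendsto_ae h h1
  have h2 := ae_all_iff.2 fun n =>
    OrliczSpace.coeFn_ofCc (κ := κ) (Φ := Φ) (μ := μ) (convCc μ f (g n))
  filter_upwards [hae, h2] with x hx hx2
  refine tendsto_nhds_unique hx ?_
  simp only [Function.comp_apply, convOp_ofCc, hx2]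
  exact (tendsto_conv_left h f hg x).comp hns.tendsto_atTop

end Group


section Density

variable {α : Type*} [MeasurableSpace α] {μ : Measure α}

/-! ### Complex measures with a density -/

theorem integrable_withDensityᵥ {f F : α → ℂ} (hf : Integrable f μ) (hF : Measurable F)
    (hfF : Integrable (fun x => f x * F x) μ) : (μ.withDensityᵥ f).Integrable F := by
  rw [VectorMeasure.Integrable, Measure.variation_withDensityᵥ hf,
    integrable_withDensity_iff_integrable_smul₀' hf.aestronglyMeasurable.enorm (by simp)]
  refine hfF.mono ?_ (ae_of_all _ fun x => by simp)
  exact hf.aestronglyMeasurable.enorm.ennreal_toReal.aestronglyMeasurable.smul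
    hF.aestronglyMeasurable

theorem integrable_mul_of_integrable_withDensityᵥ {f F : α → ℂ} (hf : Integrable f μ)
    (hF : (μ.withDensityᵥ f).Integrable F) : Integrable (fun x => f x * F x) μ := by
  rw [VectorMeasure.Integrable, Measure.variation_withDensityᵥ hf,
    integrable_withDensity_iff_integrable_smul₀' hf.aestronglyMeasurable.enorm (by simp)] at hF
  -- The factor `F` is measurable only modulo `‖f‖ dμ`. Splitting `f` into its phase and its modulus
  -- keeps `F` attached to the modulus, where measurability is known.
  have he : (fun x => f x * F x) = fun x => (‖f x‖⁻¹ • f x) * (‖f x‖ₑ.toReal • F x) := by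
    ext x
    rcases eq_or_ne (f x) 0 with h0 | h0
    · simp [h0]
    · have : (‖f x‖ : ℂ) ≠ 0 := by simpa using h0
      simp only [toReal_enorm, Complex.real_smul, Complex.ofReal_inv]
      field_simp
  refine hF.mono ?_ (ae_of_all _ fun x => by simp)
  rw [he]
  exact (hf.aestronglyMeasurable.norm.inv₀.smul hf.aestronglyMeasurable).mul
    hF.aestronglyMeasurable

theorem integral_withDensityᵥ {f F : α → ℂ} (hf : Integrable f μ)
    (hF : (μ.withDensityᵥ f).Integrable F) :
    ∫ᵛ x, F x ∂[ContinuousLinearMap.mul ℝ ℂ; μ.withDensityᵥ f] = ∫ x, f x * F x ∂μ := by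
  have hfin : IsFiniteMeasure (μ.withDensityᵥ f).variation := by
    rw [Measure.variation_withDensityᵥ hf]
    exact ⟨by simpa using! hf.2⟩
  refine Integrable.induction (μ := (μ.withDensityᵥ f).variation)
    (fun F => ∫ᵛ x, F x ∂[ContinuousLinearMap.mul ℝ ℂ; μ.withDensityᵥ f] = ∫ x, f x * F x ∂μ)
    ?_ ?_ ?_ ?_ hF
  · intro c s hs hsf
    rw [VectorMeasure.integral_indicator_const _ hs, withDensityᵥ_apply hf hs,
      ContinuousLinearMap.mul_apply', ← integral_const_mul, ← integral_indicator hs]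
    congr 1 with x
    by_cases hx : x ∈ s <;> simp [hx, mul_comm]
  · intro F F' _ hF hF' h h'
    simp only [Pi.add_apply, mul_add]
    rw [VectorMeasure.integral_fun_add hF hF', h, h',
      integral_add (integrable_mul_of_integrable_withDensityᵥ hf hF)
        (integrable_mul_of_integrable_withDensityᵥ hf hF')]
  -- The variation of `f dμ` is `‖f‖ dμ`, so both sides are continuous on the `L¹` space of the
  -- variation.
  · refine isClosed_eq VectorMeasure.continuous_integral (LipschitzWith.continuous (K := 1) ?_)
    intro F F'
    have hm := (integrable_mul_of_integrable_withDensityᵥ hf (L1.integrable_coeFn F))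
    have hm' := (integrable_mul_of_integrable_withDensityᵥ hf (L1.integrable_coeFn F'))
    have key : ∀ H : α → ℝ≥0∞,
        ∫⁻ x, H x ∂(μ.withDensityᵥ f).variation = ∫⁻ x, ‖f x‖ₑ * H x ∂μ := fun H => by
      rw [Measure.variation_withDensityᵥ hf,
        lintegral_withDensity_eq_lintegral_mul_non_measurable₀ μ hf.aestronglyMeasurable.enorm
          (by simp)]
      rfl
    rw [edist_eq_enorm_sub, ← integral_sub hm hm', ENNReal.coe_one, one_mul, L1.edist_def, key]
    refine (enorm_integral_le_lintegral_enorm _).trans (le_of_eq ?_)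
    refine lintegral_congr fun x => ?_
    rw [edist_eq_enorm_sub, ← enorm_mul, mul_sub]
  · intro F F' h hF hFF
    rw [← VectorMeasure.integral_congr_ae h, hFF]
    refine integral_congr_ae ?_
    rw [Measure.variation_withDensityᵥ hf, EventuallyEq,
      ae_withDensity_iff' hf.aestronglyMeasurable.enorm] at h
    filter_upwards [h] with x hx
    rcases eq_or_ne (f x) 0 with h0 | h0
    · simp [h0]
    · rw [hx (by simpa using h0)]

theorem isFiniteMeasure_variation (ν : ComplexMeasure α) : IsFiniteMeasure ν.variation := by
  set m : Measure α := (ComplexMeasure.re ν).totalVariation + (ComplexMeasure.im ν).totalVariation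
  refine isFiniteMeasure_of_le m (VectorMeasure.variation_le_of_forall_enorm_le fun s _ => ?_)
  have h1 : ‖ν s‖ₑ ≤ ‖(ν s).re‖ₑ + ‖(ν s).im‖ₑ := by
    conv_lhs => rw [← Complex.re_add_im (ν s)]
    refine (enorm_add_le _ _).trans (le_of_eq ?_)
    rw [enorm_mul]
    simp [← ofReal_norm]
  exact h1.trans (add_le_add ((ComplexMeasure.re ν).enorm_le_totalVariation s)
    ((ComplexMeasure.im ν).enorm_le_totalVariation s))

end Density

section Group

variable {G : Type*} [Group G] [TopologicalSpace G] [IsTopologicalGroup G] [LocallyCompactSpace G]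
  [T2Space G] [MeasurableSpace G] [BorelSpace G] {μ : Measure G} [μ.IsHaarMeasure] [μ.Regular]
  {κ : OrliczNormKind} {Φ : NFunction}

/-! ### Convolution operators of integrable functions -/

theorem regular_withDensity_enorm {X : Type*} [TopologicalSpace X] [T2Space X]
    [LocallyCompactSpace X] [MeasurableSpace X] [BorelSpace X] (μ : Measure X) [μ.Regular] (f : C_c(X, ℂ)) :
    (μ.withDensity fun x => ‖f x‖ₑ).Regular := by
  have hf : ∫⁻ x, ‖f x‖ₑ ∂μ ≠ ∞ := (integrable_compactlySupported (μ := μ) f).2.ne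
  have : IsFiniteMeasure (μ.withDensity fun x => ‖f x‖ₑ) :=
    ⟨by rw [withDensity_apply _ MeasurableSet.univ, Measure.restrict_univ]; exact hf.lt_top⟩
  have : (μ.withDensity fun x => ‖f x‖ₑ).InnerRegularCompactLTTop := by
    refine ⟨fun A hA r hr => ?_⟩
    -- Cutting down to the compact support gives finite `μ`-measure, where inner regularity of `μ`
    -- holds; absolute continuity of the integral transfers it to the density.
    have hK0 := f.hasCompactSupport.isCompact
    obtain ⟨δ, hδ, hlt⟩ := exists_pos_setLIntegral_lt_of_measure_lt hf (tsub_pos_of_lt hr).ne'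
    have hAK := hA.1.inter hK0.measurableSet
    obtain ⟨K, hKA, hK, hKδ⟩ := hAK.exists_isCompact_sdiff_lt
      (measure_ne_top_of_subset inter_subset_right (hK0.measure_lt_top (μ := μ)).ne) hδ.ne'
    refine ⟨K, hKA.trans inter_subset_left, hK, ?_⟩
    have h1 := hlt _ hKδ
    have h2 : (μ.withDensity fun x => ‖f x‖ₑ) A ≤ (μ.withDensity fun x => ‖f x‖ₑ) K +
        ∫⁻ x in (A ∩ tsupport f) \ K, ‖f x‖ₑ ∂μ := by
      rw [← withDensity_apply _ (hAK.diff hK.measurableSet)]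
      have h3 : (μ.withDensity fun x => ‖f x‖ₑ) (A \ tsupport f) = 0 := by
        rw [withDensity_apply _ (hA.1.diff hK0.measurableSet)]
        refine setLIntegral_eq_zero (hA.1.diff hK0.measurableSet) fun x hx => ?_
        simp [image_eq_zero_of_notMem_tsupport hx.2]
      calc _ ≤ (μ.withDensity fun x => ‖f x‖ₑ)
              (K ∪ ((A ∩ tsupport f) \ K) ∪ (A \ tsupport f)) := by
            refine measure_mono fun x hx => ?_
            by_cases h4 : x ∈ K <;> by_cases h5 : x ∈ tsupport f <;> simp [h4, h5, hx]
        _ ≤ _ := (measure_union_le _ _).trans (by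
            rw [h3, add_zero]; exact measure_union_le _ _)
    have h3 := h2.trans_lt (ENNReal.add_lt_add_left (measure_ne_top _ _) h1)
    by_contra hle
    have h4 := h3.trans_le (add_le_add_left (not_lt.1 hle) _)
    rw [add_tsub_cancel_of_le hr.le] at h4
    exact h4.false
  infer_instance

theorem isLeftConvolutionOperator_convOp (h : DeltaTwoOn Φ μ) (f : C_c(G, ℂ)) :
    IsLeftConvolutionOperator (μ.withDensityᵥ f) (convOp κ h f) := by
  intro g
  filter_upwards [convOp_apply_ae h f g] with x hx
  have hm : Measurable fun y : G => g (y⁻¹ * x) := by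
    have h1 := g.measurable
    have h2 : Measurable fun y : G => y⁻¹ * x := by fun_prop
    exact h1.comp h2
  have hi := integrable_withDensityᵥ (integrable_compactlySupported (μ := μ) f) hm
    (integrable_conv_left h f g x)
  exact ⟨hi, by rw [hx, integral_withDensityᵥ (integrable_compactlySupported f) hi]⟩

/-- The points `y` with `y⁻¹ x` in a null set are invisible to every kernel in `C_c(G)`, by local
domination of inverted Haar measure, and hence to every `L¹` limit of such kernels. The conclusion
is therefore confined to the set where `f` does not vanish. -/
theorem ae_inv_mul_of_ne_zero {f : G → ℂ} (hf : Integrable f μ) {p : G → Prop}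
    (hp : ∀ᵐ x ∂μ, p x) (x : G) : ∀ᵐ y ∂μ, f y ≠ 0 → p (y⁻¹ * x) := by
  obtain ⟨N, hpN, hNm, hN⟩ := exists_measurable_superset_of_null hp
  have hBm : MeasurableSet {y : G | y⁻¹ * x ∈ N} := by
    have h2 : Measurable fun y : G => y⁻¹ * x := by fun_prop
    exact h2 hNm
  have hcc : ∀ k : C_c(G, ℂ), ∀ᵐ y ∂μ, y ∈ {y : G | y⁻¹ * x ∈ N} → k y = 0 := by
    intro k
    obtain ⟨K, hK, C, hC, hle⟩ := exists_lintegral_conv_le (μ := μ) k x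
    have h1 := hle (N.indicator 1)
    have h2 : ∫⁻ y in K, ‖N.indicator (1 : G → ℂ) y‖ₑ ∂μ = 0 := by
      rw [lintegral_eq_zero_iff' (by fun_prop (disch := measurability))]
      refine ae_restrict_of_ae ?_
      filter_upwards [measure_eq_zero_iff_ae_notMem.1 hN] with y hy
      simp [hy]
    rw [h2, mul_zero, nonpos_iff_eq_zero, lintegral_eq_zero_iff'] at h1
    · filter_upwards [h1] with y hy hyN
      have hyN' : y⁻¹ * x ∈ N := hyN
      simpa [hyN'] using hy
    · have h3 := k.continuous.measurable
      have h4 : Measurable (N.indicator (1 : G → ℂ)) := measurable_one.indicator hNm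
      have h5 : Measurable fun y : G => y⁻¹ * x := by fun_prop
      exact (h3.mul (h4.comp h5)).enorm.aemeasurable
  obtain ⟨k, hk⟩ := exists_seq_compactlySupported_tendsto hf
  have hzero : ∫ y in {y : G | y⁻¹ * x ∈ N}, ‖f y‖ ∂μ = 0 := by
    refine le_antisymm (ge_of_tendsto' hk fun n => ?_) (integral_nonneg fun _ => norm_nonneg _)
    have hi : Integrable (fun y => ‖f y - k n y‖) μ :=
      (hf.sub (integrable_compactlySupported (k n))).norm
    calc ∫ y in {y : G | y⁻¹ * x ∈ N}, ‖f y‖ ∂μ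
        = ∫ y in {y : G | y⁻¹ * x ∈ N}, ‖f y - k n y‖ ∂μ := by
          refine setIntegral_congr_ae hBm ?_
          filter_upwards [hcc (k n)] with y hy hyN
          rw [hy hyN, sub_zero]
      _ ≤ _ := setIntegral_le_integral hi (ae_of_all _ fun _ => norm_nonneg _)
  rw [setIntegral_eq_zero_iff_of_nonneg_ae (ae_of_all _ fun _ => norm_nonneg _)
    hf.norm.integrableOn, EventuallyEq, ae_restrict_iff' hBm] at hzero
  filter_upwards [hzero] with y hy hfy
  by_contra hpy
  exact hfy (norm_eq_zero.1 (hy (hpN hpy)))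

theorem tendsto_convCc {f : G → ℂ} (hf : Integrable f μ) {k : ℕ → C_c(G, ℂ)}
    (hk : Tendsto (fun n => ∫ x, ‖f x - k n x‖ ∂μ) atTop (𝓝 0)) (g : C_c(G, ℂ)) (x : G) :
    Integrable (fun y => f y * g (y⁻¹ * x)) μ ∧
      Tendsto (fun n => convCc μ (k n) g x) atTop (𝓝 (∫ y, f y * g (y⁻¹ * x) ∂μ)) := by
  obtain ⟨C, hC⟩ := exists_norm_compactlySupported_le g
  have hgm : AEStronglyMeasurable (fun y : G => g (y⁻¹ * x)) μ := by
    have h1 := g.continuous.measurable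
    have h2 : Measurable fun y : G => y⁻¹ * x := by fun_prop
    exact (h1.comp h2).aestronglyMeasurable
  have hint : ∀ F : G → ℂ, Integrable F μ → Integrable (fun y => F y * g (y⁻¹ * x)) μ :=
    fun F hF => hF.mul_bdd (c := C) hgm (ae_of_all _ fun y => hC _)
  refine ⟨hint f hf, tendsto_iff_norm_sub_tendsto_zero.2 ?_⟩
  refine squeeze_zero (fun _ => norm_nonneg _) (fun n => ?_) (by simpa using hk.mul_const C)
  have hi := integrable_compactlySupported (μ := μ) (k n)
  rw [norm_sub_rev, convCc_apply, ← integral_sub (hint f hf) (hint _ hi), ← integral_mul_const]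
  refine norm_integral_le_of_norm_le ((hf.sub hi).norm.mul_const C) (ae_of_all _ fun y => ?_)
  rw [← sub_mul, norm_mul]
  exact mul_le_mul_of_nonneg_left (hC _) (norm_nonneg _)

/-- Kernels `k n` in `C_c(G)` tending to `f` in `L¹` give a Cauchy sequence of operators. Its limit
agrees with `T` on `C_c(G)` by convergence almost everywhere along a subsequence, and density of
`C_c(G)` finishes. -/
theorem mem_closure_range_convOp (h : DeltaTwoOn Φ μ) {f : G → ℂ} (hf : Integrable f μ)
    {T : OrliczSpace κ Φ μ →L[ℂ] OrliczSpace κ Φ μ}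
    (hT : IsLeftConvolutionOperator (μ.withDensityᵥ f) T) :
    T ∈ closure (Set.range (convOp κ h)) := by
  have : CompleteSpace (OrliczSpace κ Φ μ) := OrliczSpace.completeSpace h
  obtain ⟨k, hk⟩ := exists_seq_compactlySupported_tendsto hf
  have hki := fun n => integrable_compactlySupported (μ := μ) (k n)
  have hdist : ∀ m n, dist (convOp κ h (k m)) (convOp κ h (k n)) ≤
      ∫ x, ‖f x - k m x‖ ∂μ + ∫ x, ‖f x - k n x‖ ∂μ := by
    intro m n
    rw [dist_eq_norm, ← convOp_sub]
    refine le_of_le_of_eq ?_ (integral_add (hf.sub (hki m)).norm (hf.sub (hki n)).norm)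
    refine (norm_convOp_le h _).trans (integral_mono ((hki m).sub (hki n)).norm
      ((hf.sub (hki m)).norm.add (hf.sub (hki n)).norm) fun x => ?_)
    have := norm_sub_le (f x - k n x) (f x - k m x)
    simp only [sub_sub_sub_cancel_left] at this
    exact this.trans (add_comm _ _).le
  have hcau : CauchySeq fun n => convOp κ h (k n) := by
    refine Metric.cauchySeq_iff.2 fun ε hε => ?_
    obtain ⟨N, hN⟩ := eventually_atTop.1 (hk.eventually_lt_const (half_pos hε))
    exact ⟨N, fun m hm n hn => (hdist m n).trans_lt (by linarith [hN m hm, hN n hn])⟩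
  obtain ⟨S, hS⟩ := cauchySeq_tendsto_of_complete hcau
  have hST : S = T := by
    have heq : (S : OrliczSpace κ Φ μ → OrliczSpace κ Φ μ) = T := by
      refine (OrliczSpace.denseRange_ofCc h).equalizer S.continuous T.continuous ?_
      ext1 g
      refine OrliczSpace.ext_ae ?_
      have h1 : Tendsto (fun n => convOp κ h (k n) (OrliczSpace.ofCc g)) atTop
          (𝓝 (S (OrliczSpace.ofCc g))) :=
        ((ContinuousLinearMap.apply ℂ _ (OrliczSpace.ofCc g)).continuous.tendsto S).comp hS
      obtain ⟨ns, hns, hae⟩ := OrliczSpace.exists_seq_tendsto_ae h h1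
      have h2 := ae_all_iff.2 fun n =>
        OrliczSpace.coeFn_ofCc (κ := κ) (Φ := Φ) (μ := μ) (convCc μ (k n) g)
      filter_upwards [hae, h2, hT (OrliczSpace.ofCc g)] with x hx hx2 hx3
      simp only [convOp_ofCc, hx2] at hx
      refine (tendsto_nhds_unique hx ((tendsto_convCc hf hk g x).2.comp hns.tendsto_atTop)).trans ?_
      simp only [Function.comp_apply]
      rw [hx3.2, integral_withDensityᵥ hf hx3.1]
      refine integral_congr_ae ?_
      filter_upwards [ae_inv_mul_of_ne_zero hf
        (OrliczSpace.coeFn_ofCc (κ := κ) (Φ := Φ) (μ := μ) g) x] with y hy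
      rcases eq_or_ne (f y) 0 with h0 | h0
      · simp [h0]
      · rw [hy h0]
    exact DFunLike.coe_injective heq
  rw [← hST]
  exact mem_closure_of_tendsto hS (Eventually.of_forall fun n => ⟨_, rfl⟩)

theorem pseudofunctions_eq_closure_range (h : DeltaTwoOn Φ μ) :
    pseudofunctions κ Φ μ = closure (Set.range (convOp κ h)) := by
  refine Subset.antisymm (closure_minimal ?_ isClosed_closure) (closure_mono ?_)
  · rintro T ⟨f, hf, hT⟩
    exact mem_closure_range_convOp h hf hT
  · rintro _ ⟨f, rfl⟩
    exact ⟨f, integrable_compactlySupported f, isLeftConvolutionOperator_convOp h f⟩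

theorem convOp_mem_pseudomeasures_generators (h : DeltaTwoOn Φ μ) (f : C_c(G, ℂ)) :
    ∃ ν ∈ measureAlgebra G, IsLeftConvolutionOperator ν (convOp κ h f) := by
  refine ⟨μ.withDensityᵥ f, ?_, isLeftConvolutionOperator_convOp h f⟩
  change (μ.withDensityᵥ f).variation.Regular
  rw [Measure.variation_withDensityᵥ (integrable_compactlySupported f)]
  exact regular_withDensity_enorm μ f

end Group


/-! ### Left multipliers of an algebra of operators with an approximate identity -/

section Multipliers

variable {E ι B : Type*} [NormedAddCommGroup E] [NormedSpace ℂ E] {l : Filter ι}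
  [NormedRing B] [NormedAlgebra ℂ B] {ρ : B ≃ₗᵢ[ℂ] (E →L[ℂ] E)}
  {A : NonUnitalSubalgebra ℂ B} {e : ι → A}

theorem eq_of_forall_mul_eq [l.NeBot] (hρ : ∀ a b u, ρ (a * b) u = ρ a (ρ b u))
    (he : ∀ u : E, Tendsto (fun i => ρ (e i) u) l (𝓝 u)) {S S' : B}
    (h : ∀ T : A, S * T = S' * T) : S = S' := by
  refine ρ.injective (ContinuousLinearMap.ext fun u => ?_)
  refine tendsto_nhds_unique (((ρ S).continuous.tendsto u).comp (he u)) ?_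
  refine (((ρ S').continuous.tendsto u).comp (he u)).congr fun i => ?_
  rw [Function.comp_apply, Function.comp_apply, ← hρ, ← hρ, h]

theorem norm_multiplier_apply_le (he1 : ∀ i, ‖e i‖ ≤ 1) (M : A →L[ℂ] A) (i : ι) :
    ‖(M (e i) : B)‖ ≤ ‖M‖ :=
  (M.le_opNorm (e i)).trans (mul_le_of_le_one_right (norm_nonneg M) (he1 i))

/-- The net `N (e i)` is bounded by `‖N‖`, and `N (e i) * T = N (e i * T)` tends to `N T`. So it
converges strongly on the ranges of elements of `A`, which are dense in total because `e j` tends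
strongly to the identity. -/
theorem exists_multiplier_extension [CompleteSpace E] [l.NeBot]
    (hρ : ∀ a b u, ρ (a * b) u = ρ a (ρ b u)) (he1 : ∀ i, ‖e i‖ ≤ 1)
    (he : ∀ u : E, Tendsto (fun i => ρ (e i) u) l (𝓝 u))
    (heT : ∀ T : A, Tendsto (fun i => e i * T) l (𝓝 T)) {N : A →L[ℂ] A}
    (hmul : ∀ a b : A, N (a * b) = N a * b) :
    ∃ S : B, (∀ u : E, Tendsto (fun i => ρ (N (e i)) u) l (𝓝 (ρ S u))) ∧
      (∀ T : A, S * (T : B) = (N T : A)) ∧ ‖S‖ = ‖N‖ := by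
  have hlimT : ∀ (T : A) (u : E),
      Tendsto (fun i => ρ (N (e i)) (ρ T u)) l (𝓝 (ρ (N T) u)) := by
    intro T u
    have h1 : Tendsto (fun i => N (e i * T)) l (𝓝 (N T)) :=
      (N.continuous.tendsto T).comp (heT T)
    have h2 := ((ContinuousLinearMap.apply ℂ E u).continuous.tendsto _).comp
      ((ρ.continuous.tendsto _).comp ((continuous_subtype_val.tendsto (N T)).comp h1))
    refine h2.congr fun i => ?_
    change ρ (N (e i * T) : A) u = _
    rw [hmul, ← hρ]
    rfl
  have hnorm : ∀ i, ‖ρ (N (e i))‖ ≤ ‖N‖ := fun i => by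
    rw [ρ.norm_map]
    exact norm_multiplier_apply_le he1 N i
  have hlim : ∀ u : E, ∃ v, Tendsto (fun i => ρ (N (e i)) u) l (𝓝 v) := by
    intro u
    rw [← cauchy_map_iff_exists_tendsto, Metric.cauchy_iff]
    refine ⟨inferInstance, fun ε hε => ?_⟩
    have hδ : 0 < ε / 4 / (‖N‖ + 1) := by positivity
    -- One fixed `e j` replaces `u` by a vector on which the net is known to converge; uniform
    -- boundedness keeps the error below `ε/4`.
    obtain ⟨j, hj⟩ := ((Metric.tendsto_nhds.1 (he u)) _ hδ).exists
    have h1 := (Metric.tendsto_nhds.1 (hlimT (e j) u)) (ε / 4) (by positivity)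
    refine ⟨_, image_mem_map h1, ?_⟩
    have hb : ∀ i, dist (ρ (N (e i)) u) (ρ (N (e i)) (ρ (e j) u)) ≤ ε / 4 := by
      intro i
      rw [dist_eq_norm, ← map_sub]
      refine (ContinuousLinearMap.le_opNorm _ _).trans ?_
      rw [← dist_eq_norm, dist_comm]
      calc _ ≤ ‖N‖ * (ε / 4 / (‖N‖ + 1)) :=
            mul_le_mul (hnorm i) hj.le dist_nonneg N.opNorm_nonneg
        _ ≤ (‖N‖ + 1) * (ε / 4 / (‖N‖ + 1)) := by gcongr; linarith
        _ = ε / 4 := by field_simp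
    rintro _ ⟨i, hi, rfl⟩ _ ⟨k, hk, rfl⟩
    have hi' : dist (ρ (N (e i)) (ρ (e j) u)) (ρ (N (e j)) u) < ε / 4 := hi
    have hk' : dist (ρ (N (e k)) (ρ (e j) u)) (ρ (N (e j)) u) < ε / 4 := hk
    have h2 := dist_triangle4 (ρ (N (e i)) u) (ρ (N (e i)) (ρ (e j) u))
      (ρ (N (e k)) (ρ (e j) u)) (ρ (N (e k)) u)
    have h3 := dist_triangle_right (ρ (N (e i)) (ρ (e j) u)) (ρ (N (e k)) (ρ (e j) u))
      (ρ (N (e j)) u)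
    have h4 := hb k
    rw [dist_comm] at h4
    linarith [hb i]
  choose S hS using hlim
  have hbound : ∀ u, ‖S u‖ ≤ ‖N‖ * ‖u‖ := fun u =>
    le_of_tendsto (hS u).norm (Eventually.of_forall fun i =>
      (ContinuousLinearMap.le_opNorm _ _).trans
        (mul_le_mul_of_nonneg_right (hnorm i) (norm_nonneg _)))
  obtain ⟨L, hL⟩ := ρ.surjective ((linearMapOfTendsto (g := fun i => (ρ (N (e i)) : E →ₗ[ℂ] E)) S
    (tendsto_pi_nhds.2 hS)).mkContinuous ‖N‖ hbound)
  have hLS : ∀ u, ρ L u = S u := fun u => by rw [hL]; rfl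
  have hLT : ∀ T : A, L * (T : B) = (N T : A) := by
    intro T
    refine ρ.injective (ContinuousLinearMap.ext fun u => ?_)
    rw [hρ, hLS]
    exact tendsto_nhds_unique (hS (ρ T u)) (hlimT T u)
  refine ⟨L, fun u => by rw [hLS]; exact hS u, hLT, le_antisymm ?_ ?_⟩
  · rw [← ρ.norm_map, hL]
    exact LinearMap.mkContinuous_norm_le _ N.opNorm_nonneg _
  -- The reverse inequality comes from `N T = L T` and submultiplicativity of the norm.
  refine N.opNorm_le_bound (norm_nonneg _) fun T => ?_
  change ‖(N T : B)‖ ≤ _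
  rw [← hLT]
  exact norm_mul_le _ _

/-- The left multipliers of an algebra of operators with a contractive left approximate identity
which converges strongly to the identity. -/
theorem multiplierInclusions_of_approximateIdentity [CompleteSpace E] [l.NeBot]
    (hρ : ∀ a b u, ρ (a * b) u = ρ a (ρ b u))
    (he1 : ∀ i, ‖e i‖ ≤ 1) (he : ∀ u : E, Tendsto (fun i => ρ (e i) u) l (𝓝 u))
    (heT : ∀ T : A, Tendsto (fun i => e i * T) l (𝓝 T)) {P : Set B}
    (hP : ∀ (S : B) (F : ι → B) (C : ℝ), (∀ i, F i ∈ A) → (∀ i, ‖F i‖ ≤ C) →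
      (∀ u, Tendsto (fun i => ρ (F i) u) l (𝓝 (ρ S u))) → S ∈ P) :
    MultiplierInclusions (A : Set B) P := by
  choose S hS hST hnorm using
    fun M : leftMultiplier A => exists_multiplier_extension hρ he1 he heT M.2
  have hext : ∀ {S S' : B}, (∀ T : A, S * T = S' * T) → S = S' :=
    fun h => eq_of_forall_mul_eq hρ he h
  let φ : leftMultiplier A →ₐ[ℂ] B :=
    { toFun := S
      map_one' := hext fun T => by rw [hST, one_mul]; rfl
      map_mul' := fun M N => hext fun T => by
        rw [hST, mul_assoc, hST, hST]; rfl
      map_zero' := hext fun T => by rw [hST, zero_mul]; rfl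
      map_add' := fun M N => hext fun T => by
        rw [hST, add_mul, hST, hST]; rfl
      commutes' := fun c => hext fun T => by
        rw [hST, Algebra.algebraMap_eq_smul_one, Algebra.algebraMap_eq_smul_one, smul_mul_assoc,
          one_mul]
        rfl }
  have hleft : ∀ T : A, φ (leftMul T) = T := fun T => hext fun T' => hST (leftMul T) T'
  refine ⟨A, rfl, fun T => ?_, φ, hleft, hST, fun φ' hφ' => ?_, hnorm, ?_, ?_⟩
  · rw [← hnorm]
    exact congrArg norm (hleft T)
  · refine AlgHom.ext fun M => hext fun T => ?_
    -- The multiplier property says that left multiplications form a left ideal of the multiplier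
    -- algebra on which `M` acts by `T ↦ M T`. Any homomorphism fixing `A` is thereby determined.
    have h1 : M * leftMul T = leftMul ((M : A →L[ℂ] A) T) :=
      Subtype.ext (ContinuousLinearMap.ext fun b => M.2 T b)
    calc φ' M * T = φ' (M * leftMul T) := by rw [map_mul, hφ']
      _ = φ M * T := by rw [h1, hφ']; exact (hST M T).symm
  · intro T hT
    exact ⟨leftMul ⟨T, hT⟩, hleft ⟨T, hT⟩⟩
  · rintro _ ⟨M, rfl⟩
    exact hP _ (fun i => (M : A →L[ℂ] A) (e i)) _ (fun i => Subtype.mem _) (norm_multiplier_apply_le he1 (M : A →L[ℂ] A)) (hS M)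

end Multipliers

/-! ### The ultraweak topology -/

section Ultraweak

variable {E : Type*} [NormedAddCommGroup E] [NormedSpace ℂ E]

/-- The functional `T ↦ ∑ φₙ(T xₙ)`. -/
theorem continuous_tsum_apply {x : ℕ → E} {φ : ℕ → (E →L[ℂ] ℂ)}
    (h : Summable fun n => ‖x n‖ * ‖φ n‖) :
    Continuous fun T : E →L[ℂ] E => ∑' n, φ n (T (x n)) := by
  refine continuous_iff_continuousAt.2 fun T => ?_
  refine tendsto_tsum_of_dominated_convergence (bound := fun n => (‖T‖ + 1) * (‖x n‖ * ‖φ n‖))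
    (h.mul_left _) (fun n => ?_) ?_
  · exact ((φ n).continuous.comp
      (ContinuousLinearMap.apply ℂ E (x n)).continuous).tendsto T
  · filter_upwards [Metric.ball_mem_nhds T one_pos] with S hS n
    have h1 : ‖S‖ ≤ ‖T‖ + 1 := by
      have := norm_sub_norm_le S T
      rw [mem_ball_iff_norm] at hS
      linarith
    calc ‖φ n (S (x n))‖ ≤ ‖φ n‖ * (‖S‖ * ‖x n‖) :=
          (φ n).le_opNorm_of_le (S.le_opNorm _)
      _ = ‖S‖ * (‖x n‖ * ‖φ n‖) := by ring
      _ ≤ _ := by gcongr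

theorem tendsto_ultraweak_iff {ι : Type*} {l : Filter ι} {F : ι → E →L[ℂ] E} {S : E →L[ℂ] E} :
    Tendsto F l (@nhds _ (ultraweakTopology E) S) ↔
      ∀ (x : ℕ → E) (φ : ℕ → (E →L[ℂ] ℂ)), (Summable fun n => ‖x n‖ * ‖φ n‖) →
        Tendsto (fun i => ∑' n, φ n (F i (x n))) l (𝓝 (∑' n, φ n (S (x n)))) := by
  rw [nhds_induced, tendsto_comap_iff, tendsto_pi_nhds]
  exact ⟨fun h x φ hs => h ⟨(x, φ), hs⟩, fun h p => h p.1.1 p.1.2 p.2⟩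

/-- Dominated convergence for series: each term converges by strong convergence, and the norm bound
gives a summable majorant. -/
theorem tendsto_ultraweak_of_bounded {ι : Type*} {l : Filter ι} {F : ι → E →L[ℂ] E}
    {S : E →L[ℂ] E} {C : ℝ} (hC : ∀ i, ‖F i‖ ≤ C) (h : ∀ u, Tendsto (fun i => F i u) l (𝓝 (S u))) :
    Tendsto F l (@nhds _ (ultraweakTopology E) S) := by
  refine tendsto_ultraweak_iff.2 fun x φ hs => ?_
  refine tendsto_tsum_of_dominated_convergence (bound := fun n => C * (‖x n‖ * ‖φ n‖))
    (hs.mul_left _) (fun n => ((φ n).continuous.tendsto _).comp (h (x n)))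
    (Eventually.of_forall fun i n => ?_)
  calc ‖φ n (F i (x n))‖ ≤ ‖φ n‖ * (‖F i‖ * ‖x n‖) := (φ n).le_opNorm_of_le ((F i).le_opNorm _)
    _ = ‖F i‖ * (‖x n‖ * ‖φ n‖) := by ring
    _ ≤ _ := by gcongr; exact hC i

theorem mem_closure_ultraweak_of_bounded {ι : Type*} {l : Filter ι} [l.NeBot] {F : ι → E →L[ℂ] E}
    {S : E →L[ℂ] E} {C : ℝ} {s : Set (E →L[ℂ] E)} (hC : ∀ i, ‖F i‖ ≤ C)
    (h : ∀ u, Tendsto (fun i => F i u) l (𝓝 (S u)))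
    (hF : ∀ i, F i ∈ @closure _ (ultraweakTopology E) s) :
    S ∈ @closure _ (ultraweakTopology E) s :=
  @IsClosed.mem_of_tendsto _ (ultraweakTopology E) _ _ _ _ _ _
    (@isClosed_closure _ (ultraweakTopology E) _)
    (tendsto_ultraweak_of_bounded hC h) (Eventually.of_forall hF)

theorem closure_subset_closure_ultraweak (s : Set (E →L[ℂ] E)) :
    closure s ⊆ @closure _ (ultraweakTopology E) s := by
  intro T hT
  obtain ⟨F, hF, hFT⟩ := mem_closure_iff_seq_limit.1 hT
  refine @mem_closure_of_tendsto _ (ultraweakTopology E) _ T s F atTop _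
    (tendsto_ultraweak_iff.2 fun x φ hs => ?_) (Eventually.of_forall hF)
  exact ((continuous_tsum_apply hs).tendsto T).comp hFT

end Ultraweak


section Group

variable {G : Type*} [Group G] [TopologicalSpace G] [IsTopologicalGroup G] [LocallyCompactSpace G]
  [T2Space G] [MeasurableSpace G] [BorelSpace G] {μ : Measure G} [μ.IsHaarMeasure] [μ.Regular]
  {κ : OrliczNormKind} {Φ : NFunction}

/-! ### An approximate identity -/

theorem exists_bump (μ : Measure G) [μ.IsHaarMeasure] {U : Set G} (hU : U ∈ 𝓝 (1 : G)) :
    ∃ k : C_c(G, ℂ), ∫ x, ‖k x‖ ∂μ = 1 ∧ ∫ x, k x ∂μ = 1 ∧ ∀ x, x ∉ U → k x = 0 := by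
  obtain ⟨g, hg1, hg0, hg01⟩ := exists_compactlySupported_between
    (isCompact_singleton (x := (1 : G))) isOpen_interior
    (singleton_subset_iff.2 (mem_interior_iff_mem_nhds.2 hU))
  have hint : 0 < ∫ x, g x ∂μ :=
    g.continuous.integral_pos_of_hasCompactSupport_nonneg_nonzero g.hasCompactSupport
      (fun x => (hg01 x).1) (x := 1) (by rw [hg1 1 rfl]; exact one_ne_zero)
  have hc : Continuous fun x => (((∫ x, g x ∂μ)⁻¹ * g x : ℝ) : ℂ) := by
    have := g.continuous
    fun_prop
  refine ⟨⟨⟨_, hc⟩, (g.hasCompactSupport.mul_left (f := fun _ => (∫ x, g x ∂μ)⁻¹)).comp_left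
    (g := fun t : ℝ => (t : ℂ)) Complex.ofReal_zero⟩, ?_, ?_, fun x hx => ?_⟩
  · change ∫ x, ‖(((∫ x, g x ∂μ)⁻¹ * g x : ℝ) : ℂ)‖ ∂μ = 1
    have h1 : ∀ x, ‖(((∫ x, g x ∂μ)⁻¹ * g x : ℝ) : ℂ)‖ = (∫ x, g x ∂μ)⁻¹ * g x := fun x => by
      rw [Complex.norm_real, Real.norm_of_nonneg (mul_nonneg (by positivity) (hg01 x).1)]
    simp only [h1]
    rw [integral_const_mul, inv_mul_cancel₀ hint.ne']
  · change ∫ x, (((∫ x, g x ∂μ)⁻¹ * g x : ℝ) : ℂ) ∂μ = 1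
    rw [integral_complex_ofReal, integral_const_mul, inv_mul_cancel₀ hint.ne', Complex.ofReal_one]
  · change (((∫ x, g x ∂μ)⁻¹ * g x : ℝ) : ℂ) = 0
    rw [hg0 x fun h => hx (interior_subset h), mul_zero, Complex.ofReal_zero]

/-- Since `k` has integral `1`, the difference is an average of `L_y u - u` over `V`. -/
theorem norm_convOp_apply_sub_le (h : DeltaTwoOn Φ μ) {k : C_c(G, ℂ)} {V : Set G}
    (hk1 : ∫ x, ‖k x‖ ∂μ = 1) (hk : ∫ x, k x ∂μ = 1) (hkV : ∀ x, x ∉ V → k x = 0)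
    {u : OrliczSpace κ Φ μ} {ε : ℝ} (hu : ∀ y ∈ V, ‖translate y u - u‖ ≤ ε) :
    ‖convOp κ h k u - u‖ ≤ ε := by
  have : CompleteSpace (OrliczSpace κ Φ μ) := OrliczSpace.completeSpace h
  have hki := integrable_compactlySupported (μ := μ) k
  have h1 : convOp κ h k u - u = ∫ y, k y • (translate y u - u) ∂μ := by
    simp only [smul_sub]
    rw [integral_sub (integrable_smul_translate h k u) (hki.smul_const u), integral_smul_const, hk,
      one_smul, convOp_apply]
  have h2 : ∫ y, ‖k y‖ * ε ∂μ = ε := by rw [integral_mul_const, hk1, one_mul]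
  rw [h1, ← h2]
  refine norm_integral_le_of_norm_le (hki.norm.mul_const ε) (ae_of_all _ fun y => ?_)
  rw [norm_smul]
  by_cases hy : y ∈ V
  · exact mul_le_mul_of_nonneg_left (hu y hy) (norm_nonneg _)
  · simp [hkV y hy]

/-- The algebra of the convolution operators of continuous functions with compact support. -/
def convAlgebra (κ : OrliczNormKind) (h : DeltaTwoOn Φ μ) :
    NonUnitalSubalgebra ℂ (OrliczSpace κ Φ μ →L[ℂ] OrliczSpace κ Φ μ) where
  carrier := Set.range (convOp κ h)
  zero_mem' := ⟨0, by simpa using convOp_smul (κ := κ) h 0 0⟩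
  add_mem' := by
    rintro _ _ ⟨f, rfl⟩ ⟨g, rfl⟩
    exact ⟨f + g, convOp_add h f g⟩
  mul_mem' := by
    rintro _ _ ⟨f, rfl⟩ ⟨g, rfl⟩
    exact ⟨convCc μ f g, (convOp_mul h f g).symm⟩
  smul_mem' := by
    rintro c _ ⟨f, rfl⟩
    exact ⟨c • f, convOp_smul h c f⟩

/-! ### Multipliers of the pseudofunctions -/

theorem pseudofunctions_subset_pseudomeasures (h : DeltaTwoOn Φ μ) :
    pseudofunctions κ Φ μ ⊆ pseudomeasures κ Φ μ := by
  rw [pseudofunctions_eq_closure_range h]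
  refine (closure_subset_closure_ultraweak _).trans ?_
  refine @closure_mono _ (ultraweakTopology (OrliczSpace κ Φ μ)) _ _ ?_
  rintro _ ⟨f, rfl⟩
  exact convOp_mem_pseudomeasures_generators h f

theorem multiplierInclusions_pseudofunctions (h : DeltaTwoOn Φ μ) :
    MultiplierInclusions (pseudofunctions κ Φ μ) (pseudomeasures κ Φ μ) := by
  have : CompleteSpace (OrliczSpace κ Φ μ) := OrliczSpace.completeSpace h
  set A := (convAlgebra κ h).topologicalClosure with hA
  have hAS : (A : Set (OrliczSpace κ Φ μ →L[ℂ] OrliczSpace κ Φ μ)) = pseudofunctions κ Φ μ :=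
    (pseudofunctions_eq_closure_range h).symm
  -- The approximate identity is a net indexed by open neighbourhoods of the identity, directed by
  -- shrinking, since `G` need not be first countable.
  choose k hk1 hk hkU using fun U : TopologicalSpace.OpenNhdsOf (1 : G) => exists_bump μ (U.isOpen.mem_nhds U.mem)
  have hkA : ∀ f, convOp κ h f ∈ A := fun f => subset_closure ⟨f, rfl⟩
  let e : TopologicalSpace.OpenNhdsOf (1 : G) → A := fun U => ⟨convOp κ h (k U), hkA _⟩
  have he1 : ∀ U, ‖convOp κ h (k U)‖ ≤ 1 := fun U => (norm_convOp_le h _).trans (hk1 U).le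
  have hV : ∀ V ∈ 𝓝 (1 : G), ∀ᶠ U : TopologicalSpace.OpenNhdsOf (1 : G) in atBot, (U : Set G) ⊆ V := by
    intro V hV
    obtain ⟨W, hWV, hWo, hW1⟩ := mem_nhds_iff.1 hV
    filter_upwards [eventually_le_atBot (⟨⟨W, hWo⟩, hW1⟩ : TopologicalSpace.OpenNhdsOf (1 : G))] with U hU
    exact Subset.trans hU hWV
  have hstrong : ∀ u : OrliczSpace κ Φ μ,
      Tendsto (fun U => convOp κ h (k U) u) atBot (𝓝 u) := by
    intro u
    refine Metric.tendsto_nhds.2 fun ε hε => ?_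
    filter_upwards [hV _ (eventually_norm_translate_sub_le h u (half_pos hε))] with U hU
    rw [dist_eq_norm]
    exact (norm_convOp_apply_sub_le h (hk1 U) (hk U) (hkU U) fun y hy => hU hy).trans_lt
      (half_lt_self hε)
  -- Convergence in operator norm, uniformly in `u`: translating `convOp κ h f u` amounts to
  -- translating `f`, which is continuous in `L¹`.
  have hconv : ∀ (f : C_c(G, ℂ)) (ε : ℝ), 0 < ε → ∀ᶠ U in atBot,
      ‖convOp κ h (k U) * convOp κ h f - convOp κ h f‖ ≤ ε := by
    intro f ε hε
    filter_upwards [hV _ (eventually_integral_norm_translate_sub_le (μ := μ) f hε)] with U hU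
    refine ContinuousLinearMap.opNorm_le_bound _ hε.le fun u => ?_
    refine norm_convOp_apply_sub_le h (hk1 U) (hk U) (hkU U) fun y hy => ?_
    change ‖translate y (convOp κ h f u) - convOp κ h f u‖ ≤ _
    rw [translate_convOp, ← sub_apply, ← convOp_sub]
    refine (ContinuousLinearMap.le_opNorm _ _).trans
      (mul_le_mul_of_nonneg_right ((norm_convOp_le h _).trans (hU hy)) (norm_nonneg _))
  have hnorm : ∀ T ∈ A, Tendsto (fun U => convOp κ h (k U) * T) atBot (𝓝 T) := by
    intro T hT
    refine Metric.tendsto_nhds.2 fun ε hε => ?_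
    obtain ⟨_, ⟨f, rfl⟩, hf⟩ := Metric.mem_closure_iff.1 hT (ε / 3) (by positivity)
    filter_upwards [hconv f (ε / 4) (by positivity)] with U hU
    rw [dist_eq_norm] at hf ⊢
    have h1 : convOp κ h (k U) * T - T = convOp κ h (k U) * (T - convOp κ h f) +
        (convOp κ h (k U) * convOp κ h f - convOp κ h f) - (T - convOp κ h f) := by
      rw [mul_sub]; abel
    have h2 : ‖convOp κ h (k U) * (T - convOp κ h f)‖ ≤ ‖T - convOp κ h f‖ :=
      (norm_mul_le _ _).trans (mul_le_of_le_one_left (norm_nonneg _) (he1 U))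
    rw [h1]
    refine (norm_sub_le _ _).trans_lt ?_
    have h3 := norm_add_le (convOp κ h (k U) * (T - convOp κ h f))
      (convOp κ h (k U) * convOp κ h f - convOp κ h f)
    linarith
  rw [← hAS]
  refine multiplierInclusions_of_approximateIdentity (l := atBot) (e := e)
    (ρ := LinearIsometryEquiv.refl ℂ _) (fun _ _ _ => rfl) he1 hstrong (fun T => ?_)
    fun S F C hFA hF hS => mem_closure_ultraweak_of_bounded hF hS fun i =>
      pseudofunctions_subset_pseudomeasures h (hAS ▸ hFA i)
  exact tendsto_subtype_rng.2 (hnorm T T.2)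

end Group


section Group

variable {G : Type*} [Group G] [TopologicalSpace G] [IsTopologicalGroup G] [LocallyCompactSpace G]
  [T2Space G] [MeasurableSpace G] [BorelSpace G] {μ : Measure G} [μ.IsHaarMeasure] [μ.Regular]

/-! ### Null sets and convolution with a regular measure -/

section Null

variable {ρ : Measure G} [IsFiniteMeasure ρ] [ρ.Regular]

theorem isOpen_setOf_inv_mul_mem {U : Set G} (hU : IsOpen U) (x : G) :
    IsOpen {y : G | y⁻¹ * x ∈ U} := by
  have : Continuous fun y : G => y⁻¹ * x := by fun_prop
  exact hU.preimage this

/-- Inner regularity of `ρ` gives a compact `M`, and the tube lemma makes the inclusion stable under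
small changes of `x`. In particular the measure of the slice is lower semicontinuous in `x`. -/
theorem exists_isCompact_inv_mul_subset {U : Set G} (hU : IsOpen U) {x : G} {t : ℝ≥0∞}
    (ht : t < ρ {y | y⁻¹ * x ∈ U}) :
    ∃ M W : Set G, IsCompact M ∧ IsCompact W ∧ W ∈ 𝓝 x ∧ M⁻¹ * W ⊆ U ∧ t < ρ M := by
  obtain ⟨M, hMU, hM, htM⟩ := (isOpen_setOf_inv_mul_mem hU x).exists_lt_isCompact ht
  have hc : Continuous fun p : G × G => p.1⁻¹ * p.2 := by fun_prop
  obtain ⟨u, v, -, hv, hMu, hxv, huv⟩ := generalized_tube_lemma hM (isCompact_singleton (x := x))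
    (hU.preimage hc) (by
      rintro ⟨y, z⟩ ⟨hy, hz⟩
      obtain rfl : z = x := hz
      exact hMU hy)
  obtain ⟨W, hW, hxW, hWv⟩ := exists_compact_subset hv (singleton_subset_iff.1 hxv)
  refine ⟨M, W, hM, hW, mem_interior_iff_mem_nhds.1 hxW, ?_, htM⟩
  rintro _ ⟨y, hy, w, hw, rfl⟩
  have := @huv (y⁻¹, w) ⟨hMu hy, hWv hw⟩
  simpa using this

theorem isOpen_setOf_lt_measure {U : Set G} (hU : IsOpen U) (t : ℝ≥0∞) :
    IsOpen {x : G | t < ρ {y | y⁻¹ * x ∈ U}} := by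
  refine isOpen_iff_mem_nhds.2 fun x hx => ?_
  obtain ⟨M, W, -, -, hW, hMW, ht⟩ := exists_isCompact_inv_mul_subset hU hx
  filter_upwards [hW] with z hz
  exact ht.trans_le (measure_mono fun y hy => hMW ⟨y⁻¹, Set.inv_mem_inv.2 hy, z, hz, rfl⟩)

/-- Compactness of `L` makes the local choices of `M` and `Q` uniform, so that the slices can be
dominated by functions in `C_c(G)`. -/
theorem exists_isCompact_forall_lt_measure {U : Set G} (hU : IsOpen U) {L : Set G}
    (hL : IsCompact L) {t : ℝ≥0∞} (ht : ∀ x ∈ L, t < ρ {y | y⁻¹ * x ∈ U}) :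
    ∃ M Q : Set G, IsCompact M ∧ IsCompact Q ∧ Q ⊆ U ∧
      ∀ x ∈ L, t < ρ (M ∩ {y | y⁻¹ * x ∈ Q}) := by
  refine hL.induction_on (p := fun L => ∃ M Q : Set G, IsCompact M ∧ IsCompact Q ∧ Q ⊆ U ∧
      ∀ x ∈ L, t < ρ (M ∩ {y | y⁻¹ * x ∈ Q})) ?_ ?_ ?_ ?_
  · exact ⟨∅, ∅, isCompact_empty, isCompact_empty, empty_subset _, fun x hx => hx.elim⟩
  · rintro s s' hs ⟨M, Q, hM, hQ, hQU, h⟩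
    exact ⟨M, Q, hM, hQ, hQU, fun x hx => h x (hs hx)⟩
  · rintro s s' ⟨M, Q, hM, hQ, hQU, h⟩ ⟨M', Q', hM', hQ', hQU', h'⟩
    refine ⟨M ∪ M', Q ∪ Q', hM.union hM', hQ.union hQ', union_subset hQU hQU', ?_⟩
    rintro x (hx | hx)
    · exact (h x hx).trans_le (measure_mono fun y hy => ⟨Or.inl hy.1, Or.inl hy.2⟩)
    · exact (h' x hx).trans_le (measure_mono fun y hy => ⟨Or.inr hy.1, Or.inr hy.2⟩)
  · intro x hx
    obtain ⟨M, W, hM, hW, hWx, hMW, htM⟩ := exists_isCompact_inv_mul_subset hU (ht x hx)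
    refine ⟨W, mem_nhdsWithin_of_mem_nhds hWx, M, M⁻¹ * W, hM, hM.inv.mul hW, hMW, fun z hz => ?_⟩
    exact htM.trans_le (measure_mono fun y hy => ⟨hy, y⁻¹, Set.inv_mem_inv.2 hy, z, hz, rfl⟩)

theorem integral_convCc_le {U : Set G} (hU : IsOpen U) (hμU : μ U ≠ ∞) {f k : C_c(G, ℝ)}
    (hf : ∀ y, f y ∈ Icc (0 : ℝ) 1) (hk : ∀ x, k x ∈ Icc (0 : ℝ) 1) (hkU : ∀ x, x ∉ U → k x = 0) :
    ∫ x, convCc ρ f k x ∂μ ≤ ρ.real univ * μ.real U := by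
  have h1 : ∫ x, k x ∂μ ≤ μ.real U := by
    rw [← integral_indicator_one hU.measurableSet]
    refine integral_mono (k.continuous.integrable_of_hasCompactSupport k.hasCompactSupport)
      ((integrable_indicator_iff hU.measurableSet).2 (integrableOn_const hμU)) fun x => ?_
    by_cases hx : x ∈ U
    · simpa [hx] using (hk x).2
    · simp [hx, hkU x hx]
  have h2 : ∫ x, convCc ρ f k x ∂μ = ∫ y, f y * ∫ x, k x ∂μ ∂ρ := by
    refine (integral_integral_swap_of_hasCompactSupport (μ := ρ) (ν := μ)
      (continuous_uncurry_conv f k) (hasCompactSupport_uncurry_conv f k)).symm.trans ?_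
    refine integral_congr_ae (ae_of_all _ fun y => ?_)
    change ∫ x, f y * k (y⁻¹ * x) ∂μ = _
    rw [integral_const_mul, integral_mul_left_eq_self (fun x => k x) y⁻¹]
  have h3 : ∫ y, f y ∂ρ ≤ ρ.real univ := by
    rw [← mul_one (ρ.real univ), ← smul_eq_mul, ← integral_const]
    exact integral_mono (f.continuous.integrable_of_hasCompactSupport f.hasCompactSupport)
      (integrable_const _) fun y => (hf y).2
  rw [h2, integral_mul_const]
  exact mul_le_mul h3 h1 (integral_nonneg fun x => (hk x).1) measureReal_nonneg

/-- Markov's inequality for the slice measure `ρ {y | y⁻¹ * x ∈ U}`, whose integral over `x` should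
be `ρ univ * μ U`. Bumps `f` and `k` replace the indicators, so that the interchange of integrals is
legitimate. -/
theorem mul_measure_le_of_isCompact {U : Set G} (hU : IsOpen U) (hμU : μ U ≠ ∞) {L : Set G}
    (hL : IsCompact L) {t : NNReal} (ht : ∀ x ∈ L, t < ρ {y | y⁻¹ * x ∈ U}) :
    t * μ L ≤ ρ univ * μ U := by
  obtain ⟨M, Q, hM, hQ, hQU, hMQ⟩ := exists_isCompact_forall_lt_measure hU hL ht
  obtain ⟨f, hf1, -, hf⟩ := exists_compactlySupported_between hM isOpen_univ (subset_univ _)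
  obtain ⟨k, hk1, hk0, hk⟩ := exists_compactlySupported_between hQ hU hQU
  have h0 : ∀ x, 0 ≤ convCc ρ f k x := fun x =>
    integral_nonneg fun y => mul_nonneg (hf y).1 (hk _).1
  have hle : ∀ x ∈ L, (t : ℝ) ≤ convCc ρ f k x := by
    intro x hx
    have hcl : IsClosed {y : G | y⁻¹ * x ∈ Q} := by
      have : Continuous fun y : G => y⁻¹ * x := by fun_prop
      exact hQ.isClosed.preimage this
    have hm : MeasurableSet (M ∩ {y : G | y⁻¹ * x ∈ Q}) := hM.measurableSet.inter hcl.measurableSet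
    have h1 : (t : ℝ) ≤ ρ.real (M ∩ {y : G | y⁻¹ * x ∈ Q}) := by
      have := ENNReal.toReal_mono (measure_ne_top _ _) (hMQ x hx).le
      simpa [measureReal_def] using this
    refine h1.trans ?_
    rw [← integral_indicator_one hm]
    refine integral_mono ((integrable_indicator_iff hm).2 (integrableOn_const (measure_ne_top _ _)))
      ?_ fun y => ?_
    · refine Continuous.integrable_of_hasCompactSupport ?_ f.hasCompactSupport.mul_right
      have h1 := f.continuous
      have h2 := k.continuous
      fun_prop
    · by_cases hy : y ∈ M ∩ {y : G | y⁻¹ * x ∈ Q}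
      · have hy2 : y⁻¹ * x ∈ Q := hy.2
        simp [hy, hf1 y hy.1, hk1 _ hy2]
      · rw [indicator_of_notMem hy]
        exact mul_nonneg (hf y).1 (hk _).1
  have h1 : (t : ℝ) * μ.real L ≤ ρ.real univ * μ.real U := by
    refine le_trans ?_ (integral_convCc_le hU hμU hf hk hk0)
    have h2 : (t : ℝ) * μ.real L = ∫ x, L.indicator (fun _ => (t : ℝ)) x ∂μ := by
      rw [integral_indicator_const _ hL.measurableSet, smul_eq_mul, mul_comm]
    rw [h2]
    refine integral_mono ((integrable_indicator_iff hL.measurableSet).2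
      (integrableOn_const hL.measure_lt_top.ne))
      ((convCc ρ f k).continuous.integrable_of_hasCompactSupport
        (convCc ρ f k).hasCompactSupport) fun x => ?_
    by_cases hx : x ∈ L
    · simpa [hx] using hle x hx
    · simpa [hx] using h0 x
  have h2 := ENNReal.ofReal_le_ofReal h1
  rwa [ENNReal.ofReal_mul t.coe_nonneg, ENNReal.ofReal_mul measureReal_nonneg, measureReal_def,
    measureReal_def, measureReal_def, ENNReal.ofReal_toReal hL.measure_lt_top.ne,
    ENNReal.ofReal_toReal hμU, ENNReal.ofReal_toReal (measure_ne_top _ _),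
    ENNReal.ofReal_coe_nnreal] at h2

/-- If a property holds almost everywhere for Haar measure, then almost all right translates of
inverses satisfy it almost everywhere for any given finite regular measure. -/
theorem ae_ae_inv_mul {p : G → Prop} (hp : ∀ᵐ x ∂μ, p x) :
    ∀ᵐ x ∂μ, ∀ᵐ y ∂ρ, p (y⁻¹ * x) := by
  have key : ∀ t : NNReal, t ≠ 0 → μ {x | (t : ℝ≥0∞) < ρ {y | ¬ p (y⁻¹ * x)}} = 0 := by
    intro t ht
    have ht' : (t : ℝ≥0∞) ≠ 0 := by simpa using ht
    have hle : ∀ ε : ℝ≥0∞, ε ≠ 0 → ε ≠ ∞ →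
        t * μ {x | (t : ℝ≥0∞) < ρ {y | ¬ p (y⁻¹ * x)}} ≤ ρ univ * ε := by
      intro ε hε hε'
      -- The null set is enlarged to an open set of small measure. The set of `x` with a large slice
      -- is then open, and inner regularity reduces it to compact subsets.
      obtain ⟨U, hNU, hU, hUε⟩ := Set.exists_isOpen_lt_of_lt {x | ¬ p x} ε
        (μ := μ) ((ae_iff.1 hp).trans_lt (pos_iff_ne_zero.2 hε))
      have hsub : {x | (t : ℝ≥0∞) < ρ {y | ¬ p (y⁻¹ * x)}} ⊆
          {x | (t : ℝ≥0∞) < ρ {y | y⁻¹ * x ∈ U}} := fun x hx =>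
        lt_of_lt_of_le (b := ρ {y | ¬ p (y⁻¹ * x)}) hx (measure_mono fun y hy => hNU hy)
      refine (mul_le_mul_right (measure_mono hsub) _).trans ?_
      rw [(isOpen_setOf_lt_measure hU t).measure_eq_iSup_isCompact, ENNReal.mul_iSup]
      refine iSup_le fun L => ?_
      rw [ENNReal.mul_iSup]
      refine iSup_le fun hLs => ?_
      rw [ENNReal.mul_iSup]
      refine iSup_le fun hL => ?_
      exact (mul_measure_le_of_isCompact hU hUε.ne_top hL fun x hx => hLs hx).trans
        (mul_le_mul_right hUε.le _)
    have h0 : t * μ {x | (t : ℝ≥0∞) < ρ {y | ¬ p (y⁻¹ * x)}} = 0 := by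
      refine le_antisymm (ENNReal.le_of_forall_pos_le_add fun δ hδ _ => ?_) zero_le
      rw [zero_add]
      refine (hle (δ / (ρ univ + 1)) ?_ ?_).trans ?_
      · exact ENNReal.div_ne_zero.2 ⟨by simpa using hδ.ne', by finiteness⟩
      · exact ENNReal.div_ne_top ENNReal.coe_ne_top (by simp)
      · calc ρ univ * (δ / (ρ univ + 1)) ≤ (ρ univ + 1) * (δ / (ρ univ + 1)) := by
              gcongr; exact le_self_add
          _ = δ := ENNReal.mul_div_cancel (by simp) (by finiteness)
    exact (mul_eq_zero.1 h0).resolve_left ht'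
  have hall := ae_all_iff.2 fun n : ℕ => measure_eq_zero_iff_ae_notMem.1
    (key (n + 1 : NNReal)⁻¹ (by positivity))
  filter_upwards [hall] with x hx
  refine ae_iff.2 (by_contra fun hne => ?_)
  obtain ⟨n, hn⟩ := ENNReal.exists_inv_nat_lt hne
  refine hx n (lt_of_le_of_lt ?_ hn)
  rw [ENNReal.coe_inv (by positivity)]
  exact ENNReal.inv_le_inv.2 (by push_cast; exact le_self_add)

end Null

/-! ### A Fubini theorem for complex measures -/

/-- Linear maps commute with the integral against a complex measure. -/
theorem map_integral_complexMeasure {X E F : Type*} [MeasurableSpace X] [NormedAddCommGroup E]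
    [NormedSpace ℝ E] [CompleteSpace E]
    [NormedAddCommGroup F] [NormedSpace ℝ F] [CompleteSpace F]
    {ν : ComplexMeasure X} {B : E →L[ℝ] ℂ →L[ℝ] E} {C : F →L[ℝ] ℂ →L[ℝ] F} (L : E →L[ℝ] F)
    (hL : ∀ v c, L (B v c) = C (L v) c) {f : X → E} (hf : ν.Integrable f) :
    L (∫ᵛ y, f y ∂[B; ν]) = ∫ᵛ y, L (f y) ∂[C; ν] := by
  rw [VectorMeasure.continuousLinearMap_apply_integral hf,
    VectorMeasure.integral_continuousLinearMap_comp hf]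
  congr 1
  ext v c
  exact hL v c

theorem integrable_complexMeasure {X E : Type*} [TopologicalSpace X] [MeasurableSpace X]
    [OpensMeasurableSpace X] [NormedAddCommGroup E] (ν : ComplexMeasure X) {f : X → E}
    (hf : Continuous f) (hfc : HasCompactSupport f) : ν.Integrable f :=
  have := isFiniteMeasure_variation ν
  hf.integrable_of_hasCompactSupport hfc

theorem const_mul_integral_complexMeasure {X : Type*} [MeasurableSpace X] {ν : ComplexMeasure X}
    {f : X → ℂ} (hf : ν.Integrable f) (c : ℂ) :
    c * ∫ᵛ y, f y ∂[ContinuousLinearMap.mul ℝ ℂ; ν] =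
      ∫ᵛ y, c * f y ∂[ContinuousLinearMap.mul ℝ ℂ; ν] :=
  map_integral_complexMeasure (ContinuousLinearMap.mul ℝ ℂ c) (fun v d => (mul_assoc c v d).symm) hf

/-- Integration of continuous functions on a compact set. -/
def compactIntegralCLM {X : Type*} [TopologicalSpace X] [MeasurableSpace X] [BorelSpace X]
    [T2Space X] (μ : Measure X) [IsFiniteMeasureOnCompacts μ] (K : Set X) [CompactSpace K] :
    C(K, ℂ) →L[ℝ] ℂ :=
  have hK : IsCompact K := isCompact_iff_compactSpace.2 inferInstance
  have : IsFiniteMeasure (μ.comap ((↑) : K → X)) :=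
    ⟨by rw [comap_subtype_coe_apply hK.measurableSet]; simpa using hK.measure_lt_top⟩
  LinearMap.mkContinuous
    { toFun := fun h => ∫ z : K, h z ∂(μ.comap (↑))
      map_add' := fun h h' => integral_add
        (h.continuous.integrable_of_hasCompactSupport (HasCompactSupport.of_compactSpace _))
        (h'.continuous.integrable_of_hasCompactSupport (HasCompactSupport.of_compactSpace _))
      map_smul' := fun c h => integral_smul c _ }
    ((μ.comap ((↑) : K → X)).real univ) fun h => by
      rw [mul_comm]
      exact norm_integral_le_of_norm_le_const (ae_of_all _ fun z => h.norm_coe_le_norm z)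

theorem compactIntegralCLM_apply {X : Type*} [TopologicalSpace X] [MeasurableSpace X]
    [BorelSpace X] [T2Space X] (μ : Measure X) [IsFiniteMeasureOnCompacts μ] (K : Set X)
    [CompactSpace K] (h : C(K, ℂ)) :
    compactIntegralCLM μ K h = ∫ z : K, h z ∂(μ.comap (↑)) := rfl

/-- The map `x ↦ k x ·` is continuous with compact support and takes values in the Banach space
`C(K, ℂ)`. Evaluation at a point and integration against `μ` are both continuous linear there, so
both commute with one vector-valued integral against `ν`. -/
theorem integral_integral_complexMeasure_swap {X Y : Type*} [TopologicalSpace X] [T2Space X]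
    [MeasurableSpace X] [OpensMeasurableSpace X] [TopologicalSpace Y] [T2Space Y]
    [MeasurableSpace Y] [BorelSpace Y] (ν : ComplexMeasure X) (μ : Measure Y)
    [IsFiniteMeasureOnCompacts μ] {k : X → Y → ℂ} (hk : Continuous (Function.uncurry k))
    (hkc : HasCompactSupport (Function.uncurry k)) :
    ∫ y, (∫ᵛ x, k x y ∂[ContinuousLinearMap.mul ℝ ℂ; ν]) ∂μ =
      ∫ᵛ x, (∫ y, k x y ∂μ) ∂[ContinuousLinearMap.mul ℝ ℂ; ν] := by
  set K : Set Y := Prod.snd '' tsupport (Function.uncurry k) with hKdef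
  have hK : IsCompact K := hkc.isCompact.image continuous_snd
  have hKs : CompactSpace K := isCompact_iff_compactSpace.1 hK
  have hk0 : ∀ x y, y ∉ K → k x y = 0 := fun x y hy =>
    image_eq_zero_of_notMem_tsupport (f := Function.uncurry k) (x := (x, y)) fun h =>
      hy ⟨_, h, rfl⟩
  let F : C(X × K, ℂ) := ⟨fun p => k p.1 p.2,
    hk.comp (continuous_fst.prodMk (continuous_subtype_val.comp continuous_snd))⟩
  have hFc : HasCompactSupport F.curry :=
    HasCompactSupport.intro (hkc.isCompact.image continuous_fst) fun x hx =>
      ContinuousMap.ext fun z =>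
        image_eq_zero_of_notMem_tsupport (f := Function.uncurry k) (x := (x, (z : Y))) fun h =>
          hx ⟨_, h, rfl⟩
  have hFi : ν.Integrable F.curry := integrable_complexMeasure ν F.curry.continuous hFc
  set V : C(K, ℂ) := ∫ᵛ x, F.curry x ∂[(ContinuousLinearMap.lsmul ℝ ℂ).flip; ν] with hV
  have h1 : ∀ z : K, V z = ∫ᵛ x, k x z ∂[ContinuousLinearMap.mul ℝ ℂ; ν] := fun z =>
    map_integral_complexMeasure (C := ContinuousLinearMap.mul ℝ ℂ) (ContinuousMap.evalCLM ℝ z)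
      (fun v c => mul_comm c (v z)) hFi
  have h2 : compactIntegralCLM μ K V =
      ∫ᵛ x, compactIntegralCLM μ K (F.curry x) ∂[ContinuousLinearMap.mul ℝ ℂ; ν] :=
    map_integral_complexMeasure (compactIntegralCLM μ K)
      (fun v c => (integral_const_mul c (fun z => v z)).trans (mul_comm _ _)) hFi
  have h3 : ∀ x, compactIntegralCLM μ K (F.curry x) = ∫ y, k x y ∂μ := fun x =>
    (integral_subtype_comap hK.measurableSet (k x)).trans
      (setIntegral_eq_integral_of_forall_compl_eq_zero fun y hy => hk0 x y hy)
  have h4 : compactIntegralCLM μ K V =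
      ∫ y, (∫ᵛ x, k x y ∂[ContinuousLinearMap.mul ℝ ℂ; ν]) ∂μ := by
    rw [compactIntegralCLM_apply]
    simp only [h1]
    refine (integral_subtype_comap hK.measurableSet
      fun y => ∫ᵛ x, k x y ∂[ContinuousLinearMap.mul ℝ ℂ; ν]).trans ?_
    refine setIntegral_eq_integral_of_forall_compl_eq_zero fun y hy => ?_
    simp only [fun x => hk0 x y hy, VectorMeasure.integral_zero]
  rw [← h4, h2]
  simp only [h3]

end Group


/-! ### Separation and ultraweakly continuous functionals -/

section Ultraweak

variable {E : Type*} [NormedAddCommGroup E] [NormedSpace ℂ E]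

theorem exists_dual_ne_zero_of_notMem (D : Submodule ℂ E) (hD : IsClosed (D : Set E)) {x : E}
    (hx : x ∉ D) : ∃ φ : E →L[ℂ] ℂ, (∀ a ∈ D, φ a = 0) ∧ φ x ≠ 0 := by
  have : IsClosed (D : Set E) := hD
  obtain ⟨φ, hφ⟩ := SeparatingDual.exists_ne_zero (R := ℂ) (x := (D.mkQ x))
    (by simpa [Submodule.Quotient.mk_eq_zero] using hx)
  exact ⟨φ.comp D.mkQL, fun a ha => by
    change φ (D.mkQ a) = 0
    rw [D.mkQ_apply, (Submodule.Quotient.mk_eq_zero D).2 ha, map_zero], hφ⟩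

/-- A sum of two vector functionals is ultraweakly continuous, being given by sequences with two
nonzero entries at most; so its zero set is ultraweakly closed. -/
theorem apply_add_apply_eq_zero_of_mem_closure_ultraweak {s : Set (E →L[ℂ] E)} {T : E →L[ℂ] E}
    (hT : T ∈ @closure _ (ultraweakTopology E) s) {u v : E} {φ ψ : E →L[ℂ] ℂ}
    (h : ∀ S ∈ s, φ (S u) + ψ (S v) = 0) : φ (T u) + ψ (T v) = 0 := by
  set x : ℕ → E := fun n => if n = 0 then u else if n = 1 then v else 0 with hx
  set χ : ℕ → (E →L[ℂ] ℂ) := fun n => if n = 0 then φ else if n = 1 then ψ else 0 with hχ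
  have hout : ∀ n ∉ Finset.range 2, x n = 0 := by
    intro n hn
    have h0 : n ≠ 0 := by rintro rfl; simp at hn
    have h1 : n ≠ 1 := by rintro rfl; simp at hn
    simp [hx, h0, h1]
  have hs : Summable fun n => ‖x n‖ * ‖χ n‖ :=
    summable_of_ne_finset_zero (s := Finset.range 2) fun n hn => by rw [hout n hn]; simp
  have hsum : ∀ S : E →L[ℂ] E, ∑' n, χ n (S (x n)) = φ (S u) + ψ (S v) := by
    intro S
    rw [tsum_eq_sum (s := Finset.range 2) fun n hn => by rw [hout n hn]; simp]
    simp [Finset.sum_range_succ, hx, hχ]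
  have hc : @Continuous _ _ (ultraweakTopology E) _ fun S : E →L[ℂ] E => ∑' n, χ n (S (x n)) :=
    (@continuous_iff_continuousAt _ _ (ultraweakTopology E) _ _).2 fun _ =>
      tendsto_ultraweak_iff.1 tendsto_id x χ hs
  have hcl := @IsClosed.preimage _ _ (ultraweakTopology E) _ _ hc _ (isClosed_singleton (x := (0 : ℂ)))
  have hsub := @closure_minimal _ (ultraweakTopology E) s _
    (fun S hS => by rw [mem_preimage, hsum]; exact h S hS) hcl
  have := hsub hT
  rwa [mem_preimage, hsum] at this

end Ultraweak

section Group

variable {G : Type*} [Group G] [TopologicalSpace G] [IsTopologicalGroup G] [LocallyCompactSpace G]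
  [T2Space G] [MeasurableSpace G] [BorelSpace G] {μ : Measure G} [μ.IsHaarMeasure] [μ.Regular]
  {κ : OrliczNormKind} {Φ : NFunction}

/-! ### Convolution from the right -/

theorem exists_isCompact_conv_right (g : C_c(G, ℂ)) (x : G) : ∃ K : Set G, IsCompact K ∧
    ∀ y, y ∉ K → g (y⁻¹ * x) = 0 := by
  refine ⟨{x} * (tsupport g)⁻¹, isCompact_singleton.mul g.hasCompactSupport.isCompact.inv,
    fun y hy => image_eq_zero_of_notMem_tsupport fun h => hy ?_⟩
  exact ⟨x, rfl, (y⁻¹ * x)⁻¹, Set.inv_mem_inv.2 h, by simp⟩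

theorem integrable_conv_right (h : DeltaTwoOn Φ μ) (u : OrliczSpace κ Φ μ) (g : C_c(G, ℂ))
    (x : G) : Integrable (fun y => u y * g (y⁻¹ * x)) μ := by
  obtain ⟨K, hK, hgK⟩ := exists_isCompact_conv_right g x
  obtain ⟨B, hB⟩ := exists_norm_compactlySupported_le g
  have hgm : AEStronglyMeasurable (fun y : G => g (y⁻¹ * x)) (μ.restrict K) := by
    have h1 := g.continuous.measurable
    have h2 : Measurable fun y : G => y⁻¹ * x := by fun_prop
    exact (h1.comp h2).aestronglyMeasurable
  have h1 : IntegrableOn (fun y => u y * g (y⁻¹ * x)) K μ :=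
    (u.integrableOn h hK.measurableSet hK.measure_lt_top.ne).mul_bdd (c := B) hgm
      (ae_of_all _ fun y => hB _)
  refine (integrableOn_iff_integrable_of_support_subset fun y hy => ?_).1 h1
  by_contra hyK
  exact hy (by simp [hgK y hyK])

/-- The functional `u ↦ (u * g)(x)`. -/
theorem exists_convRightCLM (h : DeltaTwoOn Φ μ) (g : C_c(G, ℂ)) (x : G) :
    ∃ L : OrliczSpace κ Φ μ →L[ℂ] ℂ, ∀ u, L u = ∫ y, u y * g (y⁻¹ * x) ∂μ := by
  obtain ⟨K, hK, hgK⟩ := exists_isCompact_conv_right g x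
  obtain ⟨B, hB⟩ := exists_norm_compactlySupported_le g
  have hB0 : 0 ≤ B := (norm_nonneg _).trans (hB 1)
  refine ⟨LinearMap.mkContinuous
    { toFun := fun u : OrliczSpace κ Φ μ => ∫ y, u y * g (y⁻¹ * x) ∂μ
      map_add' := fun u v => ?_
      map_smul' := fun c u => ?_ } (B * (1 + Φ.complementary 1 * μ.real K)) fun u => ?_,
    fun u => rfl⟩
  · rw [← integral_add (integrable_conv_right h u g x) (integrable_conv_right h v g x)]
    refine integral_congr_ae ?_
    filter_upwards [OrliczSpace.coeFn_add u v] with y hy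
    rw [hy, add_mul]
  · rw [RingHom.id_apply, smul_eq_mul, ← integral_const_mul]
    refine integral_congr_ae ?_
    filter_upwards [OrliczSpace.coeFn_smul c u] with y hy
    rw [hy, mul_assoc]
  · change ‖∫ y, u y * g (y⁻¹ * x) ∂μ‖ ≤ _
    have hui := u.integrableOn h hK.measurableSet (hK.measure_lt_top (μ := μ)).ne
    rw [← setIntegral_eq_integral_of_forall_compl_eq_zero (s := K) fun y hy => by
      rw [hgK y hy, mul_zero]]
    calc ‖∫ y in K, u y * g (y⁻¹ * x) ∂μ‖ ≤ ∫ y in K, ‖u y‖ * B ∂μ :=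
          norm_integral_le_of_norm_le (hui.norm.mul_const B) (ae_of_all _ fun y => by
            rw [norm_mul]; exact mul_le_mul_of_nonneg_left (hB _) (norm_nonneg _))
      _ = B * ∫ y in K, ‖u y‖ ∂μ := by rw [integral_mul_const, mul_comm]
      _ ≤ _ := by
          rw [mul_assoc]
          exact mul_le_mul_of_nonneg_left
            (u.setIntegral_norm_le h hK.measurableSet hK.measure_lt_top.ne) hB0

/-- The pairs `(u, v)` with `v = u * g`. -/
theorem exists_convRight_submodule (h : DeltaTwoOn Φ μ) (g : C_c(G, ℂ)) :
    ∃ D : Submodule ℂ (OrliczSpace κ Φ μ × OrliczSpace κ Φ μ),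
      IsClosed (D : Set (OrliczSpace κ Φ μ × OrliczSpace κ Φ μ)) ∧
        ∀ p, p ∈ D ↔ ∀ᵐ x ∂μ, p.2 x = ∫ y, p.1 y * g (y⁻¹ * x) ∂μ := by
  choose L hL using exists_convRightCLM (κ := κ) h g
  refine ⟨{ carrier := {p | ∀ᵐ x ∂μ, p.2 x = L x p.1}
            add_mem' := fun {p q} hp hq => ?_
            zero_mem' := ?_
            smul_mem' := fun c p hp => ?_ }, ?_, fun p => ?_⟩
  · filter_upwards [hp, hq, OrliczSpace.coeFn_add p.2 q.2] with x h1 h2 h3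
    rw [Prod.fst_add, Prod.snd_add, h3, h1, h2, map_add]
  · filter_upwards [OrliczSpace.coeFn_zero (κ := κ) (Φ := Φ) (μ := μ)] with x h1
    rw [Prod.fst_zero, Prod.snd_zero, h1, map_zero]
  · filter_upwards [hp, OrliczSpace.coeFn_smul c p.2] with x h1 h2
    rw [Prod.smul_fst, Prod.smul_snd, h2, h1, map_smul, smul_eq_mul]
  -- The functional `L x` is continuous for every `x`, so a subsequence converging almost everywhere
  -- in the second component carries the relation to the limit.
  · refine isClosed_of_closure_subset fun p hp => ?_
    obtain ⟨q, hq, hqp⟩ := mem_closure_iff_seq_limit.1 hp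
    obtain ⟨ns, hns, hae⟩ := OrliczSpace.exists_seq_tendsto_ae h
      ((continuous_snd.tendsto p).comp hqp)
    filter_upwards [hae, ae_all_iff.2 hq] with x h1 h2
    refine tendsto_nhds_unique h1 ?_
    have h3 := (((L x).continuous.tendsto _).comp ((continuous_fst.tendsto p).comp hqp)).comp
      hns.tendsto_atTop
    exact h3.congr fun i => (h2 (ns i)).symm
  · simp only [← hL]
    rfl

/-! ### Convolution operators of regular measures -/

/-- Associativity `(ν * f) * g = ν * (f * g)` at a point: interchange the integrals, then translate
`z` by `y`. -/
theorem integral_measureConvolution (ν : ComplexMeasure G) (f g : C_c(G, ℂ)) (x : G) :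
    ∫ z, (∫ᵛ y, f (y⁻¹ * z) ∂[ContinuousLinearMap.mul ℝ ℂ; ν]) * g (z⁻¹ * x) ∂μ =
      ∫ᵛ y, convCc μ f g (y⁻¹ * x) ∂[ContinuousLinearMap.mul ℝ ℂ; ν] := by
  have hf := f.continuous
  have hg := g.continuous
  have hcs : HasCompactSupport (Function.uncurry fun y z : G => g (z⁻¹ * x) * f (y⁻¹ * z)) := by
    obtain ⟨K, hK, hgK⟩ := exists_isCompact_conv_right g x
    refine HasCompactSupport.intro ((hK.mul f.hasCompactSupport.isCompact.inv).prod hK) ?_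
    rintro ⟨y, z⟩ hyz
    change g (z⁻¹ * x) * f (y⁻¹ * z) = 0
    by_contra hne
    have hz : z ∈ K := by
      by_contra hz
      exact hne (by rw [hgK z hz, zero_mul])
    have hy : y⁻¹ * z ∈ tsupport f := by
      by_contra hy
      exact hne (by rw [image_eq_zero_of_notMem_tsupport hy, mul_zero])
    exact hyz ⟨⟨z, hz, (y⁻¹ * z)⁻¹, Set.inv_mem_inv.2 hy, by simp⟩, hz⟩
  have hc : Continuous (Function.uncurry fun y z : G => g (z⁻¹ * x) * f (y⁻¹ * z)) := by
    change Continuous fun p : G × G => g (p.2⁻¹ * x) * f (p.1⁻¹ * p.2)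
    fun_prop
  have hfi : ∀ z : G, ν.Integrable fun y => f (y⁻¹ * z) := fun z =>
    integrable_complexMeasure ν (by fun_prop) (f.hasCompactSupport.comp_homeomorph
      ((Homeomorph.inv G).trans (Homeomorph.mulRight z)))
  have h1 : ∀ z : G, (∫ᵛ y, f (y⁻¹ * z) ∂[ContinuousLinearMap.mul ℝ ℂ; ν]) * g (z⁻¹ * x) =
      ∫ᵛ y, g (z⁻¹ * x) * f (y⁻¹ * z) ∂[ContinuousLinearMap.mul ℝ ℂ; ν] := fun z => by
    rw [mul_comm, const_mul_integral_complexMeasure (hfi z)]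
  simp only [h1]
  rw [integral_integral_complexMeasure_swap ν μ hc hcs]
  congr 1 with y
  rw [convCc_apply, ← integral_mul_left_eq_self _ y]
  refine integral_congr_ae (ae_of_all _ fun z => ?_)
  simp only [mul_inv_rev, mul_assoc, inv_mul_cancel_left]
  exact mul_comm _ _

/-- The operator is described through some representative of the class of `f`. By `ae_ae_inv_mul`,
which needs the variation of `ν` to be regular, `f` itself may be used for almost every `x`. -/
theorem measureConvolution_ofCc {ν : ComplexMeasure G} (hν : ν ∈ measureAlgebra G)
    {T : OrliczSpace κ Φ μ →L[ℂ] OrliczSpace κ Φ μ} (hT : IsLeftConvolutionOperator ν T)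
    (f : C_c(G, ℂ)) : ∀ᵐ x ∂μ, T (OrliczSpace.ofCc f) x =
      ∫ᵛ y, f (y⁻¹ * x) ∂[ContinuousLinearMap.mul ℝ ℂ; ν] := by
  have := isFiniteMeasure_variation ν
  have : ν.variation.Regular := hν
  filter_upwards [hT (OrliczSpace.ofCc f), ae_ae_inv_mul (ρ := ν.variation)
    (OrliczSpace.coeFn_ofCc (κ := κ) (Φ := Φ) (μ := μ) f)] with x h1 h2
  rw [h1.2]
  exact VectorMeasure.integral_congr_ae h2

theorem ae_convolution_of_isLeftConvolutionOperator {ν : ComplexMeasure G}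
    (hν : ν ∈ measureAlgebra G) {T : OrliczSpace κ Φ μ →L[ℂ] OrliczSpace κ Φ μ}
    (hT : IsLeftConvolutionOperator ν T) (f g : C_c(G, ℂ)) :
    ∀ᵐ x ∂μ, T (OrliczSpace.ofCc (convCc μ f g)) x =
      ∫ y, T (OrliczSpace.ofCc f) y * g (y⁻¹ * x) ∂μ := by
  filter_upwards [measureConvolution_ofCc hν hT (convCc μ f g)] with x hx
  rw [hx, ← integral_measureConvolution]
  refine integral_congr_ae ?_
  filter_upwards [measureConvolution_ofCc hν hT f] with z hz
  rw [hz]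

/-! ### Pseudomeasures commute with right convolution -/

theorem pseudomeasures_subset_convolutionOperators (h : DeltaTwoOn Φ μ) :
    pseudomeasures κ Φ μ ⊆ convolutionOperators κ Φ μ := by
  intro T hT f g hf hfc hg hgc
  let f' : C_c(G, ℂ) := ⟨⟨f, hf⟩, hfc⟩
  let g' : C_c(G, ℂ) := ⟨⟨g, hg⟩, hgc⟩
  refine ⟨OrliczSpace.ofCc f', OrliczSpace.ofCc (convCc μ f' g'), OrliczSpace.coeFn_ofCc f', ?_, ?_⟩
  · filter_upwards [OrliczSpace.coeFn_ofCc (κ := κ) (Φ := Φ) (μ := μ) (convCc μ f' g')] with x hx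
    refine ⟨Continuous.integrable_of_hasCompactSupport ?_ hfc.mul_right, hx⟩
    fun_prop
  · obtain ⟨D, hDc, hD⟩ := exists_convRight_submodule (κ := κ) h g'
    have hmem : (T (OrliczSpace.ofCc f'), T (OrliczSpace.ofCc (convCc μ f' g'))) ∈ D := by
      by_contra hnot
      obtain ⟨φ, hφ, hne⟩ := exists_dual_ne_zero_of_notMem D hDc hnot
      -- The separating functional on the product splits into one functional per component, which is
      -- the form covered by `apply_add_apply_eq_zero_of_mem_closure_ultraweak`.
      have hsplit : ∀ a b, φ (a, b) = φ.comp (.inl ℂ _ _) a + φ.comp (.inr ℂ _ _) b := by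
        intro a b
        change φ (a, b) = φ (a, 0) + φ (0, b)
        rw [← map_add, Prod.mk_add_mk, add_zero, zero_add]
      refine hne ?_
      rw [hsplit]
      refine apply_add_apply_eq_zero_of_mem_closure_ultraweak hT ?_
      rintro S ⟨ν, hν, hS⟩
      rw [← hsplit]
      exact hφ _ ((hD _).2 (ae_convolution_of_isLeftConvolutionOperator hν hS f' g'))
    filter_upwards [(hD _).1 hmem] with x hx
    exact ⟨integrable_conv_right h _ g' x, hx⟩

end Group

end OrliczConv

end

theorem mainTheorem6 {G : Type*} [Group G] [TopologicalSpace G] [IsTopologicalGroup G]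
    [LocallyCompactSpace G] [T2Space G] [MeasurableSpace G] [BorelSpace G]
    (μ : Measure G) [μ.IsHaarMeasure] [μ.Regular]
    (κ : OrliczNormKind) (Φ : NFunction)
    (hΦ : DeltaTwo G Φ) (hΨ : DeltaTwo G Φ.complementary) :
    MultiplierInclusions (pseudofunctions κ Φ μ) (pseudomeasures κ Φ μ) ∧
      pseudomeasures κ Φ μ ⊆ convolutionOperators κ Φ μ :=
  ⟨multiplierInclusions_pseudofunctions hΦ.deltaTwoOn,
    pseudomeasures_subset_convolutionOperators hΦ.deltaTwoOn⟩
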